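/- Let $K$ be a field of characteristic $0$; all Lie algebras and vector spaces are over $K$ (of arbitrary dimension). **Definitions.** A *strict Lie 2-algebra* is a category object $(\mathfrak g_0,\mathfrak g_{-1},s,t,i,m)$ in Lie algebras; 1- and 2-morphisms are internal functors and internal natural transformations. A *crossed module* is a Lie algebra morphism $\mu:\mathfrak h\to\mathfrak g$ with an action of $\mathfrak g$ on $\mathfrak h$ by derivations such that $\mu(x\cdot a)=[x,\mu(a)]$ and $\mu(a)\cdot b=[a,b]$; a morphism is a pair of Lie algebra morphisms $(\varphi,\psi)$ compatible with $\mu$ and the actions, and a 2-morphism $(\varphi,\psi)\Rightarrow(\varphi',\psi')$ is a linear map $\eta:\mathfrak g\to\mathfrak h'$ with $\mu'\eta=\psi'-\psi$, $\eta\mu=\varphi'-\varphi$, $\eta[x,y]=\psi(x)\cdot\eta(y)-\psi(y)\cdot\eta(x)+[\eta(x),\eta(y)]$. *Equivalence* of crossed modules is the equivalence relation generated by the existence of a morphism inducing isomorphisms on $\ker\mu$ and $\operatorname{coker}\mu$. A *semi-strict Lie 2-algebra* is a 2-vector space (category object in vector spaces) with a skew-symmetric bilinear functorial bracket and a completely antisymmetric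 trilinear natural isomorphism $J_{x,y,z}:[[x,y],z]\to[x,[y,z]]+[[x,z],y]$ satisfying the Jacobiator identity; with the homomorphisms (linear functors $F$ with a skew-symmetric bilinear natural transformation $F_2(x,y):[F_0x,F_0y]\to F_0[x,y]$ compatible with $J$) and 2-homomorphisms of Baez and Crans these form a 2-category, in which equivalences and isomorphisms are understood. Its underlying complex is $d=t|_{\ker s}:\ker s\to L_0$; it is *skeletal* if $d=0$. A *triplet* $(\bar{\mathfrak g},V,c)$ is a Lie algebra, a $\bar{\mathfrak g}$-module and a class $c\in H^3(\bar{\mathfrak g},V)$; an isomorphism of triplets is a pair of compatible isomorphisms carrying one class to the other. **The arrows.** $\alpha$ sends a strict Lie 2-algebra to the crossed module $t|_{\ker s}:\ker s\to\mathfrak g_0$ with action $x\cdot a=[i(x),a]$; on 1-morphisms it restricts, and on 2-morphisms it takes the arrow part. $\beta$ sends $\mu:\mathfrak h\to\mathfrak g$ to $(\operatorname{coker}\mu,\ker\mu,[\gamma])$, where for a linear section $\rho$ of $\mathfrak g\to\operatorname{coker}\mu$ and an alternating bilinear $b:\operatorname{coker}\mu\times\operatorname{coker}\mu\to\mathfrak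 h$ with $\mu(b(x,y))=\rho([x,y])-[\rho(x),\rho(y)]$ one puts $$\gamma(x,y,z)=\rho(x)\cdot b(y,z)-\rho(y)\cdot b(x,z)+\rho(z)\cdot b(x,y)-b([x,y],z)+b([x,z],y)-b([y,z],x)\in\ker\mu .$$ The inclusion regards a strict Lie 2-algebra as a semi-strict one with identity Jacobiator. A *skeletal model* of a semi-strict $L$ is a skeletal $S$ with an equivalence $\phi:S\to L$. $\gamma$ sends a skeletal $S$ to $(S_0,\ker s,[l_3])$, where $x\in S_0$ acts on $\ker s$ by $[1_x,-]$ and $l_3$ is the arrow part of $J$. **Theorem.** 1. $\alpha$ is an equivalence between the categories of strict Lie 2-algebras and of crossed modules (a bijection on isomorphism classes of objects and on 1-morphisms), and is bijective on 2-morphisms. 2. The class $[\gamma]$ of a crossed module is independent of $(\rho,b)$, and $\beta$ induces a bijection from equivalence classes of crossed modules to isomorphism classes of triplets. For fixed $\bar{\mathfrak g}$ and $V$, the class also induces a bijection onto $H^3(\bar{\mathfrak g},V)$ from the crossed modules with cokernel $\bar{\mathfrak g}$ and kernel $V$, modulo the equivalence generated by morphisms inducing the identities of $\bar{\mathfrak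 g}$ and $V$. 3. For every semi-strict $L$ and every linear section $\sigma$ of $L_0\to\operatorname{coker}d$ there is a skeletal model $\phi:S\to L$ with $S_0\cong\operatorname{coker} d$ and $\ker s_S\cong\ker d$ as vector spaces, under which $\phi_0=\sigma$ and $\phi$ restricts on $\ker s_S$ to the inclusion of $\ker d$. 4. $\gamma$ induces a bijection from equivalence classes of skeletal Lie 2-algebras to isomorphism classes of triplets. A homomorphism between skeletal Lie 2-algebras is an equivalence if and only if it is an isomorphism; and for linear isomorphisms $e:S_0\to T_0$, $f:\ker s_S\to\ker s_T$ with $S,T$ skeletal, $(e,f)$ is induced by an isomorphism $S\to T$ if and only if it is an isomorphism of triplets $\gamma(S)\to\gamma(T)$. 5. The diagram commutes: for every strict Lie 2-algebra $G$ and every skeletal model $\phi:S\to G$ of $G$ as a semi-strict Lie 2-algebra, the maps $S_0\to\operatorname{coker}$ and $\ker s_S\to\ker$ induced by $\phi_0$ and $\phi_1$ form an isomorphism of triplets $\gamma(S)\cong\beta(\alpha(G))$. 6. Hence the two classifications agree: strict Lie 2-algebras $G,H$ are equivalent as semi-strict Lie 2-algebras if and only if the crossed modules $\alpha(G),\alpha(H)$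 are equivalent. -/

import Mathlib

universe u

set_option linter.unusedSectionVars false
set_option linter.unusedSimpArgs false

namespace Lie2

open LieModule.Cohomology CategoryTheory

section Cohomology

variable (K : Type u) [Field K]
variable (g : Type u) [LieRing g] [LieAlgebra K g]
variable (V : Type u) [AddCommGroup V] [Module K V] [LieRingModule g V] [LieModule K g V]

/-- The Chevalley-Eilenberg 3-cocycles of `g` with values in `V`: alternating trilinear maps
killed by the Chevalley-Eilenberg differential. -/
def Z3 : Submodule K (g →ₗ[K] g →ₗ[K] g →ₗ[K] V) where
  carrier := {w | (∀ x z, w x x z = 0) ∧ (∀ x y, w x y y = 0) ∧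
    ∀ a b c d,
      ⁅a, w b c d⁆ - ⁅b, w a c d⁆ + ⁅c, w a b d⁆ - ⁅d, w a b c⁆
      - w ⁅a, b⁆ c d + w ⁅a, c⁆ b d - w ⁅a, d⁆ b c
      - w ⁅b, c⁆ a d + w ⁅b, d⁆ a c - w ⁅c, d⁆ a b = 0}
  zero_mem' := by simp
  add_mem' := by
    rintro v w ⟨h1, h2, h3⟩ ⟨h1', h2', h3'⟩
    refine ⟨fun x z => by simp [h1, h1'], fun x y => by simp [h2, h2'], fun a b c d => ?_⟩
    have e := congrArg₂ (· + ·) (h3 a b c d) (h3' a b c d)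
    simp only [add_zero] at e
    rw [← e]
    simp only [LinearMap.add_apply, lie_add]
    abel
  smul_mem' := by
    rintro r w ⟨h1, h2, h3⟩
    refine ⟨fun x z => by simp [h1], fun x y => by simp [h2], fun a b c d => ?_⟩
    have e := congrArg (r • ·) (h3 a b c d)
    simp only [smul_zero] at e
    rw [← e]
    simp only [LinearMap.smul_apply, lie_smul]
    module

instance : AddCommGroup (Z3 K g V) := 
  Submodule.addCommGroup (R := K) (M := g →ₗ[K] g →ₗ[K] g →ₗ[K] V) _

/-- The 3-coboundaries: the image of the Chevalley-Eilenberg differential on 2-cochains,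
`(d b)(x,y,z) = x·b(y,z) - y·b(x,z) + z·b(x,y) - b([x,y],z) + b([x,z],y) - b([y,z],x)`. -/
def B3 : Submodule K (g →ₗ[K] g →ₗ[K] g →ₗ[K] V) := LinearMap.range (d₂₃ K g V)

/-- The third Lie algebra cohomology `H³(g, V)`. -/
abbrev H3 : Type u := Z3 K g V ⧸ (B3 K g V).comap (Z3 K g V).subtype

end Cohomology

section Transport

variable {K : Type u} [Field K]
variable {g : Type u} [LieRing g] [LieAlgebra K g]
variable {V : Type u} [AddCommGroup V] [Module K V] [LieRingModule g V] [LieModule K g V]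
variable {g' : Type u} [LieRing g'] [LieAlgebra K g']
variable {V' : Type u} [AddCommGroup V'] [Module K V'] [LieRingModule g' V'] [LieModule K g' V']

/-- Transport of trilinear maps: `w ↦ f ∘ w ∘ (e⁻¹ × e⁻¹ × e⁻¹)`. -/
def transport₃ (e : g ≃ₗ⁅K⁆ g') (f : V ≃ₗ[K] V') :
    (g →ₗ[K] g →ₗ[K] g →ₗ[K] V) →ₗ[K] (g' →ₗ[K] g' →ₗ[K] g' →ₗ[K] V') where
  toFun w :=
    { toFun := fun x =>
        { toFun := fun y =>
            { toFun := fun z => f (w (e.symm x) (e.symm y) (e.symm z))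
              map_add' := by simp
              map_smul' := by simp }
          map_add' := by intros; ext; simp
          map_smul' := by intros; ext; simp }
      map_add' := by intros; ext; simp
      map_smul' := by intros; ext; simp }
  map_add' := by intros; ext; simp
  map_smul' := by intros; ext; simp

@[simp] theorem transport₃_apply (e : g ≃ₗ⁅K⁆ g') (f : V ≃ₗ[K] V')
    (w : g →ₗ[K] g →ₗ[K] g →ₗ[K] V) (x y z : g') :
    transport₃ e f w x y z = f (w (e.symm x) (e.symm y) (e.symm z)) := rfl

theorem lie_apply_of_equivariant {e : g ≃ₗ⁅K⁆ g'} {f : V ≃ₗ[K] V'}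
    (hf : ∀ x v, f ⁅x, v⁆ = ⁅e x, f v⁆) (x : g') (v : V) : ⁅x, f v⁆ = f ⁅e.symm x, v⁆ := by
  rw [hf, e.apply_symm_apply]

/-- Transport of 3-cocycles along an isomorphism of pairs (Lie algebra, module). -/
def Z3.transport (e : g ≃ₗ⁅K⁆ g') (f : V ≃ₗ[K] V') (hf : ∀ x v, f ⁅x, v⁆ = ⁅e x, f v⁆) :
    Z3 K g V →ₗ[K] Z3 K g' V' :=
  (transport₃ e f).restrict (by
    rintro w ⟨h1, h2, h3⟩
    refine ⟨fun x z => by simp [h1], fun x y => by simp [h2], fun a b c d => ?_⟩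
    simp only [transport₃_apply, lie_apply_of_equivariant hf, LieEquiv.map_lie]
    have := congrArg f (h3 (e.symm a) (e.symm b) (e.symm c) (e.symm d))
    simpa only [map_add, map_sub, map_zero] using this)

/-- Transport of classes along an isomorphism of pairs (Lie algebra, module). -/
def H3.transport (e : g ≃ₗ⁅K⁆ g') (f : V ≃ₗ[K] V') (hf : ∀ x v, f ⁅x, v⁆ = ⁅e x, f v⁆) :
    H3 K g V →ₗ[K] H3 K g' V' :=
  Submodule.mapQ _ _ (Z3.transport e f hf) (by
    rintro ⟨w, hw⟩ ⟨b, hb⟩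
    change d₂₃ K g V b = w at hb
    refine ⟨⟨{ toFun := fun x =>
                { toFun := fun y => f (b (e.symm x) (e.symm y))
                  map_add' := by simp
                  map_smul' := by simp }
               map_add' := by intros; ext; simp
               map_smul' := by intros; ext; simp }, fun x => by simp⟩, ?_⟩
    ext x y z
    subst hb
    change ⁅x, f _⁆ - ⁅y, f _⁆ + ⁅z, f _⁆ - f (b (e.symm ⁅x, y⁆) _) + f (b (e.symm ⁅x, z⁆) _)
      - f (b (e.symm ⁅y, z⁆) _) = f (d₂₃ K g V b (e.symm x) (e.symm y) (e.symm z))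
    simp only [lie_apply_of_equivariant hf, LieEquiv.map_lie, d₂₃_apply, map_add, map_sub])

end Transport

/-! ### Triplets -/

/-- A triplet: a Lie algebra `g`, a `g`-module `V` and a class in `H³(g, V)`. -/
structure Triplet (K : Type u) [Field K] where
  g : Type u
  V : Type u
  [lieRing : LieRing g]
  [lieAlgebra : LieAlgebra K g]
  [addCommGroup : AddCommGroup V]
  [module : Module K V]
  [lieRingModule : LieRingModule g V]
  [lieModule : LieModule K g V]
  cls : H3 K g V

attribute [instance] Triplet.lieRing Triplet.lieAlgebra Triplet.addCommGroup Triplet.module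
  Triplet.lieRingModule Triplet.lieModule

/-- An isomorphism of triplets. -/
structure Triplet.Iso {K : Type u} [Field K] (T T' : Triplet K) where
  e : T.g ≃ₗ⁅K⁆ T'.g
  f : T.V ≃ₗ[K] T'.V
  equivariant : ∀ x v, f ⁅x, v⁆ = ⁅e x, f v⁆
  map_cls : H3.transport e f equivariant T.cls = T'.cls

/-- Two triplets are isomorphic. -/
def Triplet.Isomorphic {K : Type u} [Field K] (T T' : Triplet K) : Prop :=
  Nonempty (Triplet.Iso T T')

/-! ### Crossed modules -/

/-- A crossed module of Lie algebras `μ : h → g`. -/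
structure CrossedModule (K : Type u) [Field K] where
  h : Type u
  g : Type u
  [lieRingH : LieRing h]
  [lieAlgebraH : LieAlgebra K h]
  [lieRingG : LieRing g]
  [lieAlgebraG : LieAlgebra K g]
  μ : h →ₗ⁅K⁆ g
  act : g →ₗ⁅K⁆ LieDerivation K h h
  μ_act : ∀ x a, μ (act x a) = ⁅x, μ a⁆
  act_μ : ∀ a b, act (μ a) b = ⁅a, b⁆

attribute [instance] CrossedModule.lieRingH CrossedModule.lieAlgebraH CrossedModule.lieRingG
  CrossedModule.lieAlgebraG

namespace CrossedModule

variable {K : Type u} [Field K]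

/-- A morphism of crossed modules. -/
@[ext] structure Hom (X Y : CrossedModule K) where
  φ : X.h →ₗ⁅K⁆ Y.h
  ψ : X.g →ₗ⁅K⁆ Y.g
  comm : ∀ a, ψ (X.μ a) = Y.μ (φ a)
  map_act : ∀ x a, φ (X.act x a) = Y.act (ψ x) (φ a)

instance : Category (CrossedModule K) where
  Hom := Hom
  id X := ⟨LieHom.id, LieHom.id, fun _ => rfl, fun _ _ => rfl⟩
  comp F G := ⟨G.φ.comp F.φ, G.ψ.comp F.ψ, fun a => by simp [F.comm, G.comm],
    fun x a => by simp [F.map_act, G.map_act]⟩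

/-- A 2-morphism (homotopy) between morphisms of crossed modules. -/
@[ext] structure TwoHom {X Y : CrossedModule K} (F F' : X ⟶ Y) where
  η : X.g →ₗ[K] Y.h
  μ_η : ∀ x, Y.μ (η x) = F'.ψ x - F.ψ x
  η_μ : ∀ a, η (X.μ a) = F'.φ a - F.φ a
  η_lie : ∀ x y, η ⁅x, y⁆ = Y.act (F.ψ x) (η y) - Y.act (F.ψ y) (η x) + ⁅η x, η y⁆

variable (X : CrossedModule K)

@[simp] theorem act_lie (x y : X.g) (a : X.h) :
    X.act ⁅x, y⁆ a = X.act x (X.act y a) - X.act y (X.act x a) := by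
  rw [LieHom.map_lie, LieDerivation.commutator_apply]

/-- The image of `μ`, an ideal of `g`. -/
def rangeIdeal : LieIdeal K X.g where
  toSubmodule := LinearMap.range (X.μ : X.h →ₗ[K] X.g)
  lie_mem := by
    rintro x _ ⟨a, rfl⟩
    exact ⟨X.act x a, X.μ_act x a⟩

/-- The Lie algebra `coker μ`. -/
abbrev Coker : Type u := X.g ⧸ X.rangeIdeal

/-- The projection `g → coker μ`. -/
abbrev toCoker (x : X.g) : X.Coker := LieSubmodule.Quotient.mk x

/-- The vector space `ker μ`. -/
abbrev Ker : Type u := LinearMap.ker (X.μ : X.h →ₗ[K] X.g)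

theorem μ_coe (v : X.Ker) : X.μ (v : X.h) = 0 := v.2

/-- The action of `g` on `ker μ`. -/
def kerAct : X.g →ₗ[K] Module.End K X.Ker where
  toFun x := ((X.act x : LieDerivation K X.h X.h) : X.h →ₗ[K] X.h).restrict (by
    intro a ha
    change X.μ a = 0 at ha
    change X.μ (X.act x a) = 0
    rw [X.μ_act, ha, lie_zero])
  map_add' x y := by ext v; simp
  map_smul' r x := by ext v; simp

@[simp] theorem coe_kerAct (x : X.g) (v : X.Ker) : (X.kerAct x v : X.h) = X.act x v := rfl

/-- The action of `coker μ` on `ker μ` induced by the action of `g` on `h`. -/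
def cokerAct : X.Coker →ₗ[K] Module.End K X.Ker :=
  Submodule.liftQ _ X.kerAct (by
    rintro _ ⟨a, rfl⟩
    ext v
    change X.act (X.μ a) v = 0
    rw [X.act_μ, ← lie_skew, ← X.act_μ, X.μ_coe]
    simp)

instance : LieRingModule X.Coker X.Ker where
  bracket c v := X.cokerAct c v
  add_lie _ _ _ := by simp [Bracket.bracket]
  lie_add _ _ _ := by simp [Bracket.bracket]
  leibniz_lie c d v := by
    induction c using Submodule.Quotient.induction_on with | _ x
    induction d using Submodule.Quotient.induction_on with | _ y
    apply Subtype.ext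
    change X.act x (X.act y v) = X.act ⁅x, y⁆ v + X.act y (X.act x v)
    simp

@[simp] theorem coe_toCoker_lie (x : X.g) (v : X.Ker) :
    ((⁅X.toCoker x, v⁆ : X.Ker) : X.h) = X.act x v := rfl

instance : LieModule K X.Coker X.Ker where
  smul_lie _ _ _ := by simp [Bracket.bracket]
  lie_smul _ _ _ := by simp [Bracket.bracket]

/-- The choices made to compute the characteristic class of a crossed module: a linear section
`ρ` of `g → coker μ` and a bilinear alternating `b` lifting the default of `ρ` to be a
homomorphism. -/
structure SectionData where
  ρ : X.Coker →ₗ[K] X.g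
  toCoker_ρ : ∀ c, X.toCoker (ρ c) = c
  b : twoCochain K X.Coker X.h
  μ_b : ∀ c d, X.μ (b c d) = ρ ⁅c, d⁆ - ⁅ρ c, ρ d⁆


namespace SectionData

variable {X} (D : X.SectionData)

theorem nonempty : Nonempty X.SectionData := by
  obtain ⟨ρ, hρ⟩ := LinearMap.exists_rightInverse_of_surjective
    (X.rangeIdeal.toSubmodule.mkQ) (Submodule.range_mkQ _)
  obtain ⟨τ, hτ⟩ := LinearMap.exists_rightInverse_of_surjective
    (X.μ : X.h →ₗ[K] X.g).rangeRestrict (LinearMap.range_rangeRestrict _)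
  obtain ⟨θ, hθ⟩ := LinearMap.exists_extend τ
  have hρ' : ∀ c : X.Coker, X.toCoker (ρ c) = c := fun c => LinearMap.congr_fun hρ c
  have hθ' : ∀ y ∈ X.rangeIdeal, X.μ (θ y) = y := by
    intro y hy
    have h1 : θ y = τ ⟨y, hy⟩ := LinearMap.congr_fun hθ ⟨y, hy⟩
    have h2 := congrArg Subtype.val (LinearMap.congr_fun hτ ⟨y, hy⟩)
    rw [h1]
    exact h2
  refine ⟨⟨ρ, hρ', ⟨LinearMap.mk₂ K (fun c d => θ (ρ ⁅c, d⁆ - ⁅ρ c, ρ d⁆)) ?_ ?_ ?_ ?_,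
    fun c => ?_⟩, fun c d => hθ' _ ?_⟩⟩
  · intros; simp only [add_lie, map_add, map_sub]; abel
  · intros; simp only [smul_lie, map_smul, map_sub, smul_sub]
  · intros; simp only [lie_add, map_add, map_sub]; abel
  · intros; simp only [lie_smul, map_smul, map_sub, smul_sub]
  · simp
  · rw [← LieSubmodule.Quotient.mk_eq_zero']
    change X.toCoker (ρ ⁅c, d⁆ - ⁅ρ c, ρ d⁆) = 0
    have : X.toCoker (ρ ⁅c, d⁆ - ⁅ρ c, ρ d⁆) =
      X.toCoker (ρ ⁅c, d⁆) - ⁅X.toCoker (ρ c), X.toCoker (ρ d)⁆ := rfl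
    rw [this, hρ', hρ', hρ', sub_self]

/-- The formal Chevalley-Eilenberg differential of `b`, computed in `h`, where `c` "acts" by
`ρ c`. -/
def formalD (x y z : X.Coker) : X.h :=
  X.act (D.ρ x) (D.b y z) - X.act (D.ρ y) (D.b x z) + X.act (D.ρ z) (D.b x y)
    - D.b ⁅x, y⁆ z + D.b ⁅x, z⁆ y - D.b ⁅y, z⁆ x

theorem μ_formalD (x y z : X.Coker) : X.μ (D.formalD x y z) = 0 := by
  have h1 : D.ρ ⁅⁅x, y⁆, z⁆ - D.ρ ⁅⁅x, z⁆, y⁆ + D.ρ ⁅⁅y, z⁆, x⁆ = 0 := by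
    rw [← map_sub, ← map_add]
    convert map_zero D.ρ
    rw [lie_lie, ← lie_skew ⁅x, z⁆ y, ← lie_skew ⁅y, z⁆ x]
    abel
  have h2 : ⁅D.ρ x, ⁅D.ρ y, D.ρ z⁆⁆ = ⁅⁅D.ρ x, D.ρ y⁆, D.ρ z⁆ + ⁅D.ρ y, ⁅D.ρ x, D.ρ z⁆⁆ :=
    leibniz_lie _ _ _
  simp only [formalD, map_add, map_sub, X.μ_act, D.μ_b, lie_sub, h2]
  rw [← lie_skew (D.ρ x) (D.ρ ⁅y, z⁆), ← lie_skew (D.ρ y) (D.ρ ⁅x, z⁆),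
    ← lie_skew (D.ρ z) (D.ρ ⁅x, y⁆), ← lie_skew (D.ρ z) ⁅D.ρ x, D.ρ y⁆]
  refine Eq.trans ?_ ((congrArg Neg.neg h1).trans neg_zero)
  abel

theorem b_skew (x y : X.Coker) : D.b x y = - D.b y x := (twoCochain_skew D.b y x).symm

/-- `formalD` as a trilinear map with values in `ker μ`. -/
def formalD₃ : X.Coker →ₗ[K] X.Coker →ₗ[K] X.Coker →ₗ[K] X.Ker where
  toFun x :=
    { toFun := fun y =>
        { toFun := fun z => ⟨D.formalD x y z, D.μ_formalD x y z⟩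
          map_add' := by
            intros; apply Subtype.ext; simp [formalD]; abel
          map_smul' := by
            intros; apply Subtype.ext; simp [formalD]; module }
      map_add' := by
        intros; ext; simp [formalD]; abel
      map_smul' := by
        intros; ext; simp [formalD]; module }
  map_add' := by
    intros; ext; simp [formalD]; abel
  map_smul' := by
    intros; ext; simp [formalD]; module

@[simp] theorem coe_formalD₃ (x y z : X.Coker) : (D.formalD₃ x y z : X.h) =
  X.act (D.ρ x) (D.b y z) - X.act (D.ρ y) (D.b x z) + X.act (D.ρ z) (D.b x y)
    - D.b ⁅x, y⁆ z + D.b ⁅x, z⁆ y - D.b ⁅y, z⁆ x := rfl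

theorem coe_lie (c : X.Coker) (v : X.Ker) : ((⁅c, v⁆ : X.Ker) : X.h) = X.act (D.ρ c) v := by
  conv_lhs => rw [← D.toCoker_ρ c]
  rfl

theorem act_act (x y : X.Coker) (a : X.h) :
    X.act (D.ρ x) (X.act (D.ρ y) a) =
      X.act (D.ρ y) (X.act (D.ρ x) a) + X.act (D.ρ ⁅x, y⁆) a - ⁅D.b x y, a⁆ := by
  rw [← X.act_μ, D.μ_b, map_sub, LieDerivation.sub_apply, X.act_lie]
  abel

theorem b_jacobi (x y z w : X.Coker) :
    D.b ⁅⁅x, y⁆, z⁆ w = D.b ⁅⁅x, z⁆, y⁆ w - D.b ⁅⁅y, z⁆, x⁆ w := by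
  rw [← LinearMap.sub_apply, ← map_sub]
  congr 2
  rw [lie_lie, ← lie_skew ⁅x, z⁆ y, ← lie_skew ⁅y, z⁆ x]
  abel

/-- The 3-cocycle attached to a choice of sections. -/
def cocycle : Z3 K X.Coker X.Ker :=
  ⟨D.formalD₃, by
    refine ⟨fun x z => ?_, fun x y => ?_, fun x y z w => ?_⟩
    · apply Subtype.ext
      simp
    · apply Subtype.ext
      simp
    · apply Subtype.ext
      simp only [AddSubgroupClass.coe_sub, Submodule.coe_add, Submodule.coe_zero, D.coe_lie,
        coe_formalD₃, map_add, map_sub]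
      rw [D.act_act x y, D.act_act x z, D.act_act x w, D.act_act y z, D.act_act y w,
        D.act_act z w, ← lie_skew (D.b x y), ← lie_skew (D.b x z), ← lie_skew (D.b x w),
        D.b_jacobi x y z w, D.b_jacobi x y w z, D.b_jacobi x z w y, D.b_jacobi y z w x,
        D.b_skew ⁅x, y⁆ ⁅z, w⁆, D.b_skew ⁅x, z⁆ ⁅y, w⁆, D.b_skew ⁅x, w⁆ ⁅y, z⁆]
      abel⟩

end SectionData

/-- The triplet `(coker μ, ker μ, [γ])` of a crossed module, where the class `[γ]` is computed
with some choice of sections. -/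
noncomputable def triplet : Triplet K where
  g := X.Coker
  V := X.Ker
  cls := Submodule.Quotient.mk (Classical.choice (SectionData.nonempty (X := X))).cocycle

/-- `F` induces the isomorphism `(e, f)` on cokernels and kernels. -/
def Hom.Induces {X Y : CrossedModule K} (F : X ⟶ Y) (e : X.Coker → Y.Coker)
    (f : X.Ker → Y.Ker) : Prop :=
  (∀ x, e (X.toCoker x) = Y.toCoker (F.ψ x)) ∧ ∀ v, (f v : Y.h) = F.φ v

/-- Elementary equivalence of crossed modules: there is a morphism which induces isomorphisms on
kernels and cokernels. The equivalence relation generated by it is equivalence of crossed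
modules. -/
def ElementaryEquiv (X Y : CrossedModule K) : Prop :=
  ∃ F : X ⟶ Y, ∃ e f, F.Induces e f ∧ Function.Bijective e ∧ Function.Bijective f

end CrossedModule

/-- A crossed module with fixed cokernel `g` and kernel `V`, that is, a four term exact sequence
`0 → V → h → g' → g → 0` which induces the given action of `g` on `V`. -/
structure CrossedExtension (K : Type u) [Field K] (g : Type u) [LieRing g] [LieAlgebra K g]
    (V : Type u) [AddCommGroup V] [Module K V] [LieRingModule g V] [LieModule K g V] where
  X : CrossedModule K
  e : X.Coker ≃ₗ⁅K⁆ g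
  f : X.Ker ≃ₗ[K] V
  equivariant : ∀ x v, f ⁅x, v⁆ = ⁅e x, f v⁆

namespace CrossedExtension

variable {K : Type u} [Field K] {g : Type u} [LieRing g] [LieAlgebra K g]
    {V : Type u} [AddCommGroup V] [Module K V] [LieRingModule g V] [LieModule K g V]

/-- The class in `H³(g, V)` of a crossed module with cokernel `g` and kernel `V`. -/
noncomputable def cls (M : CrossedExtension K g V) : H3 K g V :=
  H3.transport M.e M.f M.equivariant M.X.triplet.cls

/-- Elementary equivalence: a morphism of crossed modules inducing the identities of `g`
and `V`. -/
def ElementaryEquiv (M N : CrossedExtension K g V) : Prop :=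
  ∃ F : M.X ⟶ N.X, F.Induces (fun c => N.e.symm (M.e c)) (fun v => N.f.symm (M.f v))

end CrossedExtension

/-! ### 2-vector spaces -/

section TwoVect

variable (K : Type u) [Field K]

/-- The space `A ×_O A` of composable pairs of arrows (first `p.1`, then `p.2`). -/
def composable {K : Type u} [Field K] {A O : Type u} [AddCommGroup A] [Module K A]
    [AddCommGroup O] [Module K O] (s t : A →ₗ[K] O) : Submodule K (A × A) :=
  LinearMap.eqLocus (t ∘ₗ LinearMap.fst K A A) (s ∘ₗ LinearMap.snd K A A)

/-- A 2-vector space: a category object in vector spaces. -/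
structure TwoVect where
  Obj : Type u
  Arr : Type u
  [addCommGroupObj : AddCommGroup Obj]
  [moduleObj : Module K Obj]
  [addCommGroupArr : AddCommGroup Arr]
  [moduleArr : Module K Arr]
  s : Arr →ₗ[K] Obj
  t : Arr →ₗ[K] Obj
  i : Obj →ₗ[K] Arr
  m : composable s t →ₗ[K] Arr
  s_i : ∀ x, s (i x) = x
  t_i : ∀ x, t (i x) = x
  s_m : ∀ p : composable s t, s (m p) = s p.1.1
  t_m : ∀ p : composable s t, t (m p) = t p.1.2
  id_m : ∀ f (h : (i (s f), f) ∈ composable s t), m ⟨(i (s f), f), h⟩ = f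
  m_id : ∀ f (h : (f, i (t f)) ∈ composable s t), m ⟨(f, i (t f)), h⟩ = f
  assoc : ∀ p q : composable s t, p.1.2 = q.1.1 → ∀ (h₁ : (m p, q.1.2) ∈ composable s t)
    (h₂ : (p.1.1, m q) ∈ composable s t),
    m ⟨(m p, q.1.2), h₁⟩ = m ⟨(p.1.1, m q), h₂⟩

end TwoVect

attribute [instance] TwoVect.addCommGroupObj TwoVect.moduleObj TwoVect.addCommGroupArr
  TwoVect.moduleArr

namespace TwoVect

variable {K : Type u} [Field K] (L : TwoVect K)

/-- The arrow part `f - i (s f)` of an arrow. -/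
def arrowPart (f : L.Arr) : L.Arr := f - L.i (L.s f)

/-- The composite "first `f`, then `g`" of composable arrows, by its closed formula
`i (s f) + (arrow part of f) + (arrow part of g)`; see `m_eq_cmp`. -/
def cmp (f g : L.Arr) : L.Arr := L.i (L.s f) + L.arrowPart f + L.arrowPart g

theorem cmp_eq (f g : L.Arr) : L.cmp f g = f + g - L.i (L.s g) := by
  simp only [cmp, arrowPart]; abel

theorem m_eq_cmp (p : composable L.s L.t) : L.m p = L.cmp p.1.1 p.1.2 := by
  obtain ⟨⟨f, g⟩, h⟩ := p
  have h' : L.t f = L.s g := h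
  have h₁ : (f, L.i (L.t f)) ∈ composable L.s L.t := (L.s_i _).symm
  have h₂ : ((0 : L.Arr), g - L.i (L.s g)) ∈ composable L.s L.t := by
    change L.t 0 = L.s (g - L.i (L.s g))
    rw [map_sub, L.s_i, map_zero, sub_self]
  have h₃ : (L.i (L.s (g - L.i (L.s g))), g - L.i (L.s g)) ∈ composable L.s L.t := L.t_i _
  have e : (⟨(f, g), h⟩ : composable L.s L.t) =
      ⟨(f, L.i (L.t f)), h₁⟩ + ⟨(0, g - L.i (L.s g)), h₂⟩ := by
    apply Subtype.ext
    simp [h']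
  have e₂ : (⟨(0, g - L.i (L.s g)), h₂⟩ : composable L.s L.t) =
      ⟨(L.i (L.s (g - L.i (L.s g))), g - L.i (L.s g)), h₃⟩ := by
    apply Subtype.ext
    simp [L.s_i]
  have e₃ : L.m ⟨(f, g), h⟩ = f + (g - L.i (L.s g)) := by
    rw [e, map_add, L.m_id, e₂, L.id_m]
  rw [e₃, cmp_eq]
  abel

/-- The degree `-1` part `ker s` of the associated 2-term complex `d : ker s → Obj`. -/
abbrev Ker : Type u := LinearMap.ker L.s

theorem s_coe (v : L.Ker) : L.s (v : L.Arr) = 0 := v.2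

/-- The differential `t|_{ker s}` of the associated 2-term complex. -/
def d : L.Ker →ₗ[K] L.Obj := L.t ∘ₗ (LinearMap.ker L.s).subtype

/-- The cokernel of the differential. -/
abbrev Coker : Type u := L.Obj ⧸ LinearMap.range L.d

end TwoVect

/-! ### Semi-strict Lie 2-algebras -/

/-- A semi-strict Lie 2-algebra: a 2-vector space with a skew-symmetric bilinear functorial
bracket (`br₀` on objects, `br₁` on arrows) and a trilinear natural transformation `J`, whose
arrow part is completely antisymmetric, satisfying the Jacobiator identity. All arrows of a
2-vector space are invertible, so `J` is a natural isomorphism. -/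
structure SemistrictLie2 (K : Type u) [Field K] extends TwoVect K where
  br₀ : Obj →ₗ[K] Obj →ₗ[K] Obj
  br₁ : Arr →ₗ[K] Arr →ₗ[K] Arr
  br₀_self : ∀ x, br₀ x x = 0
  br₁_self : ∀ f, br₁ f f = 0
  s_br : ∀ f g, s (br₁ f g) = br₀ (s f) (s g)
  t_br : ∀ f g, t (br₁ f g) = br₀ (t f) (t g)
  i_br : ∀ x y, i (br₀ x y) = br₁ (i x) (i y)
  m_br : ∀ p q : composable s t,
    ∀ h : (br₁ p.1.1 q.1.1, br₁ p.1.2 q.1.2) ∈ composable s t,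
      m ⟨(br₁ p.1.1 q.1.1, br₁ p.1.2 q.1.2), h⟩ = br₁ (m p) (m q)
  J : Obj →ₗ[K] Obj →ₗ[K] Obj →ₗ[K] Arr
  s_J : ∀ x y z, s (J x y z) = br₀ (br₀ x y) z
  t_J : ∀ x y z, t (J x y z) = br₀ x (br₀ y z) + br₀ (br₀ x z) y
  J_alt : ∀ x z, toTwoVect.arrowPart (J x x z) = 0
  J_alt' : ∀ x y, toTwoVect.arrowPart (J x y y) = 0
  J_nat : ∀ f g h,
    toTwoVect.cmp (J (s f) (s g) (s h)) (br₁ f (br₁ g h) + br₁ (br₁ f h) g) =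
      toTwoVect.cmp (br₁ (br₁ f g) h) (J (t f) (t g) (t h))
  jacobiator : ∀ w x y z,
    toTwoVect.cmp
        (toTwoVect.cmp (J (br₀ w x) y z) (br₁ (J w x z) (i y) + i (br₀ (br₀ w x) (br₀ y z))))
        (J w (br₀ x z) y + J (br₀ w z) x y + J w x (br₀ y z)) =
      toTwoVect.cmp
        (toTwoVect.cmp
          (toTwoVect.cmp (br₁ (J w x y) (i z)) (J (br₀ w y) x z + J w (br₀ x y) z))
          (br₁ (J w y z) (i x) + i (br₀ (br₀ w y) (br₀ x z) + br₀ w (br₀ (br₀ x y) z)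
            + br₀ (br₀ w z) (br₀ x y))))
        (br₁ (i w) (J x y z) + i (br₀ (br₀ w y) (br₀ x z) + br₀ (br₀ w z) (br₀ x y)
            + br₀ (br₀ w (br₀ y z)) x + br₀ (br₀ (br₀ w z) y) x))

namespace SemistrictLie2

variable {K : Type u} [Field K]

/-- The two chains of arrows in the Jacobiator identity are composable, with the same ends. -/
theorem jacobiator_composable (L : SemistrictLie2 K) (w x y z : L.Obj) :
    L.t (L.J (L.br₀ w x) y z) =
      L.s (L.br₁ (L.J w x z) (L.i y) + L.i (L.br₀ (L.br₀ w x) (L.br₀ y z))) ∧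
    L.t (L.br₁ (L.J w x z) (L.i y) + L.i (L.br₀ (L.br₀ w x) (L.br₀ y z))) =
      L.s (L.J w (L.br₀ x z) y + L.J (L.br₀ w z) x y + L.J w x (L.br₀ y z)) ∧
    L.s (L.J (L.br₀ w x) y z) = L.s (L.br₁ (L.J w x y) (L.i z)) ∧
    L.t (L.br₁ (L.J w x y) (L.i z)) = L.s (L.J (L.br₀ w y) x z + L.J w (L.br₀ x y) z) ∧
    L.t (L.J (L.br₀ w y) x z + L.J w (L.br₀ x y) z) =
      L.s (L.br₁ (L.J w y z) (L.i x) + L.i (L.br₀ (L.br₀ w y) (L.br₀ x z)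
        + L.br₀ w (L.br₀ (L.br₀ x y) z) + L.br₀ (L.br₀ w z) (L.br₀ x y))) ∧
    L.t (L.br₁ (L.J w y z) (L.i x) + L.i (L.br₀ (L.br₀ w y) (L.br₀ x z)
        + L.br₀ w (L.br₀ (L.br₀ x y) z) + L.br₀ (L.br₀ w z) (L.br₀ x y))) =
      L.s (L.br₁ (L.i w) (L.J x y z) + L.i (L.br₀ (L.br₀ w y) (L.br₀ x z)
        + L.br₀ (L.br₀ w z) (L.br₀ x y)
        + L.br₀ (L.br₀ w (L.br₀ y z)) x + L.br₀ (L.br₀ (L.br₀ w z) y) x)) ∧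
    L.t (L.br₁ (L.i w) (L.J x y z) + L.i (L.br₀ (L.br₀ w y) (L.br₀ x z)
        + L.br₀ (L.br₀ w z) (L.br₀ x y)
        + L.br₀ (L.br₀ w (L.br₀ y z)) x + L.br₀ (L.br₀ (L.br₀ w z) y) x)) =
      L.t (L.J w (L.br₀ x z) y + L.J (L.br₀ w z) x y + L.J w x (L.br₀ y z)) := by
  simp only [map_add, LinearMap.add_apply, L.s_br, L.t_br, L.s_J, L.t_J, L.s_i, L.t_i]
  refine ⟨?_, ?_, ?_, ?_, ?_, ?_, ?_⟩ <;> first | trivial | abel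

/-- A homomorphism of semi-strict Lie 2-algebras: a linear functor `(f₀, f₁)` with a
skew-symmetric bilinear natural transformation `f₂ x y : [f₀ x, f₀ y] → f₀ [x, y]` compatible
with the Jacobiators. -/
@[ext] structure Hom (L M : SemistrictLie2 K) where
  f₀ : L.Obj →ₗ[K] M.Obj
  f₁ : L.Arr →ₗ[K] M.Arr
  f₂ : L.Obj →ₗ[K] L.Obj →ₗ[K] M.Arr
  s_f₁ : ∀ a, M.s (f₁ a) = f₀ (L.s a)
  t_f₁ : ∀ a, M.t (f₁ a) = f₀ (L.t a)
  f₁_i : ∀ x, f₁ (L.i x) = M.i (f₀ x)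
  f₁_m : ∀ p : composable L.s L.t, ∀ h : (f₁ p.1.1, f₁ p.1.2) ∈ composable M.s M.t,
    f₁ (L.m p) = M.m ⟨(f₁ p.1.1, f₁ p.1.2), h⟩
  f₂_self : ∀ x, f₂ x x = 0
  s_f₂ : ∀ x y, M.s (f₂ x y) = M.br₀ (f₀ x) (f₀ y)
  t_f₂ : ∀ x y, M.t (f₂ x y) = f₀ (L.br₀ x y)
  f₂_nat : ∀ a b, M.cmp (M.br₁ (f₁ a) (f₁ b)) (f₂ (L.t a) (L.t b)) =
    M.cmp (f₂ (L.s a) (L.s b)) (f₁ (L.br₁ a b))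
  coh : ∀ x y z,
    M.cmp (M.cmp (M.br₁ (f₂ x y) (M.i (f₀ z))) (f₂ (L.br₀ x y) z)) (f₁ (L.J x y z)) =
    M.cmp
      (M.cmp (M.J (f₀ x) (f₀ y) (f₀ z))
        (M.br₁ (M.i (f₀ x)) (f₂ y z) + M.br₁ (f₂ x z) (M.i (f₀ y))))
      (f₂ x (L.br₀ y z) + f₂ (L.br₀ x z) y)

namespace Hom

/-- The identity homomorphism. -/
def id (L : SemistrictLie2 K) : Hom L L where
  f₀ := LinearMap.id
  f₁ := LinearMap.id
  f₂ := L.br₀.compr₂ L.i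
  s_f₁ _ := rfl
  t_f₁ _ := rfl
  f₁_i _ := rfl
  f₁_m _ _ := rfl
  f₂_self x := by simp [L.br₀_self]
  s_f₂ x y := by simp [L.s_i]
  t_f₂ x y := by simp [L.t_i]
  f₂_nat a b := by simp [TwoVect.cmp_eq, L.s_i, L.s_br]
  coh x y z := by
    simp [TwoVect.cmp_eq, L.s_i, L.s_J, ← L.i_br]

/-- Composition of homomorphisms, "first `F`, then `G`". -/
def comp {L M N : SemistrictLie2 K} (F : Hom L M) (G : Hom M N) : Hom L N where
  f₀ := G.f₀ ∘ₗ F.f₀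
  f₁ := G.f₁ ∘ₗ F.f₁
  f₂ := LinearMap.mk₂ K (fun x y => N.cmp (G.f₂ (F.f₀ x) (F.f₀ y)) (G.f₁ (F.f₂ x y)))
    (by intros; simp [TwoVect.cmp_eq]; abel) (by intros; simp [TwoVect.cmp_eq]; module)
    (by intros; simp [TwoVect.cmp_eq]; abel) (by intros; simp [TwoVect.cmp_eq]; module)
  s_f₁ a := by simp [G.s_f₁, F.s_f₁]
  t_f₁ a := by simp [G.t_f₁, F.t_f₁]
  f₁_i x := by simp [G.f₁_i, F.f₁_i]
  f₁_m p h := by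
    have h' : (F.f₁ p.1.1, F.f₁ p.1.2) ∈ composable M.s M.t := by
      change M.t (F.f₁ p.1.1) = M.s (F.f₁ p.1.2)
      rw [F.t_f₁, F.s_f₁]
      exact congrArg F.f₀ p.2
    simp only [LinearMap.comp_apply]
    rw [F.f₁_m p h', G.f₁_m _ h]
  f₂_self x := by simp [TwoVect.cmp_eq, F.f₂_self, G.f₂_self]
  s_f₂ x y := by simp [TwoVect.cmp_eq, G.s_f₂, G.s_f₁, F.s_f₂, N.s_i]
  t_f₂ x y := by simp [TwoVect.cmp_eq, G.t_f₂, G.s_f₁, G.t_f₁, F.s_f₂, F.t_f₂, N.t_i]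
  f₂_nat a b := by
    have h1 := congrArg G.f₁ (F.f₂_nat a b)
    have h2 := G.f₂_nat (F.f₁ a) (F.f₁ b)
    simp only [TwoVect.cmp_eq, map_add, map_sub, F.s_f₁, F.t_f₁, G.s_f₁, G.t_f₁, F.f₁_i, G.f₁_i,
      F.s_f₂, G.s_f₂, M.s_br, N.s_br, L.s_br, LinearMap.comp_apply, LinearMap.mk₂_apply,
      N.s_i] at h1 h2 ⊢
    linear_combination (norm := abel) h1 + h2
  coh x y z := by
    have h1 := congrArg G.f₁ (F.coh x y z)
    have h2 := G.coh (F.f₀ x) (F.f₀ y) (F.f₀ z)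
    have h3 := G.f₂_nat (F.f₂ x y) (M.i (F.f₀ z))
    have h4 := G.f₂_nat (M.i (F.f₀ x)) (F.f₂ y z)
    have h5 := G.f₂_nat (F.f₂ x z) (M.i (F.f₀ y))
    simp only [TwoVect.cmp_eq, map_add, map_sub, F.s_f₁, F.t_f₁, G.s_f₁, G.t_f₁, F.f₁_i, G.f₁_i,
      F.s_f₂, G.s_f₂, F.t_f₂, M.s_br, N.s_br, L.s_br, LinearMap.comp_apply, LinearMap.mk₂_apply,
      N.s_i, M.s_i, M.t_i, L.s_J, M.s_J, N.s_J, LinearMap.add_apply, LinearMap.sub_apply,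
      N.i_br] at h1 h2 h3 h4 h5 ⊢
    linear_combination (norm := abel) h1 + h2 + h3 - h4 - h5

/-- A 2-morphism: a linear natural transformation compatible with `f₂`. -/
structure TwoHom {L M : SemistrictLie2 K} (F G : Hom L M) where
  θ : L.Obj →ₗ[K] M.Arr
  s_θ : ∀ x, M.s (θ x) = F.f₀ x
  t_θ : ∀ x, M.t (θ x) = G.f₀ x
  nat : ∀ a, M.cmp (F.f₁ a) (θ (L.t a)) = M.cmp (θ (L.s a)) (G.f₁ a)
  compat : ∀ x y, M.cmp (F.f₂ x y) (θ (L.br₀ x y)) = M.cmp (M.br₁ (θ x) (θ y)) (G.f₂ x y)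

/-- Two homomorphisms are 2-isomorphic: there are 2-morphisms in both directions, inverse to
each other for vertical composition. -/
def TwoIso {L M : SemistrictLie2 K} (F G : Hom L M) : Prop :=
  ∃ (α : TwoHom F G) (β : TwoHom G F),
    (∀ x, M.cmp (α.θ x) (β.θ x) = M.i (F.f₀ x)) ∧ ∀ x, M.cmp (β.θ x) (α.θ x) = M.i (G.f₀ x)

/-- `F` is an equivalence in the 2-category of semi-strict Lie 2-algebras. -/
def IsEquivalence {L M : SemistrictLie2 K} (F : Hom L M) : Prop :=
  ∃ G : Hom M L, TwoIso (F.comp G) (Hom.id L) ∧ TwoIso (G.comp F) (Hom.id M)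

/-- `F` is an isomorphism of semi-strict Lie 2-algebras. -/
def IsIso {L M : SemistrictLie2 K} (F : Hom L M) : Prop :=
  ∃ G : Hom M L, F.comp G = Hom.id L ∧ G.comp F = Hom.id M

end Hom

/-- Two semi-strict Lie 2-algebras are equivalent. -/
def Equivalent (L M : SemistrictLie2 K) : Prop := ∃ F : Hom L M, F.IsEquivalence

end SemistrictLie2

/-! ### Skeletal semi-strict Lie 2-algebras -/

/-- A semi-strict Lie 2-algebra is skeletal if the differential of its 2-term complex is zero. -/
structure SkeletalLie2 (K : Type u) [Field K] extends SemistrictLie2 K where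
  d_eq_zero : toTwoVect.d = 0

namespace SkeletalLie2

variable {K : Type u} [Field K] (S : SkeletalLie2 K)

theorem t_eq_s (f : S.Arr) : S.t f = S.s f := by
  have h : S.s (f - S.i (S.s f)) = 0 := by rw [map_sub, S.s_i, sub_self]
  have h' : S.t (f - S.i (S.s f)) = 0 :=
    LinearMap.congr_fun S.d_eq_zero ⟨f - S.i (S.s f), h⟩
  rwa [map_sub, S.t_i, sub_eq_zero] at h'

theorem br₀_skew (x y : S.Obj) : S.br₀ x y = - S.br₀ y x := by
  have h := S.br₀_self (x + y)
  simp only [map_add, LinearMap.add_apply, S.br₀_self, zero_add, add_zero] at h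
  exact eq_neg_of_add_eq_zero_right h

theorem br₁_skew (x y : S.Arr) : S.br₁ x y = - S.br₁ y x := by
  have h := S.br₁_self (x + y)
  simp only [map_add, LinearMap.add_apply, S.br₁_self, zero_add, add_zero] at h
  exact eq_neg_of_add_eq_zero_right h

/-- The Lie algebra of objects of a skeletal Lie 2-algebra. -/
instance : LieRing S.Obj where
  bracket x y := S.br₀ x y
  add_lie x y z := by simp [Bracket.bracket]
  lie_add x y z := by simp [Bracket.bracket]
  lie_self x := S.br₀_self x
  leibniz_lie x y z := by
    have h := S.t_eq_s (S.J x y z)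
    rw [S.t_J, S.s_J, S.br₀_skew _ y, ← sub_eq_add_neg, sub_eq_iff_eq_add] at h
    exact h

theorem lie_def (x y : S.Obj) : ⁅x, y⁆ = S.br₀ x y := rfl

instance : LieAlgebra K S.Obj where
  lie_smul r x y := map_smul (S.br₀ x) r y

/-- The space `ker s` is a module over the Lie algebra of objects, `x` acting as `[1_x, -]`. -/
instance : LieRingModule S.Obj S.Ker where
  bracket x v := ⟨S.br₁ (S.i x) v, by
    change S.s _ = 0
    rw [S.s_br, S.s_coe, map_zero]⟩
  add_lie x y v := by apply Subtype.ext; simp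
  lie_add x v w := by apply Subtype.ext; simp
  leibniz_lie x y v := by
    apply Subtype.ext
    have h := S.J_nat (S.i x) (S.i y) v
    simp only [S.s_coe, S.t_eq_s, map_zero, TwoVect.cmp_eq, zero_add, add_zero, sub_zero, map_add,
      S.s_br, LinearMap.zero_apply, ← S.i_br] at h
    rw [S.br₁_skew _ (S.i y), ← sub_eq_add_neg, sub_eq_iff_eq_add] at h
    exact h

@[simp] theorem coe_lie (x : S.Obj) (v : S.Ker) :
    ((⁅x, v⁆ : S.Ker) : S.Arr) = S.br₁ (S.i x) v := rfl

instance : LieModule K S.Obj S.Ker where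
  smul_lie r x v := by apply Subtype.ext; simp
  lie_smul r x v := by apply Subtype.ext; simp

/-- The bracket `l₃`: the arrow part of the Jacobiator. -/
def l₃ : S.Obj →ₗ[K] S.Obj →ₗ[K] S.Obj →ₗ[K] S.Ker where
  toFun x :=
    { toFun := fun y =>
        { toFun := fun z => ⟨S.arrowPart (S.J x y z), by
            change S.s (S.J x y z - S.i (S.s (S.J x y z))) = 0
            rw [map_sub, S.s_i, sub_self]⟩
          map_add' := by intros; apply Subtype.ext; simp [TwoVect.arrowPart]; abel
          map_smul' := by intros; apply Subtype.ext; simp [TwoVect.arrowPart, smul_sub] }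
      map_add' := by intros; ext; simp [TwoVect.arrowPart]; abel
      map_smul' := by intros; ext; simp [TwoVect.arrowPart, smul_sub] }
  map_add' := by intros; ext; simp [TwoVect.arrowPart]; abel
  map_smul' := by intros; ext; simp [TwoVect.arrowPart, smul_sub]

theorem J_eq (x y z : S.Obj) :
    S.J x y z = (S.l₃ x y z : S.Arr) + S.i (S.br₀ (S.br₀ x y) z) := by
  change _ = S.J x y z - S.i (S.s (S.J x y z)) + _
  rw [S.s_J, sub_add_cancel]

theorem l₃_self_left (x z : S.Obj) : S.l₃ x x z = 0 := Subtype.ext (S.J_alt x z)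

theorem l₃_self_right (x y : S.Obj) : S.l₃ x y y = 0 := Subtype.ext (S.J_alt' x y)

theorem l₃_swap_left (x y z : S.Obj) : S.l₃ x y z = - S.l₃ y x z := by
  have h := S.l₃_self_left (x + y) z
  simp only [map_add, LinearMap.add_apply, S.l₃_self_left, zero_add, add_zero] at h
  exact eq_neg_of_add_eq_zero_right h

theorem l₃_swap_right (x y z : S.Obj) : S.l₃ x y z = - S.l₃ x z y := by
  have h := S.l₃_self_right x (y + z)
  simp only [map_add, LinearMap.add_apply, S.l₃_self_right, zero_add, add_zero] at h
  exact eq_neg_of_add_eq_zero_right h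

/-- `l₃` is a Chevalley-Eilenberg cocycle. -/
def cocycle : Z3 K S.Obj S.Ker :=
  ⟨S.l₃, S.l₃_self_left, S.l₃_self_right, fun w x y z => by
    apply Subtype.ext
    have h := S.jacobiator w x y z
    simp only [S.J_eq, TwoVect.cmp_eq, map_add, LinearMap.add_apply, ← S.i_br, S.s_i, S.s_coe,
      S.s_br, zero_add, map_zero, LinearMap.zero_apply] at h
    rw [S.br₁_skew _ (S.i x), S.br₁_skew _ (S.i y), S.br₁_skew _ (S.i z),
      S.l₃_swap_left w (S.br₀ x z) y, S.l₃_swap_left w (S.br₀ x y) z,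
      S.l₃_swap_right w x (S.br₀ y z), S.l₃_swap_left w (S.br₀ y z) x] at h
    simp only [AddSubgroupClass.coe_sub, Submodule.coe_add, Submodule.coe_zero, coe_lie, lie_def,
      Submodule.coe_neg, neg_neg] at h ⊢
    rw [← sub_eq_zero] at h
    rw [← neg_eq_zero, ← h]
    abel⟩

/-- The triplet `(Obj, ker s, [l₃])` of a skeletal Lie 2-algebra. -/
def triplet : Triplet K where
  g := S.Obj
  V := S.Ker
  cls := Submodule.Quotient.mk S.cocycle

/-- Equivalence of skeletal Lie 2-algebras. -/
def Equivalent (S T : SkeletalLie2 K) : Prop :=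
  S.toSemistrictLie2.Equivalent T.toSemistrictLie2

end SkeletalLie2

/-! ### Strict Lie 2-algebras -/

/-- The Lie algebra of composable pairs of arrows. -/
def lieComposable {K : Type u} [Field K] {A O : Type u} [LieRing A] [LieAlgebra K A]
    [LieRing O] [LieAlgebra K O] (s t : A →ₗ⁅K⁆ O) : LieSubalgebra K (A × A) where
  toSubmodule := composable (s : A →ₗ[K] O) (t : A →ₗ[K] O)
  lie_mem' := by
    rintro p q hp hq
    change t p.1 = s p.2 at hp
    change t q.1 = s q.2 at hq
    change t ⁅p.1, q.1⁆ = s ⁅p.2, q.2⁆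
    rw [LieHom.map_lie, LieHom.map_lie, hp, hq]

/-- A strict Lie 2-algebra: a category object in Lie algebras. -/
structure StrictLie2 (K : Type u) [Field K] where
  Obj : Type u
  Arr : Type u
  [lieRingObj : LieRing Obj]
  [lieAlgebraObj : LieAlgebra K Obj]
  [lieRingArr : LieRing Arr]
  [lieAlgebraArr : LieAlgebra K Arr]
  s : Arr →ₗ⁅K⁆ Obj
  t : Arr →ₗ⁅K⁆ Obj
  i : Obj →ₗ⁅K⁆ Arr
  m : lieComposable s t →ₗ⁅K⁆ Arr
  s_i : ∀ x, s (i x) = x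
  t_i : ∀ x, t (i x) = x
  s_m : ∀ p : lieComposable s t, s (m p) = s p.1.1
  t_m : ∀ p : lieComposable s t, t (m p) = t p.1.2
  id_m : ∀ f (h : (i (s f), f) ∈ lieComposable s t), m ⟨(i (s f), f), h⟩ = f
  m_id : ∀ f (h : (f, i (t f)) ∈ lieComposable s t), m ⟨(f, i (t f)), h⟩ = f
  assoc : ∀ p q : lieComposable s t, p.1.2 = q.1.1 →
    ∀ (h₁ : (m p, q.1.2) ∈ lieComposable s t) (h₂ : (p.1.1, m q) ∈ lieComposable s t),
    m ⟨(m p, q.1.2), h₁⟩ = m ⟨(p.1.1, m q), h₂⟩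

attribute [instance] StrictLie2.lieRingObj StrictLie2.lieAlgebraObj StrictLie2.lieRingArr
  StrictLie2.lieAlgebraArr

namespace StrictLie2

variable {K : Type u} [Field K]

/-- A morphism of strict Lie 2-algebras: an internal functor. -/
@[ext] structure Hom (G H : StrictLie2 K) where
  f₀ : G.Obj →ₗ⁅K⁆ H.Obj
  f₁ : G.Arr →ₗ⁅K⁆ H.Arr
  s_f₁ : ∀ a, H.s (f₁ a) = f₀ (G.s a)
  t_f₁ : ∀ a, H.t (f₁ a) = f₀ (G.t a)
  f₁_i : ∀ x, f₁ (G.i x) = H.i (f₀ x)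
  f₁_m : ∀ p : lieComposable G.s G.t, ∀ h : (f₁ p.1.1, f₁ p.1.2) ∈ lieComposable H.s H.t,
    f₁ (G.m p) = H.m ⟨(f₁ p.1.1, f₁ p.1.2), h⟩

instance : Category (StrictLie2 K) where
  Hom := Hom
  id G := ⟨LieHom.id, LieHom.id, fun _ => rfl, fun _ => rfl, fun _ => rfl, fun _ _ => rfl⟩
  comp {G H I} F F' := ⟨F'.f₀.comp F.f₀, F'.f₁.comp F.f₁, fun a => by simp [F.s_f₁, F'.s_f₁],
    fun a => by simp [F.t_f₁, F'.t_f₁], fun a => by simp [F.f₁_i, F'.f₁_i], fun p h => by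
      have h' : (F.f₁ p.1.1, F.f₁ p.1.2) ∈ lieComposable H.s H.t := by
        change H.t (F.f₁ p.1.1) = H.s (F.f₁ p.1.2)
        rw [F.t_f₁, F.s_f₁]
        exact congrArg F.f₀ p.2
      simp only [LieHom.comp_apply]
      rw [F.f₁_m p h']
      exact F'.f₁_m ⟨_, h'⟩ h⟩

/-- A 2-morphism of strict Lie 2-algebras: an internal natural transformation. -/
@[ext] structure TwoHom {G H : StrictLie2 K} (F F' : G ⟶ H) where
  τ : G.Obj →ₗ⁅K⁆ H.Arr
  s_τ : ∀ x, H.s (τ x) = F.f₀ x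
  t_τ : ∀ x, H.t (τ x) = F'.f₀ x
  nat : ∀ (a : G.Arr) (h₁ : (F.f₁ a, τ (G.t a)) ∈ lieComposable H.s H.t)
    (h₂ : (τ (G.s a), F'.f₁ a) ∈ lieComposable H.s H.t),
    H.m ⟨(F.f₁ a, τ (G.t a)), h₁⟩ = H.m ⟨(τ (G.s a), F'.f₁ a), h₂⟩

variable (G : StrictLie2 K)

/-- The underlying 2-vector space. -/
def toTwoVect : TwoVect K where
  Obj := G.Obj
  Arr := G.Arr
  s := G.s
  t := G.t
  i := G.i
  m := (G.m : lieComposable G.s G.t →ₗ[K] G.Arr)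
  s_i := G.s_i
  t_i := G.t_i
  s_m := G.s_m
  t_m := G.t_m
  id_m := G.id_m
  m_id := G.m_id
  assoc := G.assoc

theorem m_eq (p : lieComposable G.s G.t) : G.m p = p.1.1 + p.1.2 - G.i (G.s p.1.2) :=
  (G.toTwoVect.m_eq_cmp p).trans (G.toTwoVect.cmp_eq _ _)

/-- `[ker s, ker t] = 0`. -/
theorem lie_eq_zero (f g : G.Arr) (hf : G.s f = 0) (hg : G.t g = 0) : ⁅f, g⁆ = 0 := by
  have h₁ : ((0 : G.Arr), f) ∈ lieComposable G.s G.t := by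
    change G.t 0 = G.s f
    rw [hf, map_zero]
  have h₂ : (g, (0 : G.Arr)) ∈ lieComposable G.s G.t := by
    change G.t g = G.s 0
    rw [hg, map_zero]
  have h := G.m.map_lie ⟨(0, f), h₁⟩ ⟨(g, 0), h₂⟩
  rw [G.m_eq, G.m_eq, G.m_eq] at h
  simpa [hf] using h.symm

/-- The crossed module `t : ker s → Obj` of a strict Lie 2-algebra, with action
`x · a = [i x, a]`. -/
def toCrossedModule : CrossedModule K where
  h := G.s.ker
  g := G.Obj
  μ := G.t.comp G.s.ker.incl
  act :=
    { toFun := fun x =>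
        { toFun := fun a => ⟨⁅G.i x, (a : G.Arr)⁆, lie_mem_right K G.Arr G.s.ker _ _ a.2⟩
          map_add' := fun a b => by apply Subtype.ext; simp
          map_smul' := fun r a => by apply Subtype.ext; simp
          leibniz' := fun a b => by
            apply Subtype.ext
            change ⁅G.i x, ⁅(a : G.Arr), (b : G.Arr)⁆⁆ =
              ⁅(a : G.Arr), ⁅G.i x, (b : G.Arr)⁆⁆ - ⁅(b : G.Arr), ⁅G.i x, (a : G.Arr)⁆⁆
            rw [leibniz_lie, sub_eq_add_neg, lie_skew, add_comm] }
      map_add' := fun x y => by ext a; simp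
      map_smul' := fun r x => by ext a; simp
      map_lie' := fun {x y} => by
        ext a
        simp }
  μ_act x a := by
    change G.t ⁅G.i x, (a : G.Arr)⁆ = ⁅x, G.t a⁆
    rw [LieHom.map_lie, G.t_i]
  act_μ a b := by
    apply Subtype.ext
    change ⁅G.i (G.t a), (b : G.Arr)⁆ = ⁅(a : G.Arr), (b : G.Arr)⁆
    have h := G.lie_eq_zero (b : G.Arr) (a - G.i (G.t a)) (LieHom.mem_ker.1 b.2)
      (by rw [map_sub, G.t_i, sub_self])
    rw [← lie_skew, ← lie_skew (a : G.Arr), neg_inj]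
    rw [lie_sub, sub_eq_zero] at h
    exact h.symm


/-- The restriction of a morphism to the kernels of the source maps. -/
def Hom.onKer {G H : StrictLie2 K} (F : Hom G H) : G.s.ker →ₗ⁅K⁆ H.s.ker where
  toFun a := ⟨F.f₁ a, LieHom.mem_ker.2 (by rw [F.s_f₁, LieHom.mem_ker.1 a.2, map_zero])⟩
  map_add' a b := by apply Subtype.ext; simp
  map_smul' r a := by apply Subtype.ext; simp
  map_lie' {a b} := by apply Subtype.ext; simp

/-- The functor from strict Lie 2-algebras to crossed modules. -/
def crossedModuleFunctor (K : Type u) [Field K] : StrictLie2 K ⥤ CrossedModule K where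
  obj G := G.toCrossedModule
  map {G H} F :=
    { φ := Hom.onKer F
      ψ := F.f₀
      comm := fun (a : G.s.ker) => (F.t_f₁ (a : G.Arr)).symm
      map_act := fun (x : G.Obj) (a : G.s.ker) => by
        apply Subtype.ext
        change F.f₁ ⁅G.i x, (a : G.Arr)⁆ = ⁅H.i (F.f₀ x), F.f₁ a⁆
        rw [LieHom.map_lie, F.f₁_i] }
  map_id _ := rfl
  map_comp _ _ := rfl

/-- The arrow part of a 2-morphism. -/
def TwoHom.arrowPart {G H : StrictLie2 K} {F F' : G ⟶ H} (τ : TwoHom F F') :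
    G.Obj →ₗ[K] H.s.ker where
  toFun x := ⟨τ.τ x - H.i (F.f₀ x), LieHom.mem_ker.2 (by rw [map_sub, τ.s_τ, H.s_i, sub_self])⟩
  map_add' x y := by apply Subtype.ext; simp; abel
  map_smul' r x := by apply Subtype.ext; simp [smul_sub]

/-- The passage to crossed modules on 2-morphisms, given by the arrow part. -/
def TwoHom.toCrossed {G H : StrictLie2 K} {F F' : G ⟶ H} (τ : TwoHom F F') :
    CrossedModule.TwoHom ((crossedModuleFunctor K).map F) ((crossedModuleFunctor K).map F') where
  η := τ.arrowPart
  μ_η (x : G.Obj) := by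
    change H.t (τ.τ x - H.i (F.f₀ x)) = F'.f₀ x - F.f₀ x
    rw [map_sub, τ.t_τ, H.t_i]
  η_μ (a : G.s.ker) := by
    apply Subtype.ext
    change τ.τ (G.t a) - H.i (F.f₀ (G.t a)) = F'.f₁ a - F.f₁ a
    have h := τ.nat a
      (by change H.t (F.f₁ a) = H.s (τ.τ (G.t a)); rw [F.t_f₁, τ.s_τ])
      (by change H.t (τ.τ (G.s a)) = H.s (F'.f₁ a); rw [F'.s_f₁, τ.t_τ])
    have ha : G.s a = 0 := LieHom.mem_ker.1 a.2
    rw [H.m_eq, H.m_eq] at h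
    simp only [τ.s_τ, F'.s_f₁, ha, map_zero, zero_add, sub_zero] at h
    rw [← h]
    abel
  η_lie (x y : G.Obj) := by
    apply Subtype.ext
    change τ.τ ⁅x, y⁆ - H.i (F.f₀ ⁅x, y⁆) =
      ⁅H.i (F.f₀ x), τ.τ y - H.i (F.f₀ y)⁆ - ⁅H.i (F.f₀ y), τ.τ x - H.i (F.f₀ x)⁆ +
        ⁅τ.τ x - H.i (F.f₀ x), τ.τ y - H.i (F.f₀ y)⁆
    simp only [LieHom.map_lie, lie_sub, sub_lie]
    rw [← lie_skew (H.i (F.f₀ y)) (τ.τ x), ← lie_skew (H.i (F.f₀ y)) (H.i (F.f₀ x))]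
    abel

/-- The bracket of a Lie algebra as a bilinear map. -/
def bilinBracket (A : Type u) [LieRing A] [LieAlgebra K A] : A →ₗ[K] A →ₗ[K] A :=
  (LieModule.toEnd K A A : A →ₗ[K] Module.End K A)

@[simp] theorem bilinBracket_apply (A : Type u) [LieRing A] [LieAlgebra K A] (x y : A) :
    bilinBracket (K := K) A x y = ⁅x, y⁆ := rfl

/-- The identity Jacobiator. -/
def idJ : G.Obj →ₗ[K] G.Obj →ₗ[K] G.Obj →ₗ[K] G.Arr where
  toFun x := (bilinBracket G.Obj ∘ₗ bilinBracket G.Obj x).compr₂ (G.i : G.Obj →ₗ[K] G.Arr)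
  map_add' _ _ := by ext; simp
  map_smul' _ _ := by ext; simp

@[simp] theorem idJ_apply (x y z : G.Obj) : G.idJ x y z = G.i ⁅⁅x, y⁆, z⁆ := rfl

theorem jacobi (x y z : G.Obj) : ⁅⁅x, y⁆, z⁆ = ⁅x, ⁅y, z⁆⁆ + ⁅⁅x, z⁆, y⁆ := by
  rw [lie_lie, ← lie_skew ⁅x, z⁆ y, sub_eq_add_neg]

theorem jacobi_arr (x y z : G.Arr) : ⁅⁅x, y⁆, z⁆ = ⁅x, ⁅y, z⁆⁆ + ⁅⁅x, z⁆, y⁆ := by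
  rw [lie_lie, ← lie_skew ⁅x, z⁆ y, sub_eq_add_neg]

/-- A strict Lie 2-algebra regarded as a semi-strict one: the functorial bracket is given by the
brackets of objects and of arrows, and the Jacobiator is the identity. -/
def toSemistrict : SemistrictLie2 K where
  toTwoVect := G.toTwoVect
  br₀ := bilinBracket G.Obj
  br₁ := bilinBracket G.Arr
  br₀_self := lie_self (L := G.Obj)
  br₁_self := lie_self (L := G.Arr)
  s_br f g := LieHom.map_lie G.s f g
  t_br f g := LieHom.map_lie G.t f g
  i_br x y := LieHom.map_lie G.i x y
  m_br p q h := (G.m.map_lie p q)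
  J := G.idJ
  s_J x y z := G.s_i _
  t_J x y z := (G.t_i _).trans (G.jacobi x y z)
  J_alt x z := by
    change G.i _ - G.i (G.s (G.i _)) = 0
    rw [G.s_i, sub_self]
  J_alt' x y := by
    change G.i _ - G.i (G.s (G.i _)) = 0
    rw [G.s_i, sub_self]
  J_nat (f g h : G.Arr) := by
    rw [TwoVect.cmp_eq, TwoVect.cmp_eq]
    change G.i ⁅⁅G.s f, G.s g⁆, G.s h⁆ + (⁅f, ⁅g, h⁆⁆ + ⁅⁅f, h⁆, g⁆)
      - G.i (G.s (⁅f, ⁅g, h⁆⁆ + ⁅⁅f, h⁆, g⁆)) = ⁅⁅f, g⁆, h⁆ + G.i ⁅⁅G.t f, G.t g⁆, G.t h⁆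
      - G.i (G.s (G.i ⁅⁅G.t f, G.t g⁆, G.t h⁆))
    rw [← G.jacobi_arr, G.s_i]
    simp only [LieHom.map_lie]
    abel
  jacobiator (w x y z : G.Obj) := by
    simp only [TwoVect.cmp_eq]
    change G.i ⁅⁅⁅w, x⁆, y⁆, z⁆ + (⁅G.i ⁅⁅w, x⁆, z⁆, G.i y⁆ + G.i ⁅⁅w, x⁆, ⁅y, z⁆⁆)
        - G.i (G.s (⁅G.i ⁅⁅w, x⁆, z⁆, G.i y⁆ + G.i ⁅⁅w, x⁆, ⁅y, z⁆⁆))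
        + (G.i ⁅⁅w, ⁅x, z⁆⁆, y⁆ + G.i ⁅⁅⁅w, z⁆, x⁆, y⁆ + G.i ⁅⁅w, x⁆, ⁅y, z⁆⁆)
        - G.i (G.s (G.i ⁅⁅w, ⁅x, z⁆⁆, y⁆ + G.i ⁅⁅⁅w, z⁆, x⁆, y⁆ + G.i ⁅⁅w, x⁆, ⁅y, z⁆⁆)) =
      ⁅G.i ⁅⁅w, x⁆, y⁆, G.i z⁆ + (G.i ⁅⁅⁅w, y⁆, x⁆, z⁆ + G.i ⁅⁅w, ⁅x, y⁆⁆, z⁆)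
        - G.i (G.s (G.i ⁅⁅⁅w, y⁆, x⁆, z⁆ + G.i ⁅⁅w, ⁅x, y⁆⁆, z⁆))
        + (⁅G.i ⁅⁅w, y⁆, z⁆, G.i x⁆ + G.i (⁅⁅w, y⁆, ⁅x, z⁆⁆ + ⁅w, ⁅⁅x, y⁆, z⁆⁆
          + ⁅⁅w, z⁆, ⁅x, y⁆⁆))
        - G.i (G.s (⁅G.i ⁅⁅w, y⁆, z⁆, G.i x⁆ + G.i (⁅⁅w, y⁆, ⁅x, z⁆⁆ + ⁅w, ⁅⁅x, y⁆, z⁆⁆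
          + ⁅⁅w, z⁆, ⁅x, y⁆⁆)))
        + (⁅G.i w, G.i ⁅⁅x, y⁆, z⁆⁆ + G.i (⁅⁅w, y⁆, ⁅x, z⁆⁆ + ⁅⁅w, z⁆, ⁅x, y⁆⁆
          + ⁅⁅w, ⁅y, z⁆⁆, x⁆ + ⁅⁅⁅w, z⁆, y⁆, x⁆))
        - G.i (G.s (⁅G.i w, G.i ⁅⁅x, y⁆, z⁆⁆ + G.i (⁅⁅w, y⁆, ⁅x, z⁆⁆ + ⁅⁅w, z⁆, ⁅x, y⁆⁆
          + ⁅⁅w, ⁅y, z⁆⁆, x⁆ + ⁅⁅⁅w, z⁆, y⁆, x⁆)))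
    simp only [← LieHom.map_lie, ← map_add, ← map_sub, G.s_i]
    congr 1
    abel

/-- The bracket of arrows is the functorial bracket with source `[x, a]` and arrow part
`[x, arrow part of g] + [arrow part of f, b]`, for `f : x → y` and `g : a → b`. -/
theorem lie_arr_eq (f g : G.Arr) :
    ⁅f, g⁆ = G.i ⁅G.s f, G.s g⁆ +
      (⁅G.i (G.s f), g - G.i (G.s g)⁆ + ⁅f - G.i (G.s f), G.i (G.t g)⁆) := by
  have h := G.lie_eq_zero (f - G.i (G.s f)) (g - G.i (G.t g))
    (by rw [map_sub, G.s_i, sub_self]) (by rw [map_sub, G.t_i, sub_self])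
  simp only [LieHom.map_lie, lie_sub, sub_lie] at h ⊢
  rw [← sub_eq_zero, ← h]
  abel

/-- The arrow underlying an element of the kernel of the associated crossed module. -/
def kerToArr (v : G.toCrossedModule.triplet.V) : G.Arr :=
  ((v : G.toCrossedModule.Ker).1 : G.s.ker).1

end StrictLie2
end Lie2

/-! The section `i` splits every arrow into its source and its arrow part in `ker s`, and
composition adds arrow parts. In these coordinates a semi-strict Lie 2-algebra is a two-term
L∞-algebra (a differential `d`, a bracket, an action and a trilinear `l₃`), a homomorphism is a
triple `(f₀, k₁, k₂)`, and a 2-morphism is a linear homotopy. A homomorphism is an equivalence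
exactly when it is fully faithful and essentially surjective. Linear splittings exist over a field,
and once a map on objects and a homotopy are chosen, everything else in a quasi-inverse is forced
(`FullyFaithful.exists_quasiInverse`).

If `d = 0`, the data are a Lie algebra, a module and a 3-cocycle. An equivalence is then a pair of
bijections together with a 2-cochain `k₂` that bounds the difference of the cocycles, so skeletal
algebras are classified by triplets. Transferring the structure of a general algebra along a section
`σ` of `L₀ → coker d` produces its skeletal model; the defect of `σ`, lifted along `d`, is the
component `k₂` of the comparison map.

For a strict algebra `l₃ = 0`. The coherence of a skeletal model `φ : S → G` then says that the
cocycle of `S` is given by the formula for `γ`, with `ρ` and `b` read off from `f₀` and `k₂` of `φ`.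
This is the commutativity of the diagram (`StrictLie2.exists_iso_of_model`).

Injectivity of `β`: an isomorphism of triplets lifts, through skeletal models, to an equivalence of
strict algebras in the semi-strict sense, that is, to a weak morphism of crossed modules. A weak
morphism has a butterfly, an extension of its source by the upper algebra of its target, and this
gives a span of honest morphisms whose left leg is an elementary equivalence
(`CrossedModule.exists_span`). The right leg induces the given isomorphism on kernel and cokernel.

Surjectivity of `β` is where characteristic `0` enters. Let `π : F → g` be a surjection from a free
Lie algebra. The third cohomology of `F` vanishes, so the pulled back cocycle has a primitive, and
this primitive twists the action of `F` on `ker π × V` into a crossed module with the given class.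
For the vanishing, embed `V` in the coinduced module of linear maps from the free associative
algebra to `V`. Contraction with the Euler derivation and Cartan's homotopy formula, after division
by the total degree, give a primitive with coinduced values. Modulo `V` this primitive is a
2-cocycle, hence a coboundary because extensions of free Lie algebras split, and so it can be
corrected to take values in `V`. -/

namespace Lie2

open LieModule.Cohomology CategoryTheory

/-! ### The 2-term complex of a 2-vector space -/

namespace TwoVect

variable {K : Type u} [Field K] (L : TwoVect K)

/-- The arrow part of an arrow, as a linear map to `ker s`. -/
def part : L.Arr →ₗ[K] L.Ker where
  toFun f := ⟨f - L.i (L.s f), by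
    change L.s _ = 0
    rw [map_sub, L.s_i, sub_self]⟩
  map_add' f g := by apply Subtype.ext; simp; abel
  map_smul' r f := by apply Subtype.ext; simp [smul_sub]

theorem coe_part (f : L.Arr) : (L.part f : L.Arr) = f - L.i (L.s f) := rfl

theorem eq_i_add_part (f : L.Arr) : f = L.i (L.s f) + L.part f := by
  rw [coe_part]; abel

@[simp] theorem part_coe (a : L.Ker) : L.part a = a := by
  apply Subtype.ext
  rw [coe_part, L.s_coe]
  simp

@[simp] theorem part_i (x : L.Obj) : L.part (L.i x) = 0 := by
  apply Subtype.ext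
  rw [coe_part, L.s_i]
  simp

theorem d_apply (a : L.Ker) : L.d a = L.t a := rfl

theorem d_part (f : L.Arr) : L.d (L.part f) = L.t f - L.s f := by
  rw [d_apply, coe_part, map_sub, L.t_i]

theorem t_eq (f : L.Arr) : L.t f = L.s f + L.d (L.part f) := by
  rw [d_part]; abel

/-- An arrow is the pair of its source and its arrow part. Equalities between composites of arrows
are reduced to these two components throughout. -/
theorem arr_ext {f g : L.Arr} (hs : L.s f = L.s g) (hp : L.part f = L.part g) : f = g := by
  rw [L.eq_i_add_part f, L.eq_i_add_part g, hs, hp]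

@[simp] theorem s_cmp (f g : L.Arr) : L.s (L.cmp f g) = L.s f := by
  rw [cmp_eq, map_sub, map_add, L.s_i]; abel

@[simp] theorem part_cmp (f g : L.Arr) : L.part (L.cmp f g) = L.part f + L.part g := by
  rw [cmp_eq, map_sub, map_add, part_i, sub_zero]

end TwoVect

/-! ### Semi-strict Lie 2-algebras as two-term L∞-algebras -/

namespace SemistrictLie2

variable {K : Type u} [Field K] (L : SemistrictLie2 K)

theorem br₀_skew (x y : L.Obj) : L.br₀ x y = - L.br₀ y x := by
  have h := L.br₀_self (x + y)
  simp only [map_add, LinearMap.add_apply, L.br₀_self, zero_add, add_zero] at h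
  exact eq_neg_of_add_eq_zero_right h

theorem br₁_skew (x y : L.Arr) : L.br₁ x y = - L.br₁ y x := by
  have h := L.br₁_self (x + y)
  simp only [map_add, LinearMap.add_apply, L.br₁_self, zero_add, add_zero] at h
  exact eq_neg_of_add_eq_zero_right h

/-- The action of objects on the arrow parts: `x · a = [1_x, a]`. -/
def act : L.Obj →ₗ[K] L.Ker →ₗ[K] L.Ker where
  toFun x := (L.br₁ (L.i x)).restrict (by
    intro a ha
    change L.s a = 0 at ha
    change L.s _ = 0
    rw [L.s_br, ha, map_zero])
  map_add' x y := by ext a; simp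
  map_smul' r x := by ext a; simp

theorem coe_act (x : L.Obj) (a : L.Ker) : (L.act x a : L.Arr) = L.br₁ (L.i x) a := rfl

theorem d_act (x : L.Obj) (a : L.Ker) : L.d (L.act x a) = L.br₀ x (L.d a) := by
  rw [TwoVect.d_apply, coe_act, L.t_br, L.t_i]
  rfl

theorem br₁_cmp (f f' g g' : L.Arr) (h : L.t f = L.s f') (h' : L.t g = L.s g') :
    L.br₁ (L.cmp f f') (L.cmp g g') = L.cmp (L.br₁ f g) (L.br₁ f' g') := by
  have hb : (L.br₁ f g, L.br₁ f' g') ∈ composable L.s L.t := by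
    change L.t (L.br₁ f g) = L.s (L.br₁ f' g')
    rw [L.t_br, L.s_br, h, h']
  have := L.m_br ⟨(f, f'), h⟩ ⟨(g, g'), h'⟩ hb
  rw [L.m_eq_cmp, L.m_eq_cmp, L.m_eq_cmp] at this
  exact this.symm

/-- The bracket of an arrow with source `0` and an arrow with target `0` vanishes. -/
theorem br₁_eq_zero (f g : L.Arr) (hf : L.s f = 0) (hg : L.t g = 0) : L.br₁ f g = 0 := by
  -- Interchange law: `f` is the composite of `0` and `f`, and `g` is the composite of `g` and `0`,
  -- so `[f, g]` is the composite of `[0, g]` and `[f, 0]`.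
  have h := L.br₁_cmp 0 f g 0 (by rw [map_zero, hf]) (by rw [map_zero, hg])
  simp only [TwoVect.cmp_eq, hf, map_zero, LinearMap.zero_apply, zero_add, add_zero, sub_zero]
    at h
  exact h

/-- The arrow `g - i (t g)` has target `0`, so its bracket with `a` vanishes and only the identity
of the target of `g` contributes. -/
theorem br₁_coe (a : L.Ker) (g : L.Arr) :
    L.br₁ a g = - (L.act (L.t g) a : L.Arr) := by
  have h := L.br₁_eq_zero a (g - L.i (L.t g)) a.2 (by rw [map_sub, L.t_i, sub_self])
  rw [map_sub, sub_eq_zero] at h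
  rw [h, coe_act, L.br₁_skew]

/-- Both sides compute the bracket of the two arrow parts, before and after exchanging them. This is
the Peiffer identity of a crossed module in the semi-strict setting. -/
theorem act_d (a b : L.Ker) : L.act (L.d a) b = - L.act (L.d b) a := by
  apply Subtype.ext
  rw [Submodule.coe_neg, TwoVect.d_apply, TwoVect.d_apply, ← L.br₁_coe a b, L.br₁_skew,
    L.br₁_coe b a, neg_neg]

theorem br₁_coe_coe (a b : L.Ker) : L.br₁ a b = (L.act (L.d a) b : L.Arr) := by
  rw [L.act_d, L.br₁_coe]
  rfl

theorem act_d_self (a : L.Ker) : L.act (L.d a) a = 0 := by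
  apply Subtype.ext
  rw [← L.br₁_coe_coe, L.br₁_self]
  rfl

/-- Split both arrows into identity and arrow part. The source of `f` but the target of `g` occurs
because the bracket of an arrow part with `g` sees only `t g`. -/
theorem part_br₁ (f g : L.Arr) :
    L.part (L.br₁ f g) = L.act (L.s f) (L.part g) - L.act (L.t g) (L.part f) := by
  have h : L.br₁ f g = L.i (L.br₀ (L.s f) (L.s g)) +
      (L.act (L.s f) (L.part g) - L.act (L.t g) (L.part f) : L.Ker) := by
    rw [AddSubgroupClass.coe_sub, sub_eq_add_neg, ← L.br₁_coe (L.part f) g, coe_act, L.i_br,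
      ← add_assoc, ← map_add, ← L.eq_i_add_part g, ← LinearMap.add_apply, ← map_add,
      ← L.eq_i_add_part f]
  rw [h, map_add, L.part_i, L.part_coe, zero_add]

/-- The arrow part of the Jacobiator. -/
def l₃ : L.Obj →ₗ[K] L.Obj →ₗ[K] L.Obj →ₗ[K] L.Ker where
  toFun x := (L.J x).compr₂ L.part
  map_add' _ _ := by ext; simp
  map_smul' _ _ := by ext; simp

theorem part_J (x y z : L.Obj) : L.part (L.J x y z) = L.l₃ x y z := rfl

theorem d_l₃ (x y z : L.Obj) :
    L.d (L.l₃ x y z) = L.br₀ x (L.br₀ y z) + L.br₀ (L.br₀ x z) y - L.br₀ (L.br₀ x y) z := by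
  rw [← part_J, L.d_part, L.s_J, L.t_J]

theorem l₃_self_left (x z : L.Obj) : L.l₃ x x z = 0 := Subtype.ext (L.J_alt x z)

theorem l₃_self_right (x y : L.Obj) : L.l₃ x y y = 0 := Subtype.ext (L.J_alt' x y)

theorem l₃_swap_left (x y z : L.Obj) : L.l₃ x y z = - L.l₃ y x z := by
  have h := L.l₃_self_left (x + y) z
  simp only [map_add, LinearMap.add_apply, L.l₃_self_left, zero_add, add_zero] at h
  exact eq_neg_of_add_eq_zero_right h

theorem l₃_swap_right (x y z : L.Obj) : L.l₃ x y z = - L.l₃ x z y := by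
  have h := L.l₃_self_right x (y + z)
  simp only [map_add, LinearMap.add_apply, L.l₃_self_right, zero_add, add_zero] at h
  exact eq_neg_of_add_eq_zero_right h

/-- Naturality of `J` at `(1_x, 1_y, a)`. The source of this triple is `(x, y, 0)`, where `J`
vanishes, and its target is `(x, y, d a)`. -/
theorem act_act (x y : L.Obj) (a : L.Ker) :
    L.act x (L.act y a) = L.act y (L.act x a) + L.act (L.br₀ x y) a + L.l₃ x y (L.d a) := by
  have h := congrArg L.part (L.J_nat (L.i x) (L.i y) a)
  simp only [TwoVect.part_cmp, part_br₁, part_J, L.s_i, L.t_i, L.s_coe, map_add, map_zero,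
    TwoVect.part_i, TwoVect.part_coe, sub_zero, zero_sub, zero_add, L.s_br, L.t_br] at h
  linear_combination (norm := (simp only [TwoVect.d_apply]; abel)) h

/-- The Jacobiator identity in terms of arrow parts. -/
theorem l₃_jacobiator (w x y z : L.Obj) :
    L.l₃ (L.br₀ w x) y z - L.act y (L.l₃ w x z) + L.l₃ w (L.br₀ x z) y + L.l₃ (L.br₀ w z) x y
        + L.l₃ w x (L.br₀ y z) =
      - L.act z (L.l₃ w x y) + L.l₃ (L.br₀ w y) x z + L.l₃ w (L.br₀ x y) z
        - L.act x (L.l₃ w y z) + L.act w (L.l₃ x y z) := by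
  have h := congrArg L.part (L.jacobiator w x y z)
  simp only [TwoVect.part_cmp, part_br₁, part_J, L.s_i, L.t_i, map_add, map_zero,
    TwoVect.part_i, zero_add, add_zero, sub_zero, zero_sub] at h
  linear_combination (norm := abel) h

/-! ### Homomorphisms in components -/

namespace Hom

variable {L} {M N : SemistrictLie2 K} (F : Hom L M)

/-- The restriction of `f₁` to the arrow parts. -/
def k₁ : L.Ker →ₗ[K] M.Ker := F.f₁.restrict (by
  intro a ha
  change L.s a = 0 at ha
  change M.s _ = 0
  rw [F.s_f₁, ha, map_zero])

theorem coe_k₁ (a : L.Ker) : (F.k₁ a : M.Arr) = F.f₁ a := rfl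

/-- The arrow part of `f₂`. -/
def k₂ : L.Obj →ₗ[K] L.Obj →ₗ[K] M.Ker := F.f₂.compr₂ M.part

theorem part_f₂ (x y : L.Obj) : M.part (F.f₂ x y) = F.k₂ x y := rfl

theorem part_f₁ (a : L.Arr) : M.part (F.f₁ a) = F.k₁ (L.part a) := by
  apply Subtype.ext
  rw [coe_k₁, M.coe_part, L.coe_part, map_sub, F.f₁_i, F.s_f₁]

theorem k₂_self (x : L.Obj) : F.k₂ x x = 0 := by
  rw [← part_f₂, F.f₂_self, map_zero]

theorem k₂_skew (x y : L.Obj) : F.k₂ x y = - F.k₂ y x := by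
  have h := F.k₂_self (x + y)
  simp only [map_add, LinearMap.add_apply, F.k₂_self, zero_add, add_zero] at h
  exact eq_neg_of_add_eq_zero_right h

theorem d_k₁ (a : L.Ker) : M.d (F.k₁ a) = F.f₀ (L.d a) := F.t_f₁ a

theorem d_k₂ (x y : L.Obj) : M.d (F.k₂ x y) = F.f₀ (L.br₀ x y) - M.br₀ (F.f₀ x) (F.f₀ y) := by
  rw [← part_f₂, M.d_part, F.s_f₂, F.t_f₂]

/-- Naturality of `f₂` at the pair `(1_x, a)`. -/
theorem k₁_act (x : L.Obj) (a : L.Ker) :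
    F.k₁ (L.act x a) = M.act (F.f₀ x) (F.k₁ a) + F.k₂ x (L.d a) := by
  have h := congrArg M.part (F.f₂_nat (L.i x) a)
  simp only [TwoVect.part_cmp, part_br₁, part_f₁, part_f₂, L.s_i, L.t_i, L.s_coe, map_zero,
    TwoVect.part_i, TwoVect.part_coe, F.s_f₁, sub_zero, zero_add, add_zero] at h
  exact h.symm

/-- The coherence law on arrow parts. Between skeletal algebras it says that the two 3-cocycles
differ by the Chevalley-Eilenberg differential of `k₂`. -/
theorem k₁_l₃ (x y z : L.Obj) :
    F.k₁ (L.l₃ x y z) = M.l₃ (F.f₀ x) (F.f₀ y) (F.f₀ z) + M.act (F.f₀ x) (F.k₂ y z)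
      - M.act (F.f₀ y) (F.k₂ x z) + M.act (F.f₀ z) (F.k₂ x y) - F.k₂ (L.br₀ x y) z
      + F.k₂ (L.br₀ x z) y - F.k₂ (L.br₀ y z) x := by
  have h := congrArg M.part (F.coh x y z)
  simp only [TwoVect.part_cmp, part_br₁, part_f₁, part_f₂, part_J, M.s_i, M.t_i, map_zero,
    map_add, TwoVect.part_i, sub_zero, zero_sub, zero_add, add_zero] at h
  rw [F.k₂_skew x (L.br₀ y z)] at h
  linear_combination (norm := abel) h

/-- A homomorphism from its components on objects and arrow parts. -/
def ofParts (f₀ : L.Obj →ₗ[K] M.Obj) (k₁ : L.Ker →ₗ[K] M.Ker)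
    (k₂ : L.Obj →ₗ[K] L.Obj →ₗ[K] M.Ker)
    (k₂_self : ∀ x, k₂ x x = 0)
    (d_k₁ : ∀ a, M.d (k₁ a) = f₀ (L.d a))
    (d_k₂ : ∀ x y, M.d (k₂ x y) = f₀ (L.br₀ x y) - M.br₀ (f₀ x) (f₀ y))
    (k₁_act : ∀ x a, k₁ (L.act x a) = M.act (f₀ x) (k₁ a) + k₂ x (L.d a))
    (k₁_l₃ : ∀ x y z, k₁ (L.l₃ x y z) = M.l₃ (f₀ x) (f₀ y) (f₀ z) + M.act (f₀ x) (k₂ y z)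
      - M.act (f₀ y) (k₂ x z) + M.act (f₀ z) (k₂ x y) - k₂ (L.br₀ x y) z
      + k₂ (L.br₀ x z) y - k₂ (L.br₀ y z) x) : Hom L M :=
  have skew : ∀ x y, k₂ x y = - k₂ y x := fun x y => by
    have h := k₂_self (x + y)
    simp only [map_add, LinearMap.add_apply, k₂_self, zero_add, add_zero] at h
    exact eq_neg_of_add_eq_zero_right h
  have s₁ : ∀ a, M.s (M.i (f₀ (L.s a)) + (k₁ (L.part a) : M.Arr)) = f₀ (L.s a) := fun a => by
    rw [map_add, M.s_i, M.s_coe, add_zero]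
  have t₁ : ∀ a, M.t (M.i (f₀ (L.s a)) + (k₁ (L.part a) : M.Arr)) = f₀ (L.t a) := fun a => by
    rw [map_add, M.t_i, ← M.d_apply, d_k₁, ← map_add, ← L.t_eq]
  have s₂ : ∀ x y, M.s (M.i (M.br₀ (f₀ x) (f₀ y)) + (k₂ x y : M.Arr)) =
      M.br₀ (f₀ x) (f₀ y) := fun x y => by rw [map_add, M.s_i, M.s_coe, add_zero]
  have t₂ : ∀ x y, M.t (M.i (M.br₀ (f₀ x) (f₀ y)) + (k₂ x y : M.Arr)) =
      f₀ (L.br₀ x y) := fun x y => by rw [map_add, M.t_i, ← M.d_apply, d_k₂]; abel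
  { f₀ := f₀
    f₁ := M.i ∘ₗ f₀ ∘ₗ L.s + (LinearMap.ker M.s).subtype ∘ₗ k₁ ∘ₗ L.part
    f₂ := (M.br₀.compl₁₂ f₀ f₀).compr₂ M.i + k₂.compr₂ (LinearMap.ker M.s).subtype
    s_f₁ := s₁
    t_f₁ := t₁
    f₁_i := fun x => by simp [L.s_i]
    f₁_m := fun p h => by
      rw [M.m_eq_cmp, L.m_eq_cmp]
      apply M.arr_ext
      · exact ((s₁ _).trans (congrArg f₀ (L.s_cmp _ _))).trans ((M.s_cmp _ _).trans (s₁ _)).symm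
      · simp
    f₂_self := fun x => by simp [k₂_self, M.br₀_self]
    s_f₂ := s₂
    t_f₂ := t₂
    f₂_nat := fun a b => by
      apply M.arr_ext
      · refine (M.s_cmp _ _).trans ((M.s_br _ _).trans ?_)
        refine (congrArg₂ (fun x y => M.br₀ x y) (s₁ a) (s₁ b)).trans ?_
        exact ((M.s_cmp _ _).trans (s₂ _ _)).symm
      · rw [M.part_cmp, M.part_cmp, part_br₁]
        refine Eq.trans (b := M.act (f₀ (L.s a)) (k₁ (L.part b)) -
          M.act (f₀ (L.t b)) (k₁ (L.part a)) + k₂ (L.t a) (L.t b)) ?_ ?_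
        · refine congrArg₂ (· + ·) (congrArg₂ (· - ·) (congrArg₂ (fun x y => M.act x y) (s₁ a) ?_)
            (congrArg₂ (fun x y => M.act x y) (t₁ b) ?_)) ?_ <;> simp
        refine Eq.trans (b := k₂ (L.s a) (L.s b) + k₁ (L.part (L.br₁ a b))) ?_ (by simp)
        -- Equivariance at `s a` and at `t b` produces `k₂ (s a) (d b)` and `-k₂ (t b) (d a)`, with
        -- `d` taken of the arrow parts. By skew-symmetry these are what `k₂ (t a) (t b)` adds to
        -- `k₂ (s a) (s b)`.
        rw [L.part_br₁, map_sub, k₁_act, k₁_act, L.t_eq a, L.t_eq b]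
        simp only [map_add, LinearMap.add_apply]
        rw [← d_k₁ (L.part b), M.act_d, d_k₁, skew (L.s b), skew (L.d (L.part b))]
        abel
    coh := fun x y z => by
      apply M.arr_ext
      · simp [M.s_br, M.s_i, M.s_J, M.s_coe]
      · simp [M.part_br₁, M.s_br, M.t_br, M.s_i, M.s_J, M.s_coe, M.t_i, M.part_J, L.part_J,
          k₁_l₃, skew x (L.br₀ y z)]
        abel }

end Hom
end SemistrictLie2
end Lie2

namespace Lie2

open LieModule.Cohomology CategoryTheory

namespace SemistrictLie2

variable {K : Type u} [Field K] {L M N : SemistrictLie2 K}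

namespace Hom

theorem ext_parts {F G : Hom L M} (h₀ : ∀ x, F.f₀ x = G.f₀ x) (h₁ : ∀ a, F.k₁ a = G.k₁ a)
    (h₂ : ∀ x y, F.k₂ x y = G.k₂ x y) : F = G := by
  apply Hom.ext
  · exact LinearMap.ext h₀
  · refine LinearMap.ext fun a => M.arr_ext ?_ ?_
    · rw [F.s_f₁, G.s_f₁, h₀]
    · rw [F.part_f₁, G.part_f₁, h₁]
  · refine LinearMap.ext₂ fun x y => M.arr_ext ?_ (h₂ x y)
    rw [F.s_f₂, G.s_f₂, h₀, h₀]

@[simp] theorem id_f₀ (x : L.Obj) : (Hom.id L).f₀ x = x := rfl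

@[simp] theorem id_k₁ (a : L.Ker) : (Hom.id L).k₁ a = a := rfl

@[simp] theorem id_k₂ (x y : L.Obj) : (Hom.id L).k₂ x y = 0 := L.part_i _

variable (F : Hom L M) (G : Hom M N)

@[simp] theorem comp_f₀ (x : L.Obj) : (F.comp G).f₀ x = G.f₀ (F.f₀ x) := rfl

@[simp] theorem comp_k₁ (a : L.Ker) : (F.comp G).k₁ a = G.k₁ (F.k₁ a) := rfl

@[simp] theorem comp_k₂ (x y : L.Obj) :
    (F.comp G).k₂ x y = G.k₂ (F.f₀ x) (F.f₀ y) + G.k₁ (F.k₂ x y) := by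
  change N.part (N.cmp _ _) = _
  rw [N.part_cmp, G.part_f₁]
  rfl

section ofParts

variable (f₀ : L.Obj →ₗ[K] M.Obj) (k₁ : L.Ker →ₗ[K] M.Ker)
    (k₂ : L.Obj →ₗ[K] L.Obj →ₗ[K] M.Ker) (h₁) (h₂) (h₃) (h₄) (h₅)

@[simp] theorem ofParts_f₀ (x : L.Obj) : (ofParts f₀ k₁ k₂ h₁ h₂ h₃ h₄ h₅).f₀ x = f₀ x := rfl

@[simp] theorem ofParts_k₁ (a : L.Ker) : (ofParts f₀ k₁ k₂ h₁ h₂ h₃ h₄ h₅).k₁ a = k₁ a := by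
  apply Subtype.ext
  change M.i (f₀ (L.s a)) + (k₁ (L.part a) : M.Arr) = k₁ a
  rw [L.s_coe, map_zero, map_zero, zero_add, L.part_coe]

@[simp] theorem ofParts_k₂ (x y : L.Obj) :
    (ofParts f₀ k₁ k₂ h₁ h₂ h₃ h₄ h₅).k₂ x y = k₂ x y := by
  change M.part (M.i (M.br₀ (f₀ x) (f₀ y)) + (k₂ x y : M.Arr)) = _
  rw [map_add, M.part_i, M.part_coe, zero_add]

end ofParts

/-! ### 2-morphisms as homotopies -/

namespace TwoHom

variable {F F' : Hom L M}

/-- The arrow part of a 2-morphism. -/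
def k (α : TwoHom F F') : L.Obj →ₗ[K] M.Ker := M.part ∘ₗ α.θ

theorem part_θ (α : TwoHom F F') (x : L.Obj) : M.part (α.θ x) = α.k x := rfl

theorem d_k (α : TwoHom F F') (x : L.Obj) : M.d (α.k x) = F'.f₀ x - F.f₀ x := by
  rw [← part_θ, M.d_part, α.s_θ, α.t_θ]

theorem k₁_add (α : TwoHom F F') (a : L.Ker) : F.k₁ a + α.k (L.d a) = F'.k₁ a := by
  have h := congrArg M.part (α.nat a)
  rwa [M.part_cmp, M.part_cmp, part_f₁, part_f₁, part_θ, part_θ, L.part_coe, L.s_coe, map_zero,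
    zero_add] at h

theorem k₂_add (α : TwoHom F F') (x y : L.Obj) : F.k₂ x y + α.k (L.br₀ x y) =
    M.act (F.f₀ x) (α.k y) - M.act (F'.f₀ y) (α.k x) + F'.k₂ x y := by
  have h := congrArg M.part (α.compat x y)
  rwa [M.part_cmp, M.part_cmp, part_f₂, part_f₂, part_θ, part_br₁, part_θ, part_θ, α.s_θ,
    α.t_θ] at h

/-- A 2-morphism from its arrow part. -/
def ofPart (k : L.Obj →ₗ[K] M.Ker) (d_k : ∀ x, M.d (k x) = F'.f₀ x - F.f₀ x)
    (k₁_add : ∀ a, F.k₁ a + k (L.d a) = F'.k₁ a)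
    (k₂_add : ∀ x y, F.k₂ x y + k (L.br₀ x y) =
      M.act (F.f₀ x) (k y) - M.act (F'.f₀ y) (k x) + F'.k₂ x y) : TwoHom F F' :=
  have s' : ∀ x, M.s (M.i (F.f₀ x) + (k x : M.Arr)) = F.f₀ x := fun x => by
    rw [map_add, M.s_i, M.s_coe, add_zero]
  have t' : ∀ x, M.t (M.i (F.f₀ x) + (k x : M.Arr)) = F'.f₀ x := fun x => by
    rw [map_add, M.t_i, ← M.d_apply, d_k]; abel
  have p' : ∀ x, M.part (M.i (F.f₀ x) + (k x : M.Arr)) = k x := fun x => by simp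
  { θ := M.i ∘ₗ F.f₀ + (LinearMap.ker M.s).subtype ∘ₗ k
    s_θ := s'
    t_θ := t'
    nat := fun a => by
      apply M.arr_ext
      · rw [M.s_cmp, M.s_cmp, F.s_f₁]
        exact (s' _).symm
      · rw [M.part_cmp, M.part_cmp, part_f₁, part_f₁, ← k₁_add, L.t_eq]
        refine (congrArg₂ (· + ·) rfl (p' _)).trans ?_
        refine Eq.trans ?_ (congrArg₂ (· + ·) (p' _) rfl).symm
        rw [map_add]
        abel
    compat := fun x y => by
      apply M.arr_ext
      · rw [M.s_cmp, M.s_cmp, F.s_f₂, M.s_br]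
        exact (congrArg₂ (fun x y => M.br₀ x y) (s' x) (s' y)).symm
      · rw [M.part_cmp, M.part_cmp, part_f₂, part_f₂, part_br₁]
        refine (congrArg₂ (· + ·) rfl (p' _)).trans ((k₂_add x y).trans ?_)
        refine congrArg₂ (· + ·) (congrArg₂ (· - ·) ?_ ?_) rfl
        · exact (congrArg₂ (fun x y => M.act x y) (s' x) (p' y)).symm
        · exact (congrArg₂ (fun x y => M.act x y) (t' y) (p' x)).symm }

/-- 2-morphisms are invertible. -/
def symm (α : TwoHom F F') : TwoHom F' F :=
  ofPart (-α.k) (fun x => by rw [LinearMap.neg_apply, map_neg, α.d_k]; abel)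
    (fun a => by rw [LinearMap.neg_apply, ← α.k₁_add]; abel)
    (fun x y => by
      have h := α.k₂_add x y
      -- In the compatibility law `F` acts in one slot and `F'` in the other. Reversing the
      -- 2-morphism exchanges them, and the discrepancy `(F' x - F x) · k y + (F' y - F y) · k x`
      -- vanishes because both differences are boundaries.
      have h2 := M.act_d (α.k x) (α.k y)
      simp only [α.d_k, map_sub, LinearMap.sub_apply] at h2
      simp only [LinearMap.neg_apply, map_neg]
      linear_combination (norm := abel) - h + h2)

end TwoHom

variable {F} in
theorem TwoHom.twoIso {F' : Hom L M} (α : TwoHom F F') : TwoIso F F' := by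
  refine ⟨α, α.symm, fun x => M.arr_ext ?_ ?_, fun x => M.arr_ext ?_ ?_⟩
  · rw [M.s_cmp, α.s_θ, M.s_i]
  · rw [M.part_cmp, TwoHom.part_θ, M.part_i]
    change α.k x + M.part (M.i _ + ((- α.k x : M.Ker) : M.Arr)) = 0
    simp
  · rw [M.s_cmp, α.symm.s_θ, M.s_i]
  · rw [M.part_cmp, TwoHom.part_θ, M.part_i]
    change M.part (M.i _ + ((- α.k x : M.Ker) : M.Arr)) + α.k x = 0
    simp

/-- The arrow part measures the difference of the two homomorphisms in every component. This turns
equivalences of skeletal algebras into isomorphisms. -/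
theorem eq_of_k_eq_zero {F F' : Hom L M} (α : TwoHom F F') (h : ∀ x, α.k x = 0) : F = F' := by
  refine ext_parts (fun x => ?_) (fun a => ?_) (fun x y => ?_)
  · have := α.d_k x
    rw [h, map_zero, eq_comm, sub_eq_zero] at this
    exact this.symm
  · simpa [h] using α.k₁_add a
  · simpa [h] using α.k₂_add x y

/-! ### Equivalences: full faithfulness and essential surjectivity -/

/-- Full faithfulness, in terms of arrow parts. -/
def FullyFaithful (F : Hom L M) : Prop :=
  ∀ (b : M.Ker) (x : L.Obj), M.d b = F.f₀ x → ∃! a : L.Ker, L.d a = x ∧ F.k₁ a = b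

/-- Essential surjectivity, in terms of arrow parts. -/
def EssSurj (F : Hom L M) : Prop := ∀ y, ∃ x b, F.f₀ x + M.d b = y

variable {F}

/-- The uniqueness half of full faithfulness. Every identity needed for a quasi-inverse is an
identity in `L.Ker`, and is checked after applying `d` and after applying `k₁`. -/
theorem FullyFaithful.eq (hF : F.FullyFaithful) {a b : L.Ker} (hd : L.d a = L.d b)
    (hk : F.k₁ a = F.k₁ b) : a = b := by
  obtain ⟨c, _, hc⟩ := hF (F.k₁ b) (L.d b) (F.d_k₁ b)
  rw [hc a ⟨hd, hk⟩, hc b ⟨rfl, rfl⟩]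

/-- Full faithfulness says that `(k₁, d)` identifies `L.Ker` with the fibre product of `M.Ker` and
`L.Obj` over `M.Obj`. A linear left inverse of this embedding lifts compatible pairs; its values on
other pairs play no role. -/
theorem FullyFaithful.exists_lift (hF : F.FullyFaithful) :
    ∃ l : M.Ker × L.Obj →ₗ[K] L.Ker, ∀ b x, M.d b = F.f₀ x →
      L.d (l (b, x)) = x ∧ F.k₁ (l (b, x)) = b := by
  obtain ⟨l, hl⟩ := LinearMap.exists_leftInverse_of_injective (F.k₁.prod L.d)
    (LinearMap.ker_eq_bot.2 fun a b h => hF.eq (congrArg Prod.snd h) (congrArg Prod.fst h))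
  refine ⟨l, fun b x h => ?_⟩
  obtain ⟨a, ⟨h₁, h₂⟩, -⟩ := hF b x h
  have := LinearMap.congr_fun hl a
  subst h₁ h₂
  rw [show l (F.k₁ a, L.d a) = a from this]
  exact ⟨rfl, rfl⟩

/-- A linear right inverse of the surjection `f₀ + d` from `L.Obj × M.Ker` has the two required
components. -/
theorem EssSurj.exists_section (hF : F.EssSurj) :
    ∃ (g : M.Obj →ₗ[K] L.Obj) (θ : M.Obj →ₗ[K] M.Ker), ∀ y, M.d (θ y) = y - F.f₀ (g y) := by
  obtain ⟨s, hs⟩ := LinearMap.exists_rightInverse_of_surjective (F.f₀.coprod M.d)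
    (LinearMap.range_eq_top.2 fun y => by
      obtain ⟨x, b, h⟩ := hF y
      exact ⟨(x, b), h⟩)
  refine ⟨LinearMap.fst K _ _ ∘ₗ s, LinearMap.snd K _ _ ∘ₗ s, fun y => ?_⟩
  have := LinearMap.congr_fun hs y
  exact eq_sub_of_add_eq' this

/-- A fully faithful homomorphism has a quasi-inverse with prescribed object map and
homotopy. -/
theorem FullyFaithful.exists_quasiInverse (hF : F.FullyFaithful) (g : M.Obj →ₗ[K] L.Obj)
    (θ : M.Obj →ₗ[K] M.Ker) (hθ : ∀ y, M.d (θ y) = y - F.f₀ (g y)) :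
    ∃ (G : Hom M L) (α : TwoHom (G.comp F) (Hom.id M)) (β : TwoHom (F.comp G) (Hom.id L)),
      (∀ y, G.f₀ y = g y) ∧ (∀ y, α.k y = θ y) ∧ ∀ x, F.k₁ (β.k x) = θ (F.f₀ x) := by
  obtain ⟨l, hl⟩ := hF.exists_lift
  -- Forced: `d (g₁ a) = g (d a)` makes `G` a chain map, and `k₁ (g₁ a) + θ (d a) = a` makes `θ` a
  -- homotopy to the identity.
  let g₁ : M.Ker →ₗ[K] L.Ker := l ∘ₗ (LinearMap.id - θ ∘ₗ M.d).prod (g ∘ₗ M.d)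
  have hg₁ : ∀ a, L.d (g₁ a) = g (M.d a) ∧ F.k₁ (g₁ a) = a - θ (M.d a) := fun a => by
    refine hl (a - θ (M.d a)) (g (M.d a)) ?_
    rw [map_sub, hθ]
    abel
  -- `p` is the value of `F.k₁ ∘ g₂` forced by compatibility of `θ` with the brackets, and `q` is
  -- the value of `d ∘ g₂` forced by the boundary law for `k₂`.
  let p : M.Obj →ₗ[K] M.Obj →ₗ[K] M.Ker :=
    - F.k₂.compl₁₂ g g + M.act.compl₁₂ (F.f₀ ∘ₗ g) θ - (M.act.compl₁₂ LinearMap.id θ).flip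
      - M.br₀.compr₂ θ
  let q : M.Obj →ₗ[K] M.Obj →ₗ[K] L.Obj := M.br₀.compr₂ g - L.br₀.compl₁₂ g g
  let g₂ : M.Obj →ₗ[K] M.Obj →ₗ[K] L.Ker :=
    p.compr₂ (l ∘ₗ LinearMap.inl K _ _) + q.compr₂ (l ∘ₗ LinearMap.inr K _ _)
  have hg₂ : ∀ x y, L.d (g₂ x y) = g (M.br₀ x y) - L.br₀ (g x) (g y) ∧
      F.k₁ (g₂ x y) = - F.k₂ (g x) (g y) + M.act (F.f₀ (g x)) (θ y) - M.act y (θ x)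
        - θ (M.br₀ x y) := fun x y => by
    have h : g₂ x y = l (p x y, q x y) := by
      change l (p x y, 0) + l (0, q x y) = _
      rw [← map_add, Prod.mk_add_mk, add_zero, zero_add]
    rw [h]
    refine hl (p x y) (q x y) ?_
    change M.d (- F.k₂ (g x) (g y) + M.act (F.f₀ (g x)) (θ y) - M.act y (θ x)
        - θ (M.br₀ x y)) = F.f₀ (g (M.br₀ x y) - L.br₀ (g x) (g y))
    simp only [map_add, map_sub, map_neg, F.d_k₂, M.d_act, hθ]
    rw [M.br₀_skew y x, M.br₀_skew y (F.f₀ (g x))]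
    abel
  have self : ∀ x, g₂ x x = 0 := fun x => hF.eq
    (by rw [(hg₂ x x).1, M.br₀_self, L.br₀_self, map_zero, map_zero, sub_zero])
    (by
      have := M.act_d_self (θ x)
      rw [hθ, map_sub, LinearMap.sub_apply] at this
      rw [(hg₂ x x).2, F.k₂_self, M.br₀_self, map_zero, map_zero]
      linear_combination (norm := abel) - this)
  have act : ∀ x a, g₁ (M.act x a) = L.act (g x) (g₁ a) + g₂ x (M.d a) := fun x a => hF.eq
    (by rw [map_add, (hg₂ _ _).1, L.d_act, (hg₁ _).1, (hg₁ _).1, M.d_act]; abel)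
    (by
      have := M.act_d (θ x) a
      rw [hθ, map_sub, LinearMap.sub_apply] at this
      rw [map_add, (hg₂ _ _).2, F.k₁_act, (hg₁ _).2, (hg₁ _).2, M.d_act, (hg₁ _).1, map_sub]
      linear_combination (norm := abel) this)
  have lll : ∀ x y z, g₁ (M.l₃ x y z) = L.l₃ (g x) (g y) (g z) + L.act (g x) (g₂ y z)
      - L.act (g y) (g₂ x z) + L.act (g z) (g₂ x y) - g₂ (M.br₀ x y) z
      + g₂ (M.br₀ x z) y - g₂ (M.br₀ y z) x := fun x y z => hF.eq
    (by
      simp only [map_add, map_sub, (hg₂ _ _).1, L.d_act, (hg₁ _).1, M.d_l₃, L.d_l₃]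
      rw [L.br₀_skew (g z) (g (M.br₀ x y)), L.br₀_skew (g (M.br₀ x z)) (g y),
        L.br₀_skew (g (M.br₀ y z)), L.br₀_skew (g z) (L.br₀ _ _), L.br₀_skew (g y) (L.br₀ _ _),
        M.br₀_skew x (M.br₀ y z), map_neg]
      abel)
    (by
      -- `A`, `B` and `C` commute two successive actions on values of `θ`. As `d (θ z) = z - F.f₀ (g
      -- z)`, their Jacobiator terms telescope from `l₃` of the three objects `F.f₀ (g _)` to `l₃ x
      -- y z`, one argument at a time. The remaining terms cancel in pairs by `act_d`.
      have A := M.act_act (F.f₀ (g x)) (F.f₀ (g y)) (θ z)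
      have B := M.act_act (F.f₀ (g x)) z (θ y)
      have C := M.act_act y z (θ x)
      have D₁ := M.act_d (θ y) (M.act z (θ x))
      have D₂ := M.act_d (θ z) (M.act (F.f₀ (g x)) (θ y))
      have D₃ := M.act_d (θ z) (M.act y (θ x))
      have E₁ := M.act_d (θ x) (θ (M.br₀ y z))
      have E₂ := M.act_d (θ y) (θ (M.br₀ x z))
      have E₃ := M.act_d (θ z) (θ (M.br₀ x y))
      simp only [M.d_act, hθ, map_sub, LinearMap.sub_apply] at A B C D₁ D₂ D₃ E₁ E₂ E₃
      rw [M.l₃_swap_right (F.f₀ (g x)) z y, M.l₃_swap_right (F.f₀ (g x)) z] at B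
      rw [M.l₃_swap_right y z x, M.l₃_swap_left y x z, M.l₃_swap_right y z,
        M.l₃_swap_left y _ z] at C
      rw [M.br₀_skew z x, M.br₀_skew z] at D₁
      rw [M.br₀_skew y x, M.br₀_skew y] at D₃
      simp only [map_add, map_sub, (hg₂ _ _).2, (hg₂ _ _).1, F.k₁_act, (hg₁ _).2, M.d_l₃, F.k₁_l₃,
        map_neg, LinearMap.neg_apply] at D₁ D₃ ⊢
      rw [F.k₂_skew (g z) (g (M.br₀ x y)), F.k₂_skew (g x) (g (M.br₀ y z)),
        F.k₂_skew (g y) (g (M.br₀ x z)), F.k₂_skew (g z) (L.br₀ _ _),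
        F.k₂_skew (g y) (L.br₀ _ _), F.k₂_skew (g x) (L.br₀ _ _), M.br₀_skew x (M.br₀ y z),
        map_neg]
      linear_combination (norm := abel) - A + B - C + D₁ + D₂ - D₃ - E₁ + E₂ - E₃)
  let G : Hom M L := ofParts g g₁ g₂ self (fun a => (hg₁ a).1) (fun x y => (hg₂ x y).1) act lll
  -- The second homotopy: its boundary must be `x - g (F.f₀ x)`, and its image under `k₁` is taken
  -- to be `θ (F.f₀ x)`, a compatible pair.
  let b : L.Obj →ₗ[K] L.Ker := l ∘ₗ (θ ∘ₗ F.f₀).prod (LinearMap.id - g ∘ₗ F.f₀)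
  have hb : ∀ x, L.d (b x) = x - g (F.f₀ x) ∧ F.k₁ (b x) = θ (F.f₀ x) := fun x => by
    refine hl _ _ ?_
    change M.d (θ (F.f₀ x)) = F.f₀ (x - g (F.f₀ x))
    rw [hθ, map_sub]
  refine ⟨G, TwoHom.ofPart θ hθ (fun a => ?_) (fun x y => ?_),
    TwoHom.ofPart b (fun x => (hb x).1) (fun a => ?_) (fun x y => ?_), fun y => rfl, fun y => ?_,
    fun x => ?_⟩
  · rw [comp_k₁, ofParts_k₁, (hg₁ a).2, id_k₁]
    abel
  · rw [comp_k₂, ofParts_k₂, (hg₂ x y).2, id_k₂, comp_f₀, id_f₀, ofParts_f₀, ofParts_f₀]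
    abel
  · rw [comp_k₁, ofParts_k₁, id_k₁]
    refine hF.eq ?_ ?_
    · rw [map_add, (hg₁ _).1, (hb _).1, F.d_k₁]
      abel
    · rw [map_add, (hg₁ _).2, (hb _).2, F.d_k₁]
      abel
  · rw [comp_k₂, ofParts_k₂, ofParts_k₁, id_k₂, comp_f₀, id_f₀, ofParts_f₀, add_zero]
    refine hF.eq ?_ ?_
    · simp only [map_add, map_sub, (hg₂ _ _).1, (hg₁ _).1, (hb _).1, F.d_k₂, L.d_act]
      rw [L.br₀_skew y x, L.br₀_skew y]
      abel
    · simp only [map_add, map_sub, (hg₂ _ _).2, (hg₁ _).2, (hb _).1, (hb _).2, F.d_k₂, F.k₁_act]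
      rw [F.k₂_skew y x, F.k₂_skew y]
      abel
  · change M.part (M.i _ + (θ y : M.Arr)) = _
    simp
  · change F.k₁ (L.part (L.i _ + (b x : L.Arr))) = _
    rw [map_add, L.part_i, L.part_coe, zero_add, (hb x).2]

theorem IsEquivalence.of_fullyFaithful (hF : F.FullyFaithful) (hF' : F.EssSurj) :
    F.IsEquivalence := by
  obtain ⟨g, θ, hθ⟩ := hF'.exists_section
  obtain ⟨G, α, β, -⟩ := hF.exists_quasiInverse g θ hθ
  exact ⟨G, β.twoIso, α.twoIso⟩

theorem IsEquivalence.essSurj (hF : F.IsEquivalence) : F.EssSurj := by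
  obtain ⟨G, -, ⟨α, -, -⟩⟩ := hF
  refine fun y => ⟨G.f₀ y, α.k y, ?_⟩
  rw [α.d_k, comp_f₀, id_f₀]
  abel

theorem IsEquivalence.fullyFaithful (hF : F.IsEquivalence) : F.FullyFaithful := by
  obtain ⟨G, ⟨β, -, -⟩, ⟨α, -, -⟩⟩ := hF
  have hβ : ∀ a, G.k₁ (F.k₁ a) + β.k (L.d a) = a := β.k₁_add
  have hα : ∀ b, F.k₁ (G.k₁ b) + α.k (M.d b) = b := α.k₁_add
  have dβ : ∀ x, L.d (β.k x) = x - G.f₀ (F.f₀ x) := β.d_k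
  intro b x h
  -- The homotopy law `G.k₁ (F.k₁ a) + β.k (L.d a) = a` leaves no other candidate.
  refine ⟨G.k₁ b + β.k x, ⟨?_, ?_⟩, ?_⟩
  · rw [map_add, G.d_k₁, h, dβ]
    abel
  -- By the homotopy `α`, an element of `M.Ker` is determined by its boundary and its image under
  -- `G.k₁`; the equality is checked on these two.
  · have key : ∀ b b' : M.Ker, M.d b = M.d b' → G.k₁ b = G.k₁ b' → b = b' := fun b b' h h' => by
      rw [← hα b, ← hα b', h, h']
    refine key _ _ ?_ ?_
    · rw [F.d_k₁, map_add, G.d_k₁, h, dβ]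
      simp
    · have h2 := hβ (G.k₁ b + β.k x)
      rw [map_add L.d, G.d_k₁, h, dβ, add_sub_cancel] at h2
      exact add_right_cancel h2
  · rintro a ⟨rfl, rfl⟩
    exact (hβ a).symm

/-- Both conditions of the criterion compose directly, so no whiskering of 2-morphisms is needed. -/
theorem IsEquivalence.comp {G : Hom M N} (hF : F.IsEquivalence) (hG : G.IsEquivalence) :
    (F.comp G).IsEquivalence := by
  refine .of_fullyFaithful (fun c x h => ?_) (fun z => ?_)
  · obtain ⟨b, ⟨h₁, h₂⟩, hb⟩ := hG.fullyFaithful c (F.f₀ x) h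
    obtain ⟨a, ⟨h₃, h₄⟩, ha⟩ := hF.fullyFaithful b x h₁
    refine ⟨a, ⟨h₃, by rw [comp_k₁, h₄, h₂]⟩, fun a' ⟨h₅, h₆⟩ => ha a' ⟨h₅, ?_⟩⟩
    exact hb _ ⟨by rw [F.d_k₁, h₅], h₆⟩
  · obtain ⟨y, c, h⟩ := hG.essSurj z
    obtain ⟨x, b, h'⟩ := hF.essSurj y
    refine ⟨x, G.k₁ b + c, ?_⟩
    rw [comp_f₀, map_add, G.d_k₁, ← add_assoc, ← map_add, h', h]

theorem IsIso.isEquivalence (hF : F.IsIso) : F.IsEquivalence := by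
  obtain ⟨G, h₁, h₂⟩ := hF
  have refl : ∀ {L M : SemistrictLie2 K} {F F' : Hom L M}, F = F' → TwoIso F F' := by
    rintro L M F _ rfl
    exact (TwoHom.ofPart 0 (by simp) (by simp) (by simp)).twoIso
  exact ⟨G, refl h₁, refl h₂⟩

end Hom
end SemistrictLie2
end Lie2

namespace Lie2

open LieModule.Cohomology CategoryTheory

/-! ### Classes in `H³` -/

section Transport

variable {K : Type u} [Field K]
variable {g : Type u} [LieRing g] [LieAlgebra K g]
variable {V : Type u} [AddCommGroup V] [Module K V] [LieRingModule g V] [LieModule K g V]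
variable {g' : Type u} [LieRing g'] [LieAlgebra K g']
variable {V' : Type u} [AddCommGroup V'] [Module K V'] [LieRingModule g' V'] [LieModule K g' V']

theorem H3.mk_eq_mk_iff (w w' : Z3 K g V) :
    (Submodule.Quotient.mk w : H3 K g V) = Submodule.Quotient.mk w' ↔
      ∃ b : twoCochain K g V, ∀ x y z, w.1 x y z = w'.1 x y z + d₂₃ K g V b x y z := by
  rw [Submodule.Quotient.eq]
  constructor
  · rintro ⟨b, hb⟩
    refine ⟨b, fun x y z => ?_⟩
    have := LinearMap.congr_fun (LinearMap.congr_fun (LinearMap.congr_fun hb x) y) z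
    rw [this]
    change _ = _ + (w.1 x y z - w'.1 x y z)
    abel
  · rintro ⟨b, hb⟩
    refine ⟨b, ?_⟩
    ext x y z
    change _ = w.1 x y z - w'.1 x y z
    rw [hb]
    abel

/-- Transport along `(e, f)` carries the class of `w` to the class of `w'` iff `w` and `w'` differ
by the differential of a 2-cochain. -/
theorem H3.transport_mk_eq_mk_iff (e : g ≃ₗ⁅K⁆ g') (f : V ≃ₗ[K] V')
    (hf : ∀ x v, f ⁅x, v⁆ = ⁅e x, f v⁆) (w : Z3 K g V) (w' : Z3 K g' V') :
    H3.transport e f hf (Submodule.Quotient.mk w) = Submodule.Quotient.mk w' ↔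
      ∃ b : g →ₗ[K] g →ₗ[K] V', (∀ x, b x x = 0) ∧ ∀ x y z,
        f (w.1 x y z) = w'.1 (e x) (e y) (e z) + ⁅e x, b y z⁆ - ⁅e y, b x z⁆ + ⁅e z, b x y⁆
          - b ⁅x, y⁆ z + b ⁅x, z⁆ y - b ⁅y, z⁆ x := by
  refine (H3.mk_eq_mk_iff (Z3.transport e f hf w) w').trans ⟨?_, ?_⟩
  · rintro ⟨b, hb⟩
    refine ⟨b.1.compl₁₂ (e : g →ₗ[K] g') (e : g →ₗ[K] g'), fun x => b.2 (e x),
      fun x y z => ?_⟩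
    have := hb (e x) (e y) (e z)
    change f (w.1 (e.symm (e x)) (e.symm (e y)) (e.symm (e z))) = _ at this
    simp only [e.symm_apply_apply, d₂₃_apply] at this
    rw [this]
    change _ = _ + ⁅e x, b (e y) (e z)⁆ - ⁅e y, b (e x) (e z)⁆ + ⁅e z, b (e x) (e y)⁆
      - b (e ⁅x, y⁆) (e z) + b (e ⁅x, z⁆) (e y) - b (e ⁅y, z⁆) (e x)
    simp only [LieEquiv.map_lie]
    abel
  · rintro ⟨b, hb, h⟩
    refine ⟨⟨b.compl₁₂ (e.symm : g' →ₗ[K] g) (e.symm : g' →ₗ[K] g), fun x => hb (e.symm x)⟩,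
      fun x y z => ?_⟩
    have := h (e.symm x) (e.symm y) (e.symm z)
    change f (w.1 (e.symm x) (e.symm y) (e.symm z)) = _
    simp only [e.apply_symm_apply] at this
    rw [this]
    change _ = _ + (⁅x, b (e.symm y) (e.symm z)⁆ - ⁅y, b (e.symm x) (e.symm z)⁆
      + ⁅z, b (e.symm x) (e.symm y)⁆ - b (e.symm ⁅x, y⁆) (e.symm z)
      + b (e.symm ⁅x, z⁆) (e.symm y) - b (e.symm ⁅y, z⁆) (e.symm x))
    simp only [LieEquiv.map_lie]
    abel

variable {g'' : Type u} [LieRing g''] [LieAlgebra K g'']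
variable {V'' : Type u} [AddCommGroup V''] [Module K V''] [LieRingModule g'' V'']
  [LieModule K g'' V'']

theorem H3.transport_transport (e : g ≃ₗ⁅K⁆ g') (f : V ≃ₗ[K] V')
    (hf : ∀ x v, f ⁅x, v⁆ = ⁅e x, f v⁆) (e' : g' ≃ₗ⁅K⁆ g'') (f' : V' ≃ₗ[K] V'')
    (hf' : ∀ x v, f' ⁅x, v⁆ = ⁅e' x, f' v⁆) (hf'') (c : H3 K g V) :
    H3.transport e' f' hf' (H3.transport e f hf c) =
      H3.transport (e.trans e') (f.trans f') hf'' c := by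
  induction c using Submodule.Quotient.induction_on with | _ w
  rfl

theorem H3.transport_eq_self (e : g ≃ₗ⁅K⁆ g) (f : V ≃ₗ[K] V)
    (hf : ∀ x v, f ⁅x, v⁆ = ⁅e x, f v⁆) (he : ∀ x, e x = x) (hf' : ∀ v, f v = v) (c : H3 K g V) :
    H3.transport e f hf c = c := by
  induction c using Submodule.Quotient.induction_on with | _ w
  have he' : ∀ x, e.symm x = x := fun x => by rw [← he (e.symm x), e.apply_symm_apply]
  refine congrArg (Submodule.Quotient.mk (p := (B3 K g V).comap (Z3 K g V).subtype)) ?_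
  apply Subtype.ext
  ext x y z
  change f (w.1 (e.symm x) (e.symm y) (e.symm z)) = w.1 x y z
  rw [hf', he', he', he']

theorem H3.transport_symm_transport (e : g ≃ₗ⁅K⁆ g') (f : V ≃ₗ[K] V')
    (hf : ∀ x v, f ⁅x, v⁆ = ⁅e x, f v⁆) (hf') (c : H3 K g V) :
    H3.transport e.symm f.symm hf' (H3.transport e f hf c) = c := by
  rw [H3.transport_transport e f hf e.symm f.symm hf' (fun x v => by simp [hf, hf'])]
  exact H3.transport_eq_self _ _ _ e.symm_apply_apply f.symm_apply_apply c

end Transport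

/-! ### The groupoid of triplets -/

namespace Triplet

variable {K : Type u} [Field K]

/-- The identity isomorphism. -/
def Iso.refl (T : Triplet K) : Iso T T :=
  ⟨LieEquiv.refl, LinearEquiv.refl K T.V, fun _ _ => rfl, H3.transport_eq_self _ _ _ (fun _ => rfl) (fun _ => rfl) _⟩

/-- Composition of isomorphisms. -/
def Iso.trans {T T' T'' : Triplet K} (E : Iso T T') (E' : Iso T' T'') : Iso T T'' :=
  ⟨E.e.trans E'.e, E.f.trans E'.f, fun x v => by
    change E'.f (E.f _) = ⁅E'.e (E.e x), E'.f (E.f v)⁆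
    rw [E.equivariant, E'.equivariant], by
    rw [← H3.transport_transport E.e E.f E.equivariant E'.e E'.f E'.equivariant, E.map_cls,
      E'.map_cls]⟩

/-- The inverse isomorphism. -/
def Iso.symm {T T' : Triplet K} (E : Iso T T') : Iso T' T where
  e := E.e.symm
  f := E.f.symm
  equivariant x v := by
    rw [LinearEquiv.symm_apply_eq, E.equivariant, E.e.apply_symm_apply, E.f.apply_symm_apply]
  map_cls := by
    rw [← E.map_cls, H3.transport_symm_transport]

theorem isomorphic_equivalence : Equivalence (Isomorphic (K := K)) :=
  ⟨fun T => ⟨.refl T⟩, fun ⟨E⟩ => ⟨E.symm⟩, fun ⟨E⟩ ⟨E'⟩ => ⟨E.trans E'⟩⟩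

theorem mk_eq_mk_iff {T T' : Triplet K} :
    (Quot.mk Isomorphic T = Quot.mk Isomorphic T') ↔ Isomorphic T T' :=
  isomorphic_equivalence.quot_mk_eq_iff T T'

end Triplet


/-! ### Skeletal Lie 2-algebras -/

namespace SkeletalLie2

variable {K : Type u} [Field K]

/-- A homomorphism of skeletal Lie 2-algebras which is bijective on objects and on arrow parts
is an equivalence. -/
theorem isEquivalence_of_bijective {S T : SkeletalLie2 K}
    (F : SemistrictLie2.Hom S.toSemistrictLie2 T.toSemistrictLie2)
    (h₀ : Function.Bijective F.f₀) (h₁ : Function.Bijective F.k₁) : F.IsEquivalence := by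
  refine .of_fullyFaithful (fun b x h => ?_) (fun y => ?_)
  · obtain ⟨a, ha⟩ := h₁.2 b
    rw [T.d_eq_zero, LinearMap.zero_apply, ← map_zero F.f₀] at h
    exact ⟨a, ⟨by rw [S.d_eq_zero, ← h₀.1 h]; rfl, ha⟩, fun a' h' => h₁.1 (h'.2.trans ha.symm)⟩
  · obtain ⟨x, hx⟩ := h₀.2 y
    exact ⟨x, 0, by rw [map_zero, add_zero, hx]⟩

/-- With zero differentials, essential surjectivity is surjectivity of `f₀`. Full faithfulness at `b
= 0` is injectivity of `f₀`, and at `x = 0` it is bijectivity of `k₁`. -/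
theorem bijective_of_isEquivalence {S T : SkeletalLie2 K}
    {F : SemistrictLie2.Hom S.toSemistrictLie2 T.toSemistrictLie2} (hF : F.IsEquivalence) :
    Function.Bijective F.f₀ ∧ Function.Bijective F.k₁ := by
  have hS : ∀ a, S.d a = 0 := fun a => by rw [S.d_eq_zero]; rfl
  have hT : ∀ a, T.d a = 0 := fun a => by rw [T.d_eq_zero]; rfl
  refine ⟨⟨fun x y h => ?_, fun y => ?_⟩, fun a b h => ?_, fun b => ?_⟩
  · obtain ⟨a, ⟨ha, -⟩, -⟩ := hF.fullyFaithful 0 (x - y) (by rw [map_sub, h, sub_self, map_zero])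
    rw [hS, eq_comm, sub_eq_zero] at ha
    exact ha
  · obtain ⟨x, b, h⟩ := hF.essSurj y
    exact ⟨x, by rw [← h, hT, add_zero]⟩
  · exact hF.fullyFaithful.eq (by rw [hS, hS]) h
  · obtain ⟨a, ⟨-, ha⟩, -⟩ := hF.fullyFaithful b 0 (by rw [hT, map_zero])
    exact ⟨a, ha⟩

/-- The quasi-inverse can be built on the inverse of `f₀` with zero homotopy. Then both 2-morphisms
have zero arrow part and are equalities. -/
theorem isEquivalence_iff_isIso {S T : SkeletalLie2 K}
    (F : SemistrictLie2.Hom S.toSemistrictLie2 T.toSemistrictLie2) :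
    F.IsEquivalence ↔ F.IsIso := by
  refine ⟨fun hF => ?_, fun hF => hF.isEquivalence⟩
  let e := LinearEquiv.ofBijective F.f₀ (bijective_of_isEquivalence hF).1
  obtain ⟨G, α, β, -, hα, hβ⟩ := hF.fullyFaithful.exists_quasiInverse (e.symm : T.Obj →ₗ[K] S.Obj)
    0 (fun y => by
      have : F.f₀ (e.symm y) = y := e.apply_symm_apply y
      simp [this])
  refine ⟨G, SemistrictLie2.Hom.eq_of_k_eq_zero β fun x => hF.fullyFaithful.eq ?_ ?_,
    SemistrictLie2.Hom.eq_of_k_eq_zero α hα⟩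
  · rw [S.d_eq_zero]
    rfl
  · rw [hβ, map_zero]
    rfl

/-- An equivalence of skeletal Lie 2-algebras induces an isomorphism of triplets. -/
theorem exists_iso_of_hom {S T : SkeletalLie2 K}
    (F : SemistrictLie2.Hom S.toSemistrictLie2 T.toSemistrictLie2)
    (h₀ : Function.Bijective F.f₀) (h₁ : Function.Bijective F.k₁) :
    ∃ E : Triplet.Iso S.triplet T.triplet, (∀ x : S.Obj, E.e x = F.f₀ x) ∧
      ∀ v : S.Ker, E.f v = F.k₁ v := by
  have hT : ∀ a, T.d a = 0 := fun a => by rw [T.d_eq_zero]; rfl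
  have hS : ∀ a, S.d a = 0 := fun a => by rw [S.d_eq_zero]; rfl
  let e : S.Obj ≃ₗ⁅K⁆ T.Obj :=
    { LinearEquiv.ofBijective F.f₀ h₀ with
      map_lie' := fun {x y} => by
        have := F.d_k₂ x y
        rw [hT, eq_comm, sub_eq_zero] at this
        exact this }
  let f : S.Ker ≃ₗ[K] T.Ker := LinearEquiv.ofBijective F.k₁ h₁
  have hf : ∀ (x : S.Obj) (v : S.Ker), f ⁅x, v⁆ = ⁅e x, f v⁆ := fun x v => by
    have := F.k₁_act x v
    rw [hS, map_zero, add_zero] at this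
    exact this
  -- The coherence law of `F` is, verbatim, the statement that `k₂` bounds the difference of the two
  -- cocycles.
  exact ⟨⟨e, f, hf, (H3.transport_mk_eq_mk_iff e f hf S.cocycle T.cocycle).2
    ⟨F.k₂, F.k₂_self, F.k₁_l₃⟩⟩, fun _ => rfl, fun _ => rfl⟩

/-- An isomorphism of triplets is induced by an isomorphism of skeletal Lie 2-algebras. -/
theorem exists_hom_of_iso {S T : SkeletalLie2 K} (E : Triplet.Iso S.triplet T.triplet) :
    ∃ F : SemistrictLie2.Hom S.toSemistrictLie2 T.toSemistrictLie2,
      F.IsEquivalence ∧ (∀ x : S.Obj, F.f₀ x = E.e x) ∧ ∀ v : S.Ker, F.k₁ v = E.f v := by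
  have hT : ∀ a, T.d a = 0 := fun a => by rw [T.d_eq_zero]; rfl
  have hS : ∀ a, S.d a = 0 := fun a => by rw [S.d_eq_zero]; rfl
  obtain ⟨e, f, hf, h⟩ := E
  change S.Obj ≃ₗ⁅K⁆ T.Obj at e
  change S.Ker ≃ₗ[K] T.Ker at f
  obtain ⟨b, hb, h⟩ := (H3.transport_mk_eq_mk_iff e f hf S.cocycle T.cocycle).1 h
  let F : SemistrictLie2.Hom S.toSemistrictLie2 T.toSemistrictLie2 :=
    .ofParts (e : S.Obj →ₗ[K] T.Obj) (f : S.Ker →ₗ[K] T.Ker) b hb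
      (fun a => by rw [hT, hS, map_zero])
      (fun x y => by rw [hT, eq_comm, sub_eq_zero]; exact e.map_lie x y)
      (fun x a => by rw [hS, map_zero, add_zero]; exact hf x a) h
  have hF₁ : ∀ v, F.k₁ v = f v := fun v => SemistrictLie2.Hom.ofParts_k₁ _ _ _ _ _ _ _ _ v
  refine ⟨F, isEquivalence_of_bijective F e.bijective ?_, fun _ => rfl, hF₁⟩
  rw [show (F.k₁ : S.Ker → T.Ker) = f from funext hF₁]
  exact f.bijective

theorem exists_isIso_iff (S T : SkeletalLie2 K) (e : S.Obj ≃ₗ[K] T.Obj) (f : S.Ker ≃ₗ[K] T.Ker) :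
    (∃ F : SemistrictLie2.Hom S.toSemistrictLie2 T.toSemistrictLie2,
        F.IsIso ∧ (∀ x, F.f₀ x = e x) ∧ ∀ v : S.Ker, F.f₁ v = (f v : T.Arr)) ↔
      ∃ E : Triplet.Iso S.triplet T.triplet,
        (∀ x : S.Obj, E.e x = e x) ∧ ∀ v : S.Ker, E.f v = f v := by
  constructor
  · rintro ⟨F, hF, h₀, h₁⟩
    obtain ⟨b₀, b₁⟩ := bijective_of_isEquivalence hF.isEquivalence
    obtain ⟨E, hE, hE'⟩ := exists_iso_of_hom F b₀ b₁
    exact ⟨E, fun x => (hE x).trans (h₀ x), fun v => (hE' v).trans (Subtype.ext (h₁ v))⟩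
  · rintro ⟨E, hE, hE'⟩
    obtain ⟨F, hF, h₀, h₁⟩ := exists_hom_of_iso E
    exact ⟨F, (isEquivalence_iff_isIso F).1 hF, fun x => (h₀ x).trans (hE x),
      fun v => congrArg Subtype.val ((h₁ v).trans (hE' v))⟩

theorem equivalent_iff_isomorphic (S T : SkeletalLie2 K) :
    S.Equivalent T ↔ Triplet.Isomorphic S.triplet T.triplet := by
  constructor
  · rintro ⟨F, hF⟩
    obtain ⟨b₀, b₁⟩ := bijective_of_isEquivalence hF
    exact ⟨(exists_iso_of_hom F b₀ b₁).choose⟩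
  · rintro ⟨E⟩
    obtain ⟨F, hF, -⟩ := exists_hom_of_iso E
    exact ⟨F, hF⟩

/-! ### Skeletal algebras from cocycles -/

/-- The data of a skeletal Lie 2-algebra: objects, arrow parts and the three brackets. -/
structure Data (K : Type u) [Field K] where
  g : Type u
  V : Type u
  [addCommGroupG : AddCommGroup g]
  [moduleG : Module K g]
  [addCommGroupV : AddCommGroup V]
  [moduleV : Module K V]
  br : g →ₗ[K] g →ₗ[K] g
  act : g →ₗ[K] V →ₗ[K] V
  l : g →ₗ[K] g →ₗ[K] g →ₗ[K] V
  br_self : ∀ x, br x x = 0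
  br_br : ∀ x y z, br (br x y) z = br x (br y z) + br (br x z) y
  act_act : ∀ x y v, act x (act y v) = act y (act x v) + act (br x y) v
  l_self_left : ∀ x z, l x x z = 0
  l_self_right : ∀ x y, l x y y = 0
  l_jacobiator : ∀ w x y z,
    l (br w x) y z - act y (l w x z) + l w (br x z) y + l (br w z) x y + l w x (br y z) =
      - act z (l w x y) + l (br w y) x z + l w (br x y) z - act x (l w y z) + act w (l x y z)

attribute [instance] Data.addCommGroupG Data.moduleG Data.addCommGroupV Data.moduleV

namespace Data

variable (D : Data K)

/-- The underlying 2-vector space, with zero differential. -/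
def toTwoVect : TwoVect K where
  Obj := D.g
  Arr := D.V × D.g
  s := LinearMap.snd K D.V D.g
  t := LinearMap.snd K D.V D.g
  i := LinearMap.inr K D.V D.g
  m := (LinearMap.fst K _ _ + LinearMap.inl K D.V D.g ∘ₗ LinearMap.fst K D.V D.g ∘ₗ
    LinearMap.snd K _ _) ∘ₗ (composable (LinearMap.snd K D.V D.g) _).subtype
  s_i _ := rfl
  t_i _ := rfl
  s_m _ := by simp
  t_m p := by
    have : p.1.1.2 = p.1.2.2 := p.2
    simp [this]
  id_m f h := by simp
  m_id f h := by simp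
  assoc p q h h₁ h₂ := by
    simp only [LinearMap.comp_apply, LinearMap.add_apply, Submodule.subtype_apply, h]
    simp [h, add_assoc]

theorem toTwoVect_cmp :
    D.toTwoVect.cmp = fun (a b : D.V × D.g) => ((a.1 + b.1, a.2) : D.V × D.g) := by
  funext a b
  rw [TwoVect.cmp_eq]
  change ((a.1 + b.1 - 0, a.2 + b.2 - b.2) : D.V × D.g) = (a.1 + b.1, a.2)
  simp

/-- The bracket of arrows. -/
def br₁ : D.V × D.g →ₗ[K] D.V × D.g →ₗ[K] D.V × D.g :=
  LinearMap.mk₂ K (fun a b => (D.act a.2 b.1 - D.act b.2 a.1, D.br a.2 b.2))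
    (by intros; ext <;> simp; abel) (by intros; ext <;> simp [smul_sub])
    (by intros; ext <;> simp; abel) (by intros; ext <;> simp [smul_sub])

/-- The Jacobiator. -/
def J : D.g →ₗ[K] D.g →ₗ[K] D.g →ₗ[K] D.V × D.g where
  toFun x := LinearMap.mk₂ K (fun y z => (D.l x y z, D.br (D.br x y) z))
    (by intros; simp) (by intros; simp) (by intros; simp) (by intros; simp)
  map_add' _ _ := by ext <;> simp
  map_smul' _ _ := by ext <;> simp

/-- The skeletal Lie 2-algebra with the given data. -/
def toSkeletal : SkeletalLie2 K where
  toTwoVect := D.toTwoVect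
  br₀ := D.br
  br₁ := D.br₁
  br₀_self := D.br_self
  br₁_self f := Prod.ext (sub_self _) (D.br_self _)
  s_br _ _ := rfl
  t_br _ _ := rfl
  i_br x y := by
    change ((0 : D.V), D.br x y) = (D.act x 0 - D.act y 0, D.br x y)
    simp
  m_br p q h := by
    rw [TwoVect.m_eq_cmp, TwoVect.m_eq_cmp, TwoVect.m_eq_cmp, toTwoVect_cmp]
    have hp : p.1.1.2 = p.1.2.2 := p.2
    have hq : q.1.1.2 = q.1.2.2 := q.2
    change ((D.act p.1.1.2 q.1.1.1 - D.act q.1.1.2 p.1.1.1) +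
      (D.act p.1.2.2 q.1.2.1 - D.act q.1.2.2 p.1.2.1), D.br p.1.1.2 q.1.1.2) =
      (D.act p.1.1.2 (q.1.1.1 + q.1.2.1) - D.act q.1.1.2 (p.1.1.1 + p.1.2.1),
        D.br p.1.1.2 q.1.1.2)
    rw [map_add, map_add, ← hp, ← hq]
    congr 1
    abel
  J := D.J
  s_J x y z := rfl
  t_J x y z := D.br_br x y z
  J_alt x z := Prod.ext ((sub_zero _).trans (D.l_self_left x z)) (sub_self (G := D.g) _)
  J_alt' x y := Prod.ext ((sub_zero _).trans (D.l_self_right x y)) (sub_self (G := D.g) _)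
  J_nat f g h := by
    rw [toTwoVect_cmp]
    change (D.l f.2 g.2 h.2 + ((D.act f.2 (D.act g.2 h.1 - D.act h.2 g.1) -
      D.act (D.br g.2 h.2) f.1) + (D.act (D.br f.2 h.2) g.1 - D.act g.2 (D.act f.2 h.1
      - D.act h.2 f.1))), D.br (D.br f.2 g.2) h.2) =
      ((D.act (D.br f.2 g.2) h.1 - D.act h.2 (D.act f.2 g.1 - D.act g.2 f.1))
      + D.l f.2 g.2 h.2, D.br (D.br f.2 g.2) h.2)
    refine Prod.ext ?_ rfl
    simp only [map_sub]
    rw [D.act_act f.2 g.2 h.1, D.act_act f.2 h.2 g.1, D.act_act g.2 h.2 f.1]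
    abel
  jacobiator w x y z := by
    have h := D.l_jacobiator w x y z
    rw [toTwoVect_cmp]
    change ((D.l (D.br w x) y z + ((D.act (D.br (D.br w x) z) 0 - D.act y (D.l w x z)) + 0)) +
        (D.l w (D.br x z) y + D.l (D.br w z) x y + D.l w x (D.br y z)),
        D.br (D.br (D.br w x) y) z) =
      ((((D.act (D.br (D.br w x) y) 0 - D.act z (D.l w x y)) +
        (D.l (D.br w y) x z + D.l w (D.br x y) z)) +
        ((D.act (D.br (D.br w y) z) 0 - D.act x (D.l w y z)) + 0)) +
        ((D.act w (D.l x y z) - D.act (D.br (D.br x y) z) 0) + 0), D.br (D.br (D.br w x) y) z)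
    refine Prod.ext ?_ rfl
    simp only [map_zero]
    linear_combination (norm := abel) h
  d_eq_zero := LinearMap.ext fun v => v.2

/-- The arrow parts of `toSkeletal`. -/
def kerEquiv : D.toSkeletal.Ker ≃ₗ[K] D.V where
  toFun a := Prod.fst (α := D.V) (β := D.g) a.1
  map_add' _ _ := rfl
  map_smul' _ _ := rfl
  invFun v := ⟨((v, 0) : D.V × D.g), rfl⟩
  left_inv a := Subtype.ext (Prod.ext rfl (a.2 : Prod.snd (α := D.V) (β := D.g) a.1 = 0).symm)
  right_inv _ := rfl

theorem kerEquiv_act (x : D.g) (a : D.toSkeletal.Ker) :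
    D.kerEquiv (D.toSkeletal.act x a) = D.act x (D.kerEquiv a) := by
  change D.act x (D.kerEquiv a) - D.act (Prod.snd (α := D.V) (β := D.g) a.1) 0 = _
  rw [map_zero, sub_zero]

theorem kerEquiv_l₃ (x y z : D.g) : D.kerEquiv (D.toSkeletal.toSemistrictLie2.l₃ x y z) =
    D.l x y z := by
  exact sub_zero (D.l x y z)

end Data

/-- The data given by a Lie algebra, a module and a 3-cocycle. -/
def Data.ofCocycle {g : Type u} [LieRing g] [LieAlgebra K g] {V : Type u} [AddCommGroup V]
    [Module K V] [LieRingModule g V] [LieModule K g V] (w : Z3 K g V) : Data K :=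
  have sl : ∀ x y z, w.1 x y z = - w.1 y x z := fun x y z => by
    have h := w.2.1 (x + y) z
    simp only [map_add, LinearMap.add_apply, w.2.1, zero_add, add_zero] at h
    exact eq_neg_of_add_eq_zero_right h
  have sr : ∀ x y z, w.1 x y z = - w.1 x z y := fun x y z => by
    have h := w.2.2.1 x (y + z)
    simp only [map_add, LinearMap.add_apply, w.2.2.1, zero_add, add_zero] at h
    exact eq_neg_of_add_eq_zero_right h
  { g := g
    V := V
    br := (LieModule.toEnd K g g : g →ₗ[K] Module.End K g)
    act := (LieModule.toEnd K g V : g →ₗ[K] Module.End K V)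
    l := w.1
    br_self := fun x => lie_self x
    br_br := fun x y z => by
      change ⁅⁅x, y⁆, z⁆ = ⁅x, ⁅y, z⁆⁆ + ⁅⁅x, z⁆, y⁆
      rw [lie_lie, ← lie_skew ⁅x, z⁆ y, sub_eq_add_neg]
    act_act := fun x y v => by
      change ⁅x, ⁅y, v⁆⁆ = ⁅y, ⁅x, v⁆⁆ + ⁅⁅x, y⁆, v⁆
      rw [leibniz_lie, add_comm]
    l_self_left := w.2.1
    l_self_right := w.2.2.1
    l_jacobiator := fun a b c d => by
      have h := w.2.2.2 a b c d
      change w.1 ⁅a, b⁆ c d - ⁅c, w.1 a b d⁆ + w.1 a ⁅b, d⁆ c + w.1 ⁅a, d⁆ b c + w.1 a b ⁅c, d⁆ =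
        - ⁅d, w.1 a b c⁆ + w.1 ⁅a, c⁆ b d + w.1 a ⁅b, c⁆ d - ⁅b, w.1 a c d⁆ + ⁅a, w.1 b c d⁆
      rw [sl a ⁅b, d⁆, sl a ⁅b, c⁆, sr a b ⁅c, d⁆, sl a ⁅c, d⁆]
      linear_combination (norm := abel) - h }

/-- A representing cocycle serves as `l₃`: the Jacobiator identity is the cocycle condition. The
cocycles agree on the nose, so the zero cochain compares the classes. -/
theorem exists_triplet_isomorphic (T : Triplet K) :
    ∃ S : SkeletalLie2 K, Triplet.Isomorphic S.triplet T := by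
  obtain ⟨g, V, c⟩ := T
  induction c using Submodule.Quotient.induction_on with | _ w
  let D := Data.ofCocycle w
  let S := D.toSkeletal
  let e : S.Obj ≃ₗ⁅K⁆ g :=
    { toFun := fun x => x
      map_add' := fun _ _ => rfl
      map_smul' := fun _ _ => rfl
      map_lie' := rfl
      invFun := fun x => x
      left_inv := fun _ => rfl
      right_inv := fun _ => rfl }
  let f : S.Ker ≃ₗ[K] V := D.kerEquiv
  have hf : ∀ (x : S.Obj) (v : S.Ker), f ⁅x, v⁆ = ⁅e x, f v⁆ := fun x v => D.kerEquiv_act x v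
  refine ⟨S, ⟨e, f, hf, ?_⟩⟩
  refine (H3.transport_mk_eq_mk_iff e f hf S.cocycle w).2 ?_
  refine ⟨0, fun _ => rfl, fun x y z => ?_⟩
  simp only [LinearMap.zero_apply, lie_zero, sub_zero, add_zero]
  exact D.kerEquiv_l₃ x y z

theorem exists_bijective_quot : ∃ b : Quot (Equivalent (K := K)) →
      Quot (Triplet.Isomorphic (K := K)),
    Function.Bijective b ∧ ∀ S, b (Quot.mk _ S) = Quot.mk _ S.triplet := by
  refine ⟨Quot.map triplet fun S T h => (equivalent_iff_isomorphic S T).1 h, ⟨?_, ?_⟩,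
    fun _ => rfl⟩
  · rintro ⟨S⟩ ⟨T⟩ h
    exact Quot.sound ((equivalent_iff_isomorphic S T).2 (Triplet.mk_eq_mk_iff.1 h))
  · rintro ⟨T⟩
    obtain ⟨S, h⟩ := exists_triplet_isomorphic T
    exact ⟨Quot.mk _ S, Quot.sound h⟩

end SkeletalLie2

end Lie2

namespace Lie2

open LieModule.Cohomology CategoryTheory

/-! ### Skeletal models -/

namespace SemistrictLie2

variable {K : Type u} [Field K] (L : SemistrictLie2 K)

theorem l₃_cycle (x y z : L.Obj) : L.l₃ x y z = L.l₃ z x y := by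
  rw [L.l₃_swap_right, L.l₃_swap_left, neg_neg]

/-- A linear section of `L₀ → coker d` together with a linear lift of the boundaries. -/
structure ModelData where
  σ : L.Coker →ₗ[K] L.Obj
  mk_σ : ∀ c, Submodule.Quotient.mk (σ c) = c
  τ : L.Obj →ₗ[K] L.Ker
  d_τ : ∀ a, L.d (τ (L.d a)) = L.d a

/-- The lift `τ` is a linear section of `d` over its image, extended arbitrarily to all objects. -/
theorem exists_modelData (σ : L.Coker →ₗ[K] L.Obj) (hσ : ∀ c, Submodule.Quotient.mk (σ c) = c) :
    ∃ D : L.ModelData, D.σ = σ := by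
  obtain ⟨τ, hτ⟩ := LinearMap.exists_rightInverse_of_surjective L.d.rangeRestrict
    L.d.range_rangeRestrict
  obtain ⟨θ, hθ⟩ := LinearMap.exists_extend τ
  refine ⟨⟨σ, hσ, θ, fun a => ?_⟩, rfl⟩
  have h₁ : θ (L.d a) = τ (L.d.rangeRestrict a) := LinearMap.congr_fun hθ (L.d.rangeRestrict a)
  rw [h₁]
  exact congrArg Subtype.val (LinearMap.congr_fun hτ (L.d.rangeRestrict a))

namespace ModelData

variable {L} (D : L.ModelData)

/-- The bracket on the cokernel. -/
def br : L.Coker →ₗ[K] L.Coker →ₗ[K] L.Coker :=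
  (L.br₀.compl₁₂ D.σ D.σ).compr₂ (Submodule.mkQ _)

/-- The defect of `σ` to be a homomorphism, lifted along `d`. -/
def B : L.Coker →ₗ[K] L.Coker →ₗ[K] L.Ker :=
  (D.br.compr₂ D.σ - L.br₀.compl₁₂ D.σ D.σ).compr₂ D.τ

theorem mk_eq_zero_iff (x : L.Obj) :
    (Submodule.Quotient.mk x : L.Coker) = 0 ↔ ∃ a, L.d a = x := by
  rw [Submodule.Quotient.mk_eq_zero]
  rfl

theorem exists_d_eq (x : L.Obj) : ∃ a, L.d a = x - D.σ (Submodule.Quotient.mk x) := by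
  rw [← mk_eq_zero_iff, Submodule.Quotient.mk_sub, D.mk_σ, sub_self]

/-- The defect of `σ` dies in the cokernel, so it is a boundary, and on boundaries `τ` is a true
lift. -/
theorem d_B (x y : L.Coker) : L.d (D.B x y) = D.σ (D.br x y) - L.br₀ (D.σ x) (D.σ y) := by
  change L.d (D.τ (D.σ (D.br x y) - L.br₀ (D.σ x) (D.σ y))) = _
  obtain ⟨a, ha⟩ := (mk_eq_zero_iff (D.σ (D.br x y) - L.br₀ (D.σ x) (D.σ y))).1 (by
    rw [Submodule.Quotient.mk_sub, D.mk_σ]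
    exact sub_self _)
  rw [← ha, D.d_τ]

theorem br_self (x : L.Coker) : D.br x x = 0 := by
  change Submodule.Quotient.mk (L.br₀ _ _) = _
  rw [L.br₀_self]
  rfl

theorem br_skew (x y : L.Coker) : D.br x y = - D.br y x := by
  change Submodule.Quotient.mk (L.br₀ _ _) = - Submodule.Quotient.mk (L.br₀ _ _)
  rw [L.br₀_skew]
  rfl

theorem B_self (x : L.Coker) : D.B x x = 0 := by
  change D.τ (D.σ (D.br x x) - L.br₀ (D.σ x) (D.σ x)) = _
  rw [D.br_self, L.br₀_self, map_zero, sub_zero, map_zero]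

theorem B_skew (x y : L.Coker) : D.B x y = - D.B y x := by
  have h := D.B_self (x + y)
  simp only [map_add, LinearMap.add_apply, D.B_self, zero_add, add_zero] at h
  exact eq_neg_of_add_eq_zero_right h

/-- An object differs from the chosen representative of its class by a boundary, and the bracket
with a boundary is a boundary. Arbitrary representatives are needed for iterated brackets, since `[σ
x, σ y]` need not be a value of `σ`. -/
theorem br_mk (x : L.Obj) (y : L.Coker) :
    D.br (Submodule.Quotient.mk x) y = Submodule.Quotient.mk (L.br₀ x (D.σ y)) := by
  change (Submodule.Quotient.mk (L.br₀ _ _) : L.Coker) = _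
  obtain ⟨a, ha⟩ := D.exists_d_eq x
  rw [eq_comm, ← sub_eq_zero, ← Submodule.Quotient.mk_sub, mk_eq_zero_iff]
  refine ⟨- L.act (D.σ y) a, ?_⟩
  rw [map_neg, L.d_act, ha, map_sub, L.br₀_skew _ x, L.br₀_skew (D.σ y)]
  abel

/-- In `L` the Jacobi identity fails by the boundary of `l₃`, so it holds in the cokernel. -/
theorem br_br (x y z : L.Coker) :
    D.br (D.br x y) z = D.br x (D.br y z) + D.br (D.br x z) y := by
  rw [D.br_skew x (D.br y z)]
  change D.br (Submodule.Quotient.mk (L.br₀ (D.σ x) (D.σ y))) z =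
    - D.br (Submodule.Quotient.mk (L.br₀ (D.σ y) (D.σ z))) x +
      D.br (Submodule.Quotient.mk (L.br₀ (D.σ x) (D.σ z))) y
  rw [br_mk, br_mk, br_mk, eq_comm, ← sub_eq_zero, ← Submodule.Quotient.mk_neg,
    ← Submodule.Quotient.mk_add, ← Submodule.Quotient.mk_sub, mk_eq_zero_iff]
  refine ⟨L.l₃ (D.σ x) (D.σ y) (D.σ z), ?_⟩
  rw [L.d_l₃, L.br₀_skew (D.σ x) (L.br₀ _ _)]

/-- The action of the cokernel on the kernel. -/
def act : L.Coker →ₗ[K] LinearMap.ker L.d →ₗ[K] LinearMap.ker L.d where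
  toFun x := (L.act (D.σ x)).restrict (by
    intro a ha
    rw [LinearMap.mem_ker] at ha ⊢
    rw [L.d_act, ha, map_zero])
  map_add' x y := by ext a; simp
  map_smul' r x := by ext a; simp

theorem coe_act (x : L.Coker) (v : LinearMap.ker L.d) :
    (D.act x v : L.Ker) = L.act (D.σ x) v := rfl

/-- `σ [x, y]` and `[σ x, σ y]` differ by the boundary of `B x y`, and `act_d` exchanges the roles
of `a` and `B x y`. The correction disappears when `d a = 0`, which makes the action on `ker d` a
representation. -/
theorem act_br (x y : L.Coker) (a : L.Ker) :
    L.act (L.br₀ (D.σ x) (D.σ y)) a = L.act (D.σ (D.br x y)) a + L.act (L.d a) (D.B x y) := by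
  have h := L.act_d (D.B x y) a
  rw [D.d_B, map_sub, LinearMap.sub_apply] at h
  linear_combination (norm := abel) - h

theorem act_act (x y : L.Coker) (v : LinearMap.ker L.d) :
    D.act x (D.act y v) = D.act y (D.act x v) + D.act (D.br x y) v := by
  apply Subtype.ext
  have h := L.act_act (D.σ x) (D.σ y) v
  rw [D.act_br, LinearMap.mem_ker.1 v.2] at h
  simpa [coe_act] using h

/-- The formal differential of `B`, corrected by the Jacobiator of `L`. -/
def formal (x y z : L.Coker) : L.Ker :=
  L.l₃ (D.σ x) (D.σ y) (D.σ z) + L.act (D.σ x) (D.B y z) - L.act (D.σ y) (D.B x z)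
    + L.act (D.σ z) (D.B x y) - D.B (D.br x y) z + D.B (D.br x z) y - D.B (D.br y z) x

/-- The boundary of `l₃` is the Jacobi defect of the representatives. The boundaries of the `B`
terms replace brackets of representatives by representatives of brackets, and what is left is `σ` of
the Jacobi identity of the cokernel. -/
theorem d_formal (x y z : L.Coker) : L.d (D.formal x y z) = 0 := by
  have h := congrArg D.σ (D.br_br x y z)
  rw [D.br_skew x (D.br y z), map_add, map_neg] at h
  simp only [formal, map_add, map_sub, L.d_l₃, L.d_act, D.d_B, h]
  rw [L.br₀_skew (D.σ z) (D.σ (D.br x y)), L.br₀_skew (D.σ y) (D.σ (D.br x z)),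
    L.br₀_skew (D.σ x) (D.σ (D.br y z)), L.br₀_skew (D.σ z) (L.br₀ _ _),
    L.br₀_skew (D.σ y) (L.br₀ _ _)]
  abel

/-- `formal` as a trilinear map to the kernel. -/
def l : L.Coker →ₗ[K] L.Coker →ₗ[K] L.Coker →ₗ[K] LinearMap.ker L.d where
  toFun x := LinearMap.mk₂ K (fun y z => ⟨D.formal x y z, D.d_formal x y z⟩)
    (by intros; apply Subtype.ext; simp [formal]; abel)
    (by intros; apply Subtype.ext; simp [formal]; module)
    (by intros; apply Subtype.ext; simp [formal]; abel)
    (by intros; apply Subtype.ext; simp [formal]; module)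
  map_add' _ _ := by ext; simp [formal]; abel
  map_smul' _ _ := by ext; simp [formal]; module

theorem coe_l (x y z : L.Coker) : (D.l x y z : L.Ker) = D.formal x y z := rfl

/-- Leibniz holds up to `l₃` of the boundary of `B r s`. This correction exchanges `[σ r, σ s]` for
`σ [r, s]` in the Jacobiator identity of `L`. -/
theorem act_act_B (p q r s : L.Coker) :
    L.act (D.σ p) (L.act (D.σ q) (D.B r s)) = L.act (D.σ q) (L.act (D.σ p) (D.B r s))
      + L.act (L.br₀ (D.σ p) (D.σ q)) (D.B r s)
      + (L.l₃ (D.σ (D.br r s)) (D.σ p) (D.σ q) - L.l₃ (L.br₀ (D.σ r) (D.σ s)) (D.σ p) (D.σ q)) := by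
  rw [L.act_act, D.d_B, map_sub, L.l₃_cycle _ _ (D.σ (D.br r s)), L.l₃_cycle _ _ (L.br₀ _ _)]

/-- `act_d` for two values of `B`; it cancels the terms quadratic in `B`. -/
theorem B_B (p q r s : L.Coker) :
    L.act (D.σ (D.br p q)) (D.B r s) - L.act (L.br₀ (D.σ p) (D.σ q)) (D.B r s) =
      L.act (L.br₀ (D.σ r) (D.σ s)) (D.B p q) - L.act (D.σ (D.br r s)) (D.B p q) := by
  have h := L.act_d (D.B p q) (D.B r s)
  simp only [D.d_B, map_sub, LinearMap.sub_apply] at h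
  rw [h]
  abel

-- The identity is that of `L` at the four representatives, corrected by `act_act_B` for each of the
-- six pairs among `w, x, y, z` and by `B_B` for each of the three splittings into two pairs. The
-- Jacobi identity inside the argument of `B` disposes of the rest.
set_option maxHeartbeats 1000000 in
theorem l_jacobiator (w x y z : L.Coker) :
    D.l (D.br w x) y z - D.act y (D.l w x z) + D.l w (D.br x z) y + D.l (D.br w z) x y
        + D.l w x (D.br y z) =
      - D.act z (D.l w x y) + D.l (D.br w y) x z + D.l w (D.br x y) z
        - D.act x (D.l w y z) + D.act w (D.l x y z) := by
  apply Subtype.ext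
  simp only [AddSubgroupClass.coe_sub, Submodule.coe_add, Submodule.coe_neg, D.coe_act, D.coe_l]
  have J := L.l₃_jacobiator (D.σ w) (D.σ x) (D.σ y) (D.σ z)
  have A₁ := D.act_act_B w x y z
  have A₂ := D.act_act_B w y x z
  have A₃ := D.act_act_B w z x y
  have A₄ := D.act_act_B x y w z
  have A₅ := D.act_act_B x z w y
  have A₆ := D.act_act_B y z w x
  have D₁ := D.B_B w x y z
  have D₂ := D.B_B w y x z
  have D₃ := D.B_B w z x y
  have hB : ∀ p q r s, D.B (D.br (D.br p q) r) s =
      - D.B (D.br (D.br q r) p) s + D.B (D.br (D.br p r) q) s := fun p q r s => by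
    rw [D.br_br p q r, D.br_skew p, map_add, map_neg, LinearMap.add_apply, LinearMap.neg_apply]
  have hl : ∀ p q r : L.Obj, L.l₃ p q r = - L.l₃ q p r := L.l₃_swap_left
  simp only [formal, map_add, map_sub]
  rw [hl (D.σ w) (L.br₀ _ _), hl (D.σ w) (L.br₀ _ _), L.l₃_cycle (D.σ w) (D.σ x) (L.br₀ _ _)] at J
  rw [hl (D.σ w) (D.σ (D.br x z)), hl (D.σ w) (D.σ (D.br x y)),
    L.l₃_cycle (D.σ w) (D.σ x) (D.σ (D.br y z)),
    D.br_skew w (D.br x z), D.br_skew w (D.br y z), D.br_skew w (D.br x y),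
    D.br_skew x (D.br y z), D.B_skew w (D.br x z), D.B_skew w (D.br x y), D.B_skew w (D.br y z),
    D.B_skew x (D.br y z), D.B_skew (D.br w x) (D.br y z), D.B_skew (D.br w y) (D.br x z),
    D.B_skew (D.br w z) (D.br x y)]
  simp only [map_neg, LinearMap.neg_apply, neg_neg]
  rw [hB w x y z, hB w x z y, hB w y z x, hB x y z w]
  linear_combination (norm := abel) J - A₁ + A₂ - A₃ - A₄ + A₅ - A₆ + D₁ - D₂ + D₃

/-- The skeletal Lie 2-algebra on the cokernel and the kernel of the differential. -/
def data : SkeletalLie2.Data K where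
  g := L.Coker
  V := LinearMap.ker L.d
  br := D.br
  act := D.act
  l := D.l
  br_self := D.br_self
  br_br := D.br_br
  act_act := D.act_act
  l_self_left x z := by
    apply Subtype.ext
    change D.formal x x z = 0
    rw [formal, D.br_self, D.B_self, L.l₃_self_left]
    simp
  l_self_right x y := by
    apply Subtype.ext
    change D.formal x y y = 0
    rw [formal, D.br_self, D.B_self, L.l₃_self_right]
    simp
  l_jacobiator := D.l_jacobiator

/-- The arrow parts of the skeletal model. -/
def kerEquiv : D.data.toSkeletal.Ker ≃ₗ[K] LinearMap.ker L.d := D.data.kerEquiv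

theorem data_d (a : D.data.toSkeletal.Ker) : D.data.toSkeletal.d a = 0 := by
  rw [D.data.toSkeletal.d_eq_zero]
  rfl

/-- The homomorphism from the skeletal model. -/
def hom : Hom D.data.toSkeletal.toSemistrictLie2 L :=
  Hom.ofParts (L := D.data.toSkeletal.toSemistrictLie2) D.σ
    ((LinearMap.ker L.d).subtype ∘ₗ (D.kerEquiv : D.data.toSkeletal.Ker →ₗ[K] LinearMap.ker L.d))
    D.B D.B_self
    (fun a => (D.kerEquiv a).2.trans ((congrArg D.σ (D.data_d a)).trans (map_zero D.σ)).symm)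
    (fun x y => D.d_B x y)
    (fun x a => (congrArg Subtype.val (D.data.kerEquiv_act x a)).trans
      ((add_zero _).symm.trans (congrArg (L.act (D.σ x) (D.kerEquiv a : LinearMap.ker L.d).1 + ·)
        ((congrArg (D.B x) (D.data_d a)).trans (map_zero (D.B x))).symm)))
    (fun x y z => congrArg Subtype.val (D.data.kerEquiv_l₃ x y z))

theorem hom_k₁ (a : D.data.toSkeletal.Ker) : D.hom.k₁ a = (D.kerEquiv a).1 :=
  Hom.ofParts_k₁ (L := D.data.toSkeletal.toSemistrictLie2) D.σ
    ((LinearMap.ker L.d).subtype ∘ₗ (D.kerEquiv : D.data.toSkeletal.Ker →ₗ[K] LinearMap.ker L.d))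
    D.B _ _ _ _ _ a

/-- An element with boundary `σ x` forces `x = 0`, because `σ` is a section, and so lies in `ker d`.
Conversely every object is a value of `σ` plus a boundary. -/
theorem hom_isEquivalence : D.hom.IsEquivalence := by
  refine .of_fullyFaithful ?_ ?_
  · intro b (x : L.Coker) (h : L.d b = D.σ x)
    have hx : x = 0 := by
      rw [← D.mk_σ x, mk_eq_zero_iff]
      exact ⟨b, h⟩
    subst hx
    rw [map_zero] at h
    refine ⟨D.kerEquiv.symm ⟨b, h⟩, ⟨D.data_d _, ?_⟩, fun a ha => ?_⟩
    · rw [hom_k₁, LinearEquiv.apply_symm_apply]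
    · rw [LinearEquiv.eq_symm_apply]
      apply Subtype.ext
      rw [← hom_k₁, ha.2]
  · intro y
    obtain ⟨a, ha⟩ := D.exists_d_eq y
    refine ⟨(Submodule.Quotient.mk y : L.Coker), a, ?_⟩
    rw [ha]
    exact add_sub_cancel _ _

end ModelData

theorem exists_skeletal_model (σ : L.Coker →ₗ[K] L.Obj)
    (hσ : ∀ c, Submodule.Quotient.mk (σ c) = c) :
    ∃ (S : SkeletalLie2 K) (φ : Hom S.toSemistrictLie2 L)
      (e : S.Obj ≃ₗ[K] L.Coker) (f : S.Ker ≃ₗ[K] LinearMap.ker L.d),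
      φ.IsEquivalence ∧ (∀ x, φ.f₀ x = σ (e x)) ∧
        ∀ v : S.Ker, φ.f₁ v = ((f v : L.Ker) : L.Arr) := by
  obtain ⟨D, rfl⟩ := L.exists_modelData σ hσ
  exact ⟨D.data.toSkeletal, D.hom, LinearEquiv.refl K L.Coker, D.kerEquiv, D.hom_isEquivalence,
    fun _ => rfl, fun v => congrArg Subtype.val (D.hom_k₁ v)⟩

theorem exists_skeletal_equivalence : ∃ (S : SkeletalLie2 K) (φ : Hom S.toSemistrictLie2 L),
    φ.IsEquivalence := by
  obtain ⟨σ, hσ⟩ := LinearMap.exists_rightInverse_of_surjective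
    (LinearMap.range L.d).mkQ (Submodule.range_mkQ _)
  obtain ⟨S, φ, -, -, h, -⟩ := L.exists_skeletal_model σ (fun c => LinearMap.congr_fun hσ c)
  exact ⟨S, φ, h⟩

end SemistrictLie2
end Lie2

namespace Lie2

open LieModule.Cohomology CategoryTheory

/-! ### The class of a crossed module -/

namespace CrossedModule

variable {K : Type u} [Field K]

theorem toCoker_eq_zero_iff (X : CrossedModule K) (x : X.g) :
    X.toCoker x = 0 ↔ ∃ a, X.μ a = x := LieSubmodule.Quotient.mk_eq_zero'

theorem exists_lift (X : CrossedModule K) :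
    ∃ τ : X.g →ₗ[K] X.h, ∀ x, X.toCoker x = 0 → X.μ (τ x) = x := by
  obtain ⟨τ, hτ⟩ := LinearMap.exists_rightInverse_of_surjective
    (X.μ : X.h →ₗ[K] X.g).rangeRestrict (LinearMap.range_rangeRestrict _)
  obtain ⟨θ, hθ⟩ := LinearMap.exists_extend τ
  refine ⟨θ, fun x hx => ?_⟩
  have hx' : x ∈ LinearMap.range (X.μ : X.h →ₗ[K] X.g) := (X.toCoker_eq_zero_iff x).1 hx
  have h₁ : θ x = τ ⟨x, hx'⟩ := LinearMap.congr_fun hθ ⟨x, hx'⟩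
  rw [h₁]
  exact congrArg Subtype.val (LinearMap.congr_fun hτ ⟨x, hx'⟩)

variable {X Y : CrossedModule K}

/-- The map induced on cokernels. -/
def cokerMap (F : X ⟶ Y) : X.Coker →ₗ⁅K⁆ Y.Coker where
  toLinearMap := Submodule.mapQ _ _ (Hom.ψ F : X.g →ₗ[K] Y.g) (by
    rintro _ ⟨a, rfl⟩
    exact ⟨Hom.φ F a, (Hom.comm F a).symm⟩)
  map_lie' {c d} := by
    induction c using Submodule.Quotient.induction_on with | _ x
    induction d using Submodule.Quotient.induction_on with | _ y
    exact congrArg Y.toCoker (LieHom.map_lie (Hom.ψ F) x y)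

/-- The map induced on kernels. -/
def kerMap (F : X ⟶ Y) : X.Ker →ₗ[K] Y.Ker :=
  (Hom.φ F : X.h →ₗ[K] Y.h).restrict (by
    intro a ha
    change X.μ a = 0 at ha
    change Y.μ (Hom.φ F a) = 0
    rw [← Hom.comm, ha, map_zero])

@[simp] theorem coe_kerMap (F : X ⟶ Y) (v : X.Ker) : (kerMap F v : Y.h) = Hom.φ F v := rfl

theorem Hom.Induces.eq_cokerMap {F : X ⟶ Y} {e : X.Coker → Y.Coker} {f : X.Ker → Y.Ker}
    (h : Hom.Induces F e f) : e = cokerMap F := by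
  funext c
  induction c using Submodule.Quotient.induction_on with | _ x
  exact h.1 x

theorem Hom.Induces.eq_kerMap {F : X ⟶ Y} {e : X.Coker → Y.Coker} {f : X.Ker → Y.Ker}
    (h : Hom.Induces F e f) : f = kerMap F := funext fun v => Subtype.ext (h.2 v)

theorem induces (F : X ⟶ Y) : Hom.Induces F (cokerMap F) (kerMap F) :=
  ⟨fun _ => rfl, fun _ => rfl⟩

theorem elementaryEquiv_iff : ElementaryEquiv X Y ↔ ∃ F : X ⟶ Y,
    Function.Bijective (cokerMap F) ∧ Function.Bijective (kerMap F) := by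
  constructor
  · rintro ⟨F, e, f, h, he, hf⟩
    rw [h.eq_cokerMap] at he
    rw [h.eq_kerMap] at hf
    exact ⟨F, he, hf⟩
  · rintro ⟨F, he, hf⟩
    exact ⟨F, _, _, induces F, he, hf⟩

theorem kerMap_lie (F : X ⟶ Y) (c : X.Coker) (v : X.Ker) :
    kerMap F ⁅c, v⁆ = ⁅cokerMap F c, kerMap F v⁆ := by
  induction c using Submodule.Quotient.induction_on with | _ x
  exact Subtype.ext (Hom.map_act F x v)

theorem act_lie_apply (x : X.g) (a b : X.h) :
    X.act x ⁅a, b⁆ = ⁅a, X.act x b⁆ - ⁅b, X.act x a⁆ := (X.act x).leibniz' a b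

/-- Change of section data along a morphism of crossed modules. -/
theorem exists_cochain (F : X ⟶ Y) (D : X.SectionData) (D' : Y.SectionData) :
    ∃ b : X.Coker →ₗ[K] X.Coker →ₗ[K] Y.Ker, (∀ x, b x x = 0) ∧ ∀ x y z,
      kerMap F (D.cocycle.1 x y z) = D'.cocycle.1 (cokerMap F x) (cokerMap F y) (cokerMap F z)
        + ⁅cokerMap F x, b y z⁆ - ⁅cokerMap F y, b x z⁆ + ⁅cokerMap F z, b x y⁆
        - b ⁅x, y⁆ z + b ⁅x, z⁆ y - b ⁅y, z⁆ x := by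
  obtain ⟨τ, hτ⟩ := Y.exists_lift
  let e : X.Coker →ₗ[K] Y.Coker := cokerMap F
  let R : X.Coker →ₗ[K] Y.g := (Hom.ψ F : X.g →ₗ[K] Y.g) ∘ₗ D.ρ
  -- `D'.ρ ∘ e` and `R` lift the same map to `Y.Coker`, so their difference is a boundary; `κ` is a
  -- linear lift of it.
  let κ : X.Coker →ₗ[K] Y.h := τ ∘ₗ (D'.ρ ∘ₗ e - R)
  have hκ : ∀ x, Y.μ (κ x) = D'.ρ (e x) - R x := fun x => by
    refine hτ _ ?_
    change Y.toCoker (D'.ρ (e x)) - cokerMap F (X.toCoker (D.ρ x)) = 0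
    rw [D'.toCoker_ρ, D.toCoker_ρ]
    exact sub_self _
  have hRb : ∀ x y, Y.μ (Hom.φ F (D.b x y)) = R ⁅x, y⁆ - ⁅R x, R y⁆ := fun x y => by
    rw [← Hom.comm, D.μ_b, map_sub, LieHom.map_lie]
    rfl
  -- The lift of the defect transformed under the change of section from `R` to `R + μ κ`. It has
  -- the same boundary as `D'.b (e x) (e y)`, and the difference is the required 2-cochain in `ker
  -- μ`.
  let b₀ : X.Coker → X.Coker → Y.h := fun x y => Hom.φ F (D.b x y) + κ ⁅x, y⁆
    - Y.act (R x) (κ y) + Y.act (R y) (κ x) - ⁅κ x, κ y⁆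
  have he : ∀ x y, e ⁅x, y⁆ = ⁅e x, e y⁆ := fun x y => LieHom.map_lie (cokerMap F) x y
  have hb₀ : ∀ x y, Y.μ (b₀ x y - D'.b (e x) (e y)) = 0 := fun x y => by
    simp only [b₀, map_sub, map_add, hRb, hκ, Y.μ_act, LieHom.map_lie, D'.μ_b, lie_sub, sub_lie,
      he]
    rw [← lie_skew (R y) (R x), ← lie_skew (R y) (D'.ρ (e x))]
    abel
  let b : X.Coker →ₗ[K] X.Coker →ₗ[K] Y.Ker :=
    LinearMap.mk₂ K (fun x y => ⟨b₀ x y - D'.b (e x) (e y), hb₀ x y⟩)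
      (by intros; apply Subtype.ext; simp [b₀]; abel)
      (by intros; apply Subtype.ext; simp [b₀]; module)
      (by intros; apply Subtype.ext; simp [b₀]; abel)
      (by intros; apply Subtype.ext; simp [b₀]; module)
  have hb : ∀ x y, (b x y : Y.h) = b₀ x y - D'.b (e x) (e y) := fun _ _ => rfl
  refine ⟨b, fun x => Subtype.ext ?_, fun x y z => Subtype.ext ?_⟩
  · rw [hb]
    simp [b₀]
  have hρ : ∀ x a, Y.act (D'.ρ (e x)) a = Y.act (R x) a + ⁅κ x, a⁆ := fun x a => by
    rw [← Y.act_μ, hκ, map_sub, LieDerivation.sub_apply]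
    abel
  -- `R` is a homomorphism up to the boundary of `φ (b x y)`, and boundaries act by inner
  -- derivations.
  have hRR : ∀ x y a, Y.act (R x) (Y.act (R y) a) = Y.act (R y) (Y.act (R x) a)
      + Y.act (R ⁅x, y⁆) a + ⁅a, Hom.φ F (D.b x y)⁆ := fun x y a => by
    rw [← lie_skew a (Hom.φ F (D.b x y)), ← Y.act_μ (Hom.φ F (D.b x y)), hRb, map_sub,
      LieDerivation.sub_apply, Y.act_lie]
    abel
  have hF : ∀ x a, Hom.φ F (X.act (D.ρ x) a) = Y.act (R x) (Hom.φ F a) :=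
    fun x a => Hom.map_act F (D.ρ x) a
  have hjac : κ ⁅⁅x, y⁆, z⁆ = κ ⁅⁅x, z⁆, y⁆ - κ ⁅⁅y, z⁆, x⁆ := by
    rw [← map_sub]
    congr 1
    rw [lie_lie, ← lie_skew ⁅x, z⁆ y, ← lie_skew ⁅y, z⁆ x]
    abel
  have hJ : ⁅κ x, ⁅κ y, κ z⁆⁆ = ⁅κ y, ⁅κ x, κ z⁆⁆ - ⁅κ z, ⁅κ x, κ y⁆⁆ := by
    rw [leibniz_lie, ← lie_skew ⁅κ x, κ y⁆]
    abel
  simp only [AddSubgroupClass.coe_sub, Submodule.coe_add, coe_kerMap, D'.coe_lie, hb]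
  change Hom.φ F (D.formalD x y z) = D'.formalD (e x) (e y) (e z)
    + Y.act (D'.ρ (e x)) _ - Y.act (D'.ρ (e y)) _ + Y.act (D'.ρ (e z)) _ - _ + _ - _
  simp only [SectionData.formalD, he, map_add, map_sub, hF, hρ]
  simp only [b₀, map_add, map_sub, act_lie_apply, lie_add, lie_sub, hρ]
  rw [hRR x y, hRR x z, hRR y z, hjac, hJ, ← lie_skew (κ x) (κ ⁅y, z⁆),
    ← lie_skew (κ y) (κ ⁅x, z⁆), ← lie_skew (κ z) (κ ⁅x, y⁆)]
  abel

theorem transport_mk_cocycle (F : X ⟶ Y) (e : X.Coker ≃ₗ⁅K⁆ Y.Coker) (f : X.Ker ≃ₗ[K] Y.Ker)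
    (hf : ∀ x v, f ⁅x, v⁆ = ⁅e x, f v⁆) (he : ∀ x, e x = cokerMap F x)
    (hf' : ∀ v, f v = kerMap F v) (D : X.SectionData) (D' : Y.SectionData) :
    H3.transport e f hf (Submodule.Quotient.mk D.cocycle) =
      Submodule.Quotient.mk D'.cocycle := by
  rw [H3.transport_mk_eq_mk_iff]
  simp only [he, hf']
  exact exists_cochain F D D'

/-- Naturality of the class, applied to the identity morphism with different choices of sections at
its two ends. -/
theorem mk_cocycle_eq (D D' : X.SectionData) :
    (Submodule.Quotient.mk D.cocycle : H3 K X.Coker X.Ker) =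
      Submodule.Quotient.mk D'.cocycle := by
  rw [← transport_mk_cocycle (𝟙 X) LieEquiv.refl (LinearEquiv.refl K X.Ker) (fun _ _ => rfl)
    (fun x => ?_) (fun _ => rfl) D D']
  · exact (H3.transport_eq_self _ _ _ (fun _ => rfl) (fun _ => rfl) _).symm
  · induction x using Submodule.Quotient.induction_on with | _ x
    rfl

theorem mk_cocycle_eq_cls (D : X.SectionData) :
    (Submodule.Quotient.mk D.cocycle : H3 K X.Coker X.Ker) = X.triplet.cls :=
  mk_cocycle_eq _ _

/-- A morphism which is bijective on kernels and cokernels induces an isomorphism of triplets. -/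
noncomputable def tripletIso (F : X ⟶ Y) (he : Function.Bijective (cokerMap F))
    (hf : Function.Bijective (kerMap F)) : Triplet.Iso X.triplet Y.triplet where
  e := LieEquiv.ofBijective (cokerMap F) he
  f := LinearEquiv.ofBijective (kerMap F) hf
  equivariant := kerMap_lie F
  map_cls := transport_mk_cocycle F (LieEquiv.ofBijective (cokerMap F) he)
    (LinearEquiv.ofBijective (kerMap F) hf) (kerMap_lie F) (fun _ => rfl) (fun _ => rfl) _ _

theorem ElementaryEquiv.isomorphic (h : ElementaryEquiv X Y) :
    Triplet.Isomorphic X.triplet Y.triplet := by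
  obtain ⟨F, he, hf⟩ := elementaryEquiv_iff.1 h
  exact ⟨tripletIso F he hf⟩

end CrossedModule

/-! ### Crossed modules with fixed kernel and cokernel -/

namespace CrossedExtension

variable {K : Type u} [Field K] {g : Type u} [LieRing g] [LieAlgebra K g]
    {V : Type u} [AddCommGroup V] [Module K V] [LieRingModule g V] [LieModule K g V]

theorem ElementaryEquiv.cls_eq {M N : CrossedExtension K g V} (h : ElementaryEquiv M N) :
    M.cls = N.cls := by
  obtain ⟨F, hF⟩ := h
  have h := CrossedModule.transport_mk_cocycle F (M.e.trans N.e.symm) (M.f.trans N.f.symm)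
    (fun x v => by
      change N.f.symm (M.f _) = ⁅N.e.symm (M.e x), N.f.symm (M.f v)⁆
      rw [LinearEquiv.symm_apply_eq, N.equivariant, M.equivariant, N.f.apply_symm_apply,
        N.e.apply_symm_apply])
    (fun x => congrFun hF.eq_cokerMap x) (fun v => congrFun hF.eq_kerMap v)
    (Classical.choice CrossedModule.SectionData.nonempty)
    (Classical.choice CrossedModule.SectionData.nonempty)
  have hs : ∀ x v, N.f.symm ⁅x, v⁆ = ⁅N.e.symm x, N.f.symm v⁆ := fun x v => by
    rw [LinearEquiv.symm_apply_eq, N.equivariant, N.f.apply_symm_apply, N.e.apply_symm_apply]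
  rw [← H3.transport_transport M.e M.f M.equivariant N.e.symm N.f.symm hs] at h
  have h2 := congrArg (H3.transport N.e N.f N.equivariant) h
  rw [H3.transport_transport N.e.symm N.f.symm hs N.e N.f N.equivariant (fun x v => by
    change N.f (N.f.symm _) = ⁅N.e (N.e.symm x), N.f (N.f.symm v)⁆
    rw [N.f.apply_symm_apply, N.e.apply_symm_apply, N.f.apply_symm_apply])] at h2
  rw [H3.transport_eq_self _ _ _ (fun x => N.e.apply_symm_apply x)
    (fun v => N.f.apply_symm_apply v)] at h2
  exact h2

end CrossedExtension

/-! ### Strict Lie 2-algebras and their skeletal models -/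

namespace StrictLie2

variable {K : Type u} [Field K] (G : StrictLie2 K)

/-- The arrow parts of `G` as the domain of the associated crossed module. -/
def kerEquiv : G.toSemistrict.Ker ≃ₗ[K] G.toCrossedModule.h where
  toFun v := (⟨(v.1 : G.Arr), (LieHom.mem_ker (f := G.s)).2 v.2⟩ : G.s.ker)
  map_add' _ _ := rfl
  map_smul' _ _ := rfl
  invFun v := ⟨(v : G.s.ker).1, (LieHom.mem_ker (L := G.Arr) (L' := G.Obj) (f := G.s)).1
    (v : G.s.ker).2⟩
  left_inv _ := rfl
  right_inv _ := rfl

theorem toSemistrict_l₃ (x y z : G.Obj) : G.toSemistrict.l₃ x y z = 0 := by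
  change G.toSemistrict.part (G.toSemistrict.i _) = 0
  exact TwoVect.part_i _ _

/-- Through the induced isomorphism `S₀ ≅ coker μ`, the map `φ₀` becomes a linear section and `k₂` a
lift of its defect, that is, section data for the crossed module. Since `l₃` of `G` vanishes, the
coherence law equates the image of `l₃` of `S` with the cocycle of this data, without a coboundary
correction. -/
theorem exists_iso_of_model (S : SkeletalLie2 K)
    (φ : SemistrictLie2.Hom S.toSemistrictLie2 G.toSemistrict) (hφ : φ.IsEquivalence) :
    ∃ E : Triplet.Iso S.triplet G.toCrossedModule.triplet,
      (∀ x : S.Obj, E.e x = G.toCrossedModule.toCoker (φ.f₀ x)) ∧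
      ∀ v : S.Ker, G.kerToArr (E.f v) = φ.f₁ v := by
  have hS : ∀ a, S.d a = 0 := fun a => by
    rw [S.d_eq_zero]
    rfl
  have ff := hφ.fullyFaithful
  have es := hφ.essSurj
  let X := G.toCrossedModule
  let φ₀ : S.Obj →ₗ[K] X.g := φ.f₀
  let e' : S.Obj →ₗ[K] X.Coker := X.rangeIdeal.toSubmodule.mkQ ∘ₗ φ₀
  have he' : ∀ x, e' x = X.toCoker (φ₀ x) := fun _ => rfl
  have bij : Function.Bijective e' := by
    constructor
    · rw [injective_iff_map_eq_zero]
      intro x hx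
      -- If `φ₀ x` is a boundary, full faithfulness makes `x` a boundary in `S`, where boundaries
      -- vanish.
      obtain ⟨a, ha⟩ := (X.toCoker_eq_zero_iff _).1 hx
      obtain ⟨c, ⟨hc, -⟩, -⟩ := ff (G.kerEquiv.symm a) x ha
      rw [← hc, hS]
    · intro c
      induction c using Submodule.Quotient.induction_on with | _ y
      obtain ⟨x, b, h⟩ := es y
      refine ⟨x, ?_⟩
      rw [he']
      refine (sub_eq_zero.1 ?_).symm
      refine (X.toCoker_eq_zero_iff (y - φ₀ x)).2 ⟨G.kerEquiv b, ?_⟩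
      exact eq_sub_of_add_eq' h
  let e : S.Obj ≃ₗ⁅K⁆ X.Coker :=
    { LinearEquiv.ofBijective e' bij with
      map_lie' := fun {x y} => by
        change X.toCoker (φ₀ (S.br₀ x y)) = X.toCoker ⁅φ₀ x, φ₀ y⁆
        refine sub_eq_zero.1 ((X.toCoker_eq_zero_iff (φ₀ (S.br₀ x y) - ⁅φ₀ x, φ₀ y⁆)).2
          ⟨G.kerEquiv (φ.k₂ x y), φ.d_k₂ x y⟩) }
  have he : ∀ x, e x = X.toCoker (φ₀ x) := fun _ => rfl
  let f' : S.Ker →ₗ[K] X.Ker := LinearMap.codRestrict _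
    ((G.kerEquiv : G.toSemistrict.Ker →ₗ[K] X.h) ∘ₗ φ.k₁) (fun v => by
      change G.toSemistrict.d (φ.k₁ v) = 0
      rw [φ.d_k₁, hS]
      exact map_zero φ.f₀)
  have hf' : ∀ v, (f' v : X.h) = G.kerEquiv (φ.k₁ v) := fun _ => rfl
  have bijf : Function.Bijective f' := by
    constructor
    · intro v w h
      refine ff.eq (by rw [hS, hS]) ?_
      apply G.kerEquiv.injective
      rw [← hf', ← hf', h]
    · intro w
      obtain ⟨a, ⟨-, ha⟩, -⟩ := ff (G.kerEquiv.symm w.1) 0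
        (by rw [map_zero]; exact w.2)
      refine ⟨a, Subtype.ext ?_⟩
      rw [hf', ha, LinearEquiv.apply_symm_apply]
  let f : S.Ker ≃ₗ[K] X.Ker := LinearEquiv.ofBijective f' bijf
  have hf : ∀ (x : S.Obj) (v : S.Ker), f ⁅x, v⁆ = ⁅e x, f v⁆ := fun x v => by
    apply Subtype.ext
    change G.kerEquiv (φ.k₁ (S.act x v)) = X.act (φ₀ x) (G.kerEquiv (φ.k₁ v))
    have h := φ.k₁_act x v
    rw [hS, map_zero, add_zero] at h
    exact congrArg G.kerEquiv h
  let k : S.Obj →ₗ[K] S.Obj →ₗ[K] X.h := φ.k₂.compr₂ (G.kerEquiv : G.toSemistrict.Ker →ₗ[K] X.h)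
  let i : X.Coker →ₗ[K] S.Obj := e.symm
  have hi : ∀ x, i (e x) = x := e.symm_apply_apply
  have hi' : ∀ x, e (i x) = x := e.apply_symm_apply
  have hil : ∀ x y, i ⁅x, y⁆ = ⁅i x, i y⁆ := fun x y => LieEquiv.map_lie e.symm x y
  let D : X.SectionData :=
    { ρ := φ₀ ∘ₗ i
      toCoker_ρ := fun c => by
        change X.toCoker (φ₀ (i c)) = c
        rw [← he, hi']
      b := ⟨k.compl₁₂ i i, fun c => by
        change G.kerEquiv (φ.k₂ (i c) (i c)) = 0
        rw [φ.k₂_self, map_zero]⟩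
      μ_b := fun c d => by
        refine (φ.d_k₂ (i c) (i d)).trans ?_
        change φ₀ ⁅i c, i d⁆ - ⁅φ₀ (i c), φ₀ (i d)⁆ = φ₀ (i ⁅c, d⁆) - ⁅φ₀ (i c), φ₀ (i d)⁆
        rw [hil] }
  refine ⟨⟨e, f, hf, ?_⟩, fun _ => rfl, fun _ => rfl⟩
  refine Eq.trans ?_ (CrossedModule.mk_cocycle_eq_cls D)
  refine (H3.transport_mk_eq_mk_iff e f hf S.cocycle D.cocycle).2 ⟨0, fun _ => rfl, ?_⟩
  intro x y z
  simp only [LinearMap.zero_apply, lie_zero, sub_zero, add_zero]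
  apply Subtype.ext
  have h := congrArg G.kerEquiv (φ.k₁_l₃ x y z)
  rw [show G.toSemistrict.l₃ (φ.f₀ x) (φ.f₀ y) (φ.f₀ z) = 0 from G.toSemistrict_l₃ _ _ _,
    zero_add] at h
  refine h.trans ?_
  change _ = X.act (φ₀ (i (e x))) (k (i (e y)) (i (e z)))
    - X.act (φ₀ (i (e y))) (k (i (e x)) (i (e z))) + X.act (φ₀ (i (e z))) (k (i (e x)) (i (e y)))
    - k (i ⁅e x, e y⁆) (i (e z)) + k (i ⁅e x, e z⁆) (i (e y)) - k (i ⁅e y, e z⁆) (i (e x))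
  simp only [hil, hi]
  simp only [map_add, map_sub]
  rfl

/-- An isomorphism of the triplets of strict Lie 2-algebras is induced by an equivalence of
semi-strict Lie 2-algebras. -/
theorem exists_hom_of_iso {G H : StrictLie2 K}
    (E : Triplet.Iso G.toCrossedModule.triplet H.toCrossedModule.triplet) :
    ∃ F : SemistrictLie2.Hom G.toSemistrict H.toSemistrict, F.IsEquivalence ∧
      (∀ x : G.Obj, H.toCrossedModule.toCoker (F.f₀ x) = E.e (G.toCrossedModule.toCoker x)) ∧
      ∀ v : G.toCrossedModule.Ker,
        H.kerEquiv (F.k₁ (G.kerEquiv.symm v)) = (E.f v : H.toCrossedModule.Ker).1 := by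
  obtain ⟨S, φ, hφ⟩ := G.toSemistrict.exists_skeletal_equivalence
  obtain ⟨T, ψ, hψ⟩ := H.toSemistrict.exists_skeletal_equivalence
  obtain ⟨ES, hES, hES'⟩ := G.exists_iso_of_model S φ hφ
  obtain ⟨ET, hET, hET'⟩ := H.exists_iso_of_model T ψ hψ
  obtain ⟨J, hJ, hJ₀, hJ₁⟩ := SkeletalLie2.exists_hom_of_iso ((ES.trans E).trans ET.symm)
  obtain ⟨φ', hφ₁, hφ₂⟩ := hφ
  have hφ' : φ'.IsEquivalence := ⟨φ, hφ₂, hφ₁⟩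
  obtain ⟨α, -⟩ := hφ₂
  -- From `G` to its skeletal model by a quasi-inverse, across by the homomorphism realizing the
  -- isomorphism of triplets, and back into `H`. The homotopy `α` shows that `φ'` followed by `φ`
  -- acts as the identity on cokernel and kernel.
  refine ⟨φ'.comp (J.comp ψ), hφ'.comp (hJ.comp hψ), fun x => ?_, fun v => ?_⟩
  · refine (hET (J.f₀ (φ'.f₀ x))).symm.trans ((congrArg ET.e (hJ₀ _)).trans
      ((ET.e.apply_symm_apply _).trans ?_))
    refine congrArg E.e ((hES _).trans ?_)
    refine (sub_eq_zero.1 ?_).symm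
    exact (G.toCrossedModule.toCoker_eq_zero_iff _).2 ⟨G.kerEquiv (α.k x), α.d_k x⟩
  · have h₂ := (hET' (J.k₁ (φ'.k₁ (G.kerEquiv.symm v)))).symm.trans
      (congrArg H.kerToArr ((congrArg ET.f (hJ₁ _)).trans (ET.f.apply_symm_apply _)))
    apply Subtype.ext
    refine Eq.trans h₂ ?_
    change H.kerToArr (E.f _) = H.kerToArr (E.f v)
    congr 2
    apply Subtype.ext
    apply Subtype.ext
    refine (hES' _).trans ?_
    have h₃ := α.k₁_add (G.kerEquiv.symm v)
    have hd : G.toSemistrict.d (G.kerEquiv.symm v) = 0 := v.2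
    rw [hd, map_zero, add_zero] at h₃
    exact congrArg Subtype.val h₃

end StrictLie2

end Lie2

namespace Lie2

open LieModule.Cohomology CategoryTheory

/-! ### Cohomology of free Lie algebras -/

namespace FreeLie

variable {K : Type u} [Field K] {X : Type u}

/-- By the universal property the identity factors through any Lie subalgebra that contains the
generators. -/
theorem lieSubalgebra_eq_top (S : LieSubalgebra K (FreeLieAlgebra K X))
    (h : ∀ x, FreeLieAlgebra.of K x ∈ S) : S = ⊤ := by
  have hid : S.incl.comp (FreeLieAlgebra.lift K fun x => (⟨FreeLieAlgebra.of K x, h x⟩ : S)) =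
      LieHom.id := by
    refine FreeLieAlgebra.hom_ext fun x => ?_
    rw [LieHom.comp_apply, FreeLieAlgebra.lift_of_apply]
    rfl
  rw [eq_top_iff]
  intro a _
  have ha : S.incl _ = a := LieHom.congr_fun hid a
  rw [← ha]
  exact Subtype.property _

section Split

variable {M : Type u} [AddCommGroup M] [Module K M] [LieRingModule (FreeLieAlgebra K X) M]
  [LieModule K (FreeLieAlgebra K X) M]

/-- Every 2-cocycle of a free Lie algebra is a coboundary, with prescribed values of the primitive
on the generators. -/
theorem exists_primitive (c : twoCocycle K (FreeLieAlgebra K X) M) (m : X → M) :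
    ∃ α : FreeLieAlgebra K X →ₗ[K] M, (∀ x, α (FreeLieAlgebra.of K x) = m x) ∧
      ∀ a b, α ⁅a, b⁆ = ⁅a, α b⁆ - ⁅b, α a⁆ + (c : twoCochain K (FreeLieAlgebra K X) M) a b := by
  -- `A` is the extension of the free Lie algebra by `M` defined by `c`. Freeness splits it, with
  -- arbitrary values in `M` on the generators, and the `M`-component of the splitting is the
  -- primitive.
  let A := LieAlgebra.ofTwoCocycle c
  let θ : FreeLieAlgebra K X →ₗ⁅K⁆ A :=
    FreeLieAlgebra.lift K fun x => LieAlgebra.ofProd c (FreeLieAlgebra.of K x, m x)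
  let p : A →ₗ⁅K⁆ FreeLieAlgebra K X :=
    { toFun := fun a => a.carrier.1
      map_add' := fun _ _ => rfl
      map_smul' := fun _ _ => rfl
      map_lie' := rfl }
  let r : A →ₗ[K] M :=
    { toFun := fun a => a.carrier.2
      map_add' := fun _ _ => rfl
      map_smul' := fun _ _ => rfl }
  have hp : p.comp θ = LieHom.id := FreeLieAlgebra.hom_ext fun x => by
    rw [LieHom.comp_apply, FreeLieAlgebra.lift_of_apply]
    rfl
  have hp' : ∀ a, (θ a).carrier.1 = a := fun a => LieHom.congr_fun hp a
  refine ⟨r ∘ₗ (θ : FreeLieAlgebra K X →ₗ[K] A), fun x => ?_, fun a b => ?_⟩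
  · change r (θ _) = _
    rw [FreeLieAlgebra.lift_of_apply]
    rfl
  · change (θ ⁅a, b⁆).carrier.2 = ⁅a, (θ b).carrier.2⁆ - ⁅b, (θ a).carrier.2⁆ + _
    rw [LieHom.map_lie, LieAlgebra.bracket_ofTwoCocycle]
    change (c : twoCochain K (FreeLieAlgebra K X) M) (θ a).carrier.1 (θ b).carrier.1
      + ⁅(θ a).carrier.1, (θ b).carrier.2⁆ - ⁅(θ b).carrier.1, (θ a).carrier.2⁆ = _
    rw [hp', hp']
    abel

end Split

/-- A derivation is a 1-cocycle in the adjoint module: this is the primitive of the zero 2-cocycle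
with the generators as prescribed values. -/
theorem exists_degree : ∃ D : FreeLieAlgebra K X →ₗ[K] FreeLieAlgebra K X,
    (∀ x, D (FreeLieAlgebra.of K x) = FreeLieAlgebra.of K x) ∧
      ∀ a b, D ⁅a, b⁆ = ⁅a, D b⁆ + ⁅D a, b⁆ := by
  obtain ⟨D, hD, hD'⟩ := exists_primitive (K := K) (X := X) 0 (FreeLieAlgebra.of K)
  refine ⟨D, hD, fun a b => ?_⟩
  rw [hD', ← lie_skew (D a) b, sub_eq_add_neg]
  exact add_zero _

variable (K X) in
/-- The derivation of the free Lie algebra which is the identity on the generators. -/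
noncomputable def degree : FreeLieAlgebra K X →ₗ[K] FreeLieAlgebra K X :=
  exists_degree.choose

theorem degree_of (x : X) : degree K X (FreeLieAlgebra.of K x) = FreeLieAlgebra.of K x :=
  exists_degree.choose_spec.1 x

theorem degree_lie (a b : FreeLieAlgebra K X) :
    degree K X ⁅a, b⁆ = ⁅a, degree K X b⁆ + ⁅degree K X a, b⁆ :=
  exists_degree.choose_spec.2 a b

variable (K X) in
/-- The nonzero homogeneous elements. -/
def homogeneous : Set (FreeLieAlgebra K X) :=
  {a | ∃ n : ℕ, 0 < n ∧ degree K X a = (n : K) • a}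

/-- Degrees add under brackets, so the span of the eigenvectors of positive degree is a Lie
subalgebra containing the generators. -/
theorem span_homogeneous : ⊤ ≤ Submodule.span K (homogeneous K X) := by
  let S : LieSubalgebra K (FreeLieAlgebra K X) :=
    { Submodule.span K (homogeneous K X) with
      lie_mem' := fun {a b} ha hb => by
        change a ∈ Submodule.span K _ at ha
        change b ∈ Submodule.span K _ at hb
        change ⁅a, b⁆ ∈ Submodule.span K _
        induction ha using Submodule.span_induction with
        | mem a ha =>
          induction hb using Submodule.span_induction with
          | mem b hb =>
            obtain ⟨n, hn, hna⟩ := ha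
            obtain ⟨k, hk, hkb⟩ := hb
            refine Submodule.subset_span ⟨k + n, by omega, ?_⟩
            rw [degree_lie, hna, hkb, lie_smul, smul_lie, ← add_smul, Nat.cast_add]
          | zero => rw [lie_zero]; exact Submodule.zero_mem _
          | add b c _ _ hb hc => rw [lie_add]; exact Submodule.add_mem _ hb hc
          | smul r b _ hb => rw [lie_smul]; exact Submodule.smul_mem _ r hb
        | zero => rw [zero_lie]; exact Submodule.zero_mem _
        | add b c _ _ hb hc => rw [add_lie]; exact Submodule.add_mem _ hb hc
        | smul r b _ hb => rw [smul_lie]; exact Submodule.smul_mem _ r hb }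
  have h := lieSubalgebra_eq_top S fun x =>
    Submodule.subset_span ⟨1, one_pos, by rw [degree_of, Nat.cast_one, one_smul]⟩
  intro a _
  have ha : a ∈ S := h ▸ LieSubalgebra.mem_top a
  exact ha

theorem exists_basis : ∃ (ι : Type u) (b : Module.Basis ι K (FreeLieAlgebra K X)) (n : ι → ℕ),
    (∀ i, 0 < n i) ∧ ∀ i, degree K X (b i) = (n i : K) • b i := by
  have h : ∀ i, ∃ n : ℕ, 0 < n ∧ degree K X (Module.Basis.ofSpan span_homogeneous i) =
      (n : K) • Module.Basis.ofSpan span_homogeneous i := fun i => by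
    have hi : Module.Basis.ofSpan span_homogeneous i ∈ homogeneous K X :=
      Module.Basis.ofSpan_subset span_homogeneous ⟨i, rfl⟩
    exact hi
  choose n hn hn' using h
  exact ⟨_, _, n, hn, hn'⟩

/-! #### The tensor algebra and its action on modules -/

variable (K X) in
/-- The basis of words of the free associative algebra. -/
noncomputable abbrev words : Module.Basis (FreeMonoid X) K (FreeAlgebra K X) :=
  FreeAlgebra.basisFreeMonoid K X

theorem words_one : words K X 1 = 1 := by
  simp [FreeAlgebra.basisFreeMonoid, FreeAlgebra.equivMonoidAlgebraFreeMonoid]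

theorem words_mul_of (w : FreeMonoid X) (x : X) :
    words K X (w * FreeMonoid.of x) = words K X w * FreeAlgebra.ι K x := by
  simp [FreeAlgebra.basisFreeMonoid, FreeAlgebra.equivMonoidAlgebraFreeMonoid]

/-- Induction on elements of the free associative algebra by right multiplication. -/
theorem tensor_linearMap_ext {E : Type u} [AddCommGroup E] [Module K E]
    {f f' : FreeAlgebra K X →ₗ[K] E} (h₁ : f 1 = f' 1)
    (h₂ : ∀ u x, f u = f' u → f (u * FreeAlgebra.ι K x) = f' (u * FreeAlgebra.ι K x)) :
    f = f' := by
  refine (words K X).ext fun w => ?_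
  have key : ∀ l : List X, f (words K X (FreeMonoid.ofList l)) =
      f' (words K X (FreeMonoid.ofList l)) := fun l => by
    induction l using List.reverseRecOn with
    | nil => exact (congrArg f words_one).trans (h₁.trans (congrArg f' words_one.symm))
    | append_singleton l x ih =>
      have hl : words K X (FreeMonoid.ofList (l ++ [x])) =
          words K X (FreeMonoid.ofList l) * FreeAlgebra.ι K x :=
        words_mul_of (FreeMonoid.ofList l) x
      rw [hl]
      exact h₂ _ x ih
  exact key (FreeMonoid.toList w)

variable (K X) in
/-- The degree operator of the free associative algebra. -/
noncomputable def tensorDegree : FreeAlgebra K X →ₗ[K] FreeAlgebra K X :=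
  (words K X).constr K fun w => (FreeMonoid.length w : K) • words K X w

theorem tensorDegree_words (w : FreeMonoid X) :
    tensorDegree K X (words K X w) = (FreeMonoid.length w : K) • words K X w :=
  (words K X).constr_basis K _ w

theorem tensorDegree_one : tensorDegree K X 1 = 0 := by
  rw [← words_one, tensorDegree_words]
  simp

theorem tensorDegree_mul_ι (u : FreeAlgebra K X) (x : X) :
    tensorDegree K X (u * FreeAlgebra.ι K x) =
      tensorDegree K X u * FreeAlgebra.ι K x + u * FreeAlgebra.ι K x := by
  have h : tensorDegree K X ∘ₗ LinearMap.mulRight K (FreeAlgebra.ι K x) =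
      LinearMap.mulRight K (FreeAlgebra.ι K x) ∘ₗ tensorDegree K X +
        LinearMap.mulRight K (FreeAlgebra.ι K x) := by
    refine (words K X).ext fun w => ?_
    simp only [LinearMap.comp_apply, LinearMap.add_apply, LinearMap.mulRight_apply]
    rw [← words_mul_of, tensorDegree_words, tensorDegree_words, smul_mul_assoc, words_mul_of,
      FreeMonoid.length_mul, FreeMonoid.length_of, Nat.cast_add, Nat.cast_one, add_smul, one_smul]
  exact LinearMap.congr_fun h u

section Assoc

attribute [local instance 100] LieRing.ofAssociativeRing

theorem exists_incl : ∃ j : FreeLieAlgebra K X →ₗ[K] FreeAlgebra K X,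
    (∀ x, j (FreeLieAlgebra.of K x) = FreeAlgebra.ι K x) ∧
      ∀ a b, j ⁅a, b⁆ = j a * j b - j b * j a :=
  ⟨(FreeLieAlgebra.lift K (FreeAlgebra.ι K) : FreeLieAlgebra K X →ₗ⁅K⁆ FreeAlgebra K X),
    fun x => FreeLieAlgebra.lift_of_apply (FreeAlgebra.ι K : X → FreeAlgebra K X) x,
    fun a b => LieHom.map_lie (FreeLieAlgebra.lift K (FreeAlgebra.ι K)) a b⟩

theorem end_eq_of_lie {M : Type u} [AddCommGroup M] [Module K M]
    {f f' : FreeLieAlgebra K X →ₗ[K] Module.End K M}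
    (hf : ∀ a b, f ⁅a, b⁆ = f a * f b - f b * f a)
    (hf' : ∀ a b, f' ⁅a, b⁆ = f' a * f' b - f' b * f' a)
    (h : ∀ x, f (FreeLieAlgebra.of K x) = f' (FreeLieAlgebra.of K x)) : f = f' := by
  let F : FreeLieAlgebra K X →ₗ⁅K⁆ Module.End K M := { f with map_lie' := hf _ _ }
  let F' : FreeLieAlgebra K X →ₗ⁅K⁆ Module.End K M := { f' with map_lie' := hf' _ _ }
  have hF : F = F' := FreeLieAlgebra.hom_ext h
  exact LinearMap.ext fun a => LieHom.congr_fun hF a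

end Assoc

variable (K X) in
/-- The inclusion of the free Lie algebra in the free associative algebra. -/
noncomputable def incl : FreeLieAlgebra K X →ₗ[K] FreeAlgebra K X := exists_incl.choose

theorem incl_of (x : X) : incl K X (FreeLieAlgebra.of K x) = FreeAlgebra.ι K x :=
  exists_incl.choose_spec.1 x

theorem incl_lie (a b : FreeLieAlgebra K X) :
    incl K X ⁅a, b⁆ = incl K X a * incl K X b - incl K X b * incl K X a :=
  exists_incl.choose_spec.2 a b

/-- The elements `a` satisfying this for all `u` at once form a Lie subalgebra containing the
generators. The quantifier over `u` is what gives closure under brackets. -/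
theorem tensorDegree_mul_incl (u : FreeAlgebra K X) (a : FreeLieAlgebra K X) :
    tensorDegree K X (u * incl K X a) =
      tensorDegree K X u * incl K X a + u * incl K X (degree K X a) := by
  let S : LieSubalgebra K (FreeLieAlgebra K X) :=
    { carrier := {a | ∀ u, tensorDegree K X (u * incl K X a) =
        tensorDegree K X u * incl K X a + u * incl K X (degree K X a)}
      add_mem' := fun {a b} ha hb u => by
        simp only [map_add, mul_add, ha u, hb u]
        abel
      zero_mem' := fun u => by simp
      smul_mem' := fun r a ha u => by
        simp only [map_smul, mul_smul_comm, ha u, smul_add]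
      lie_mem' := fun {a b} ha hb u => by
        simp only [incl_lie, degree_lie, map_add, map_sub, mul_sub, mul_add, ← mul_assoc]
        rw [ha, hb, ha, hb]
        simp only [add_mul, mul_assoc]
        abel }
  have hS : S = ⊤ := lieSubalgebra_eq_top S fun x u => by
    rw [degree_of, incl_of, tensorDegree_mul_ι]
  have ha : a ∈ S := hS ▸ LieSubalgebra.mem_top a
  exact ha u

section Representation

variable {M : Type u} [AddCommGroup M] [Module K M]

/-- The action of the free associative algebra extending a representation of the free Lie
algebra. -/
noncomputable def tensorAct (A : FreeLieAlgebra K X →ₗ[K] Module.End K M) :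
    FreeAlgebra K X →ₐ[K] Module.End K M :=
  FreeAlgebra.lift K fun x => A (FreeLieAlgebra.of K x)

variable {A : FreeLieAlgebra K X →ₗ[K] Module.End K M}

theorem tensorAct_ι (x : X) : tensorAct A (FreeAlgebra.ι K x) = A (FreeLieAlgebra.of K x) :=
  FreeAlgebra.lift_ι_apply _ x

theorem tensorAct_incl (hA : ∀ a b, A ⁅a, b⁆ = A a * A b - A b * A a)
    (a : FreeLieAlgebra K X) : tensorAct A (incl K X a) = A a := by
  have h : (tensorAct A).toLinearMap ∘ₗ incl K X = A := by
    refine end_eq_of_lie (fun a b => ?_) hA fun x => ?_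
    · simp only [LinearMap.comp_apply, incl_lie, AlgHom.toLinearMap_apply, map_sub, map_mul]
    · simp only [LinearMap.comp_apply, incl_of, AlgHom.toLinearMap_apply, tensorAct_ι]
  exact LinearMap.congr_fun h a

end Representation

/-! #### Inverting the degree -/

section Weights

variable [CharZero K] {E : Type u} [AddCommGroup E] [Module K E]

/-- On homogeneous basis elements the total degree operator multiplies by a sum of degrees. It is
positive because Lie elements have positive degree, hence nonzero in characteristic `0`. -/
theorem eq_zero_of_weight₂
    {f : FreeLieAlgebra K X →ₗ[K] FreeLieAlgebra K X →ₗ[K] FreeAlgebra K X →ₗ[K] E}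
    (h : ∀ a b u, f (degree K X a) b u + f a (degree K X b) u + f a b (tensorDegree K X u) = 0) :
    f = 0 := by
  obtain ⟨ι, bs, n, hn, hn'⟩ := exists_basis (K := K) (X := X)
  refine bs.ext fun i => bs.ext fun j => (words K X).ext fun w => ?_
  have h₁ := h (bs i) (bs j) (words K X w)
  simp only [hn', tensorDegree_words, map_smul, LinearMap.smul_apply, ← add_smul] at h₁
  refine (smul_eq_zero.1 h₁).resolve_left ?_
  have := hn i
  exact_mod_cast (by omega : n i + n j + FreeMonoid.length w ≠ 0)

theorem eq_zero_of_weight₃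
    {f : FreeLieAlgebra K X →ₗ[K] FreeLieAlgebra K X →ₗ[K] FreeLieAlgebra K X →ₗ[K]
      FreeAlgebra K X →ₗ[K] E}
    (h : ∀ a b c u, f (degree K X a) b c u + f a (degree K X b) c u + f a b (degree K X c) u
      + f a b c (tensorDegree K X u) = 0) :
    f = 0 := by
  obtain ⟨ι, bs, n, hn, hn'⟩ := exists_basis (K := K) (X := X)
  refine bs.ext fun i => bs.ext fun j => bs.ext fun k => (words K X).ext fun w => ?_
  have h₁ := h (bs i) (bs j) (bs k) (words K X w)
  simp only [hn', tensorDegree_words, map_smul, LinearMap.smul_apply, ← add_smul] at h₁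
  refine (smul_eq_zero.1 h₁).resolve_left ?_
  have := hn i
  exact_mod_cast (by omega : n i + n j + n k + FreeMonoid.length w ≠ 0)

/-- Divide by the total degree on the homogeneous basis. -/
theorem exists_weight_inverse
    (f : FreeLieAlgebra K X →ₗ[K] FreeLieAlgebra K X →ₗ[K] FreeAlgebra K X →ₗ[K] E) :
    ∃ f' : FreeLieAlgebra K X →ₗ[K] FreeLieAlgebra K X →ₗ[K] FreeAlgebra K X →ₗ[K] E,
      ∀ a b u, f' (degree K X a) b u + f' a (degree K X b) u + f' a b (tensorDegree K X u) =
        f a b u := by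
  obtain ⟨ι, bs, n, hn, hn'⟩ := exists_basis (K := K) (X := X)
  let f' : FreeLieAlgebra K X →ₗ[K] FreeLieAlgebra K X →ₗ[K] FreeAlgebra K X →ₗ[K] E :=
    bs.constr K fun i => bs.constr K fun j => (words K X).constr K fun w =>
      ((n i + n j + FreeMonoid.length w : ℕ) : K)⁻¹ • f (bs i) (bs j) (words K X w)
  have hf' : ∀ i j w, f' (bs i) (bs j) (words K X w) =
      ((n i + n j + FreeMonoid.length w : ℕ) : K)⁻¹ • f (bs i) (bs j) (words K X w) :=
    fun i j w => by simp only [f', Module.Basis.constr_basis]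
  refine ⟨f', fun a b u => ?_⟩
  have h : f' ∘ₗ degree K X + f'.compl₂ (degree K X)
      + f'.compr₂ (LinearMap.lcomp K E (tensorDegree K X)) = f := by
    refine bs.ext fun i => bs.ext fun j => (words K X).ext fun w => ?_
    change f' (degree K X (bs i)) (bs j) (words K X w) + f' (bs i) (degree K X (bs j)) (words K X w)
      + f' (bs i) (bs j) (tensorDegree K X (words K X w)) = _
    simp only [hn', tensorDegree_words, map_smul, LinearMap.smul_apply, ← add_smul, hf']
    have := hn i
    have h0 : ((n i + n j + FreeMonoid.length w : ℕ) : K) ≠ 0 :=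
      Nat.cast_ne_zero.2 (by omega)
    rw [← Nat.cast_add, ← Nat.cast_add, smul_smul, mul_inv_cancel₀ h0, one_smul]
  exact LinearMap.congr_fun (LinearMap.congr_fun (LinearMap.congr_fun h a) b) u

end Weights

end FreeLie

end Lie2

namespace Lie2

open LieModule.Cohomology CategoryTheory

namespace FreeLie

variable {K : Type u} [Field K] {X : Type u}

/-! #### The coinduced module -/

variable (K X) in
/-- The coinduced module of linear maps from the free associative algebra to `V`. -/
def Coind (V : Type u) [AddCommGroup V] [Module K V] : Type u := FreeAlgebra K X →ₗ[K] V

variable {V : Type u} [AddCommGroup V] [Module K V]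

instance : AddCommGroup (Coind K X V) := inferInstanceAs (AddCommGroup (FreeAlgebra K X →ₗ[K] V))

instance : Module K (Coind K X V) := inferInstanceAs (Module K (FreeAlgebra K X →ₗ[K] V))

/-- Evaluation of elements of the coinduced module. -/
def Coind.eval : Coind K X V →ₗ[K] FreeAlgebra K X →ₗ[K] V := LinearMap.id

theorem Coind.eval_injective : Function.Injective (Coind.eval : Coind K X V → _) := fun _ _ h => h

noncomputable instance : LieRingModule (FreeLieAlgebra K X) (Coind K X V) where
  bracket a f := (Coind.eval f ∘ₗ LinearMap.mulRight K (incl K X a) : FreeAlgebra K X →ₗ[K] V)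
  add_lie a b f := LinearMap.ext fun u => by
    change Coind.eval f (u * incl K X (a + b)) =
      Coind.eval f (u * incl K X a) + Coind.eval f (u * incl K X b)
    rw [map_add, mul_add, map_add]
  lie_add _ _ _ := rfl
  leibniz_lie a b f := LinearMap.ext fun u => by
    change Coind.eval f (u * incl K X a * incl K X b) =
      Coind.eval f (u * incl K X ⁅a, b⁆) + Coind.eval f (u * incl K X b * incl K X a)
    rw [incl_lie, mul_sub, map_sub, mul_assoc, mul_assoc, sub_add_cancel]

theorem Coind.eval_lie (a : FreeLieAlgebra K X) (f : Coind K X V) (u : FreeAlgebra K X) :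
    Coind.eval ⁅a, f⁆ u = Coind.eval f (u * incl K X a) := rfl

noncomputable instance : LieModule K (FreeLieAlgebra K X) (Coind K X V) where
  smul_lie r a f := LinearMap.ext fun u => by
    change Coind.eval f (u * incl K X (r • a)) = r • Coind.eval f (u * incl K X a)
    rw [map_smul, mul_smul_comm, map_smul]
  lie_smul _ _ _ := rfl

variable [LieRingModule (FreeLieAlgebra K X) V] [LieModule K (FreeLieAlgebra K X) V]

variable (K X V) in
/-- The action on `V` as a linear map. -/
noncomputable def action : FreeLieAlgebra K X →ₗ[K] Module.End K V :=
  (LieModule.toEnd K (FreeLieAlgebra K X) V : FreeLieAlgebra K X →ₗ[K] Module.End K V)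

theorem action_apply (a : FreeLieAlgebra K X) (v : V) : action K X V a v = ⁅a, v⁆ := rfl

theorem action_lie (a b : FreeLieAlgebra K X) : action K X V ⁅a, b⁆ =
    action K X V a * action K X V b - action K X V b * action K X V a := by
  ext v
  exact lie_lie a b v

variable (K X V) in
/-- The embedding of `V` in the coinduced module. -/
noncomputable def toCoind : V →ₗ⁅K, FreeLieAlgebra K X⁆ Coind K X V where
  toFun v := LinearMap.applyₗ v ∘ₗ (tensorAct (action K X V)).toLinearMap
  map_add' v w := LinearMap.ext fun u => map_add (tensorAct (action K X V) u) v w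
  map_smul' r v := LinearMap.ext fun u => map_smul (tensorAct (action K X V) u) r v
  map_lie' {a v} := LinearMap.ext fun u => by
    change tensorAct (action K X V) u ⁅a, v⁆ = tensorAct (action K X V) (u * incl K X a) v
    rw [map_mul, tensorAct_incl action_lie]
    rfl

theorem eval_toCoind (v : V) (u : FreeAlgebra K X) :
    Coind.eval (toCoind K X V v) u = tensorAct (action K X V) u v := rfl

theorem toCoind_injective : Function.Injective (toCoind K X V) := fun v w h => by
  have h₁ := LinearMap.congr_fun (congrArg Coind.eval h) (1 : FreeAlgebra K X)
  simpa only [eval_toCoind, map_one, Module.End.one_apply] using h₁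

/-! #### The homotopy -/

variable (K X V) in
/-- The action of the free Lie algebra on `Hom(F, V) × V`. -/
noncomputable def twistedAction :
    FreeLieAlgebra K X →ₗ[K] Module.End K ((FreeLieAlgebra K X →ₗ[K] V) × V) :=
  LinearMap.mk₂ K (fun a p => (⁅a, p.1⁆, ⁅a, p.2⁆ + p.1 (degree K X a)))
    (fun a b p => by simp only [add_lie, map_add, Prod.mk_add_mk]; congr 1; abel)
    (fun r a p => by simp only [smul_lie, map_smul, Prod.smul_mk, smul_add])
    (fun a p q => by
      simp only [lie_add, Prod.fst_add, Prod.snd_add, LinearMap.add_apply, Prod.mk_add_mk]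
      congr 1; abel)
    (fun r a p => by
      simp only [lie_smul, Prod.smul_fst, Prod.smul_snd, LinearMap.smul_apply, Prod.smul_mk,
        smul_add])

theorem twistedAction_apply (a : FreeLieAlgebra K X) (p : (FreeLieAlgebra K X →ₗ[K] V) × V) :
    twistedAction K X V a p = (⁅a, p.1⁆, ⁅a, p.2⁆ + p.1 (degree K X a)) := rfl

/-- Because `degree` is a derivation, the off-diagonal part `p ↦ p (degree a)` is a 1-cocycle, and
the triangular action is a representation. -/
theorem twistedAction_lie (a b : FreeLieAlgebra K X) : twistedAction K X V ⁅a, b⁆ =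
    twistedAction K X V a * twistedAction K X V b -
      twistedAction K X V b * twistedAction K X V a := by
  refine LinearMap.ext fun p => Prod.ext (lie_lie a b p.1) ?_
  change ⁅⁅a, b⁆, p.2⁆ + p.1 (degree K X ⁅a, b⁆) =
    ⁅a, ⁅b, p.2⁆ + p.1 (degree K X b)⁆ + ⁅b, p.1⁆ (degree K X a)
      - (⁅b, ⁅a, p.2⁆ + p.1 (degree K X a)⁆ + ⁅a, p.1⁆ (degree K X b))
  rw [lie_lie, degree_lie, ← lie_skew (degree K X a) b]
  simp only [LieHom.lie_apply, lie_add, map_add, map_neg]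
  abel

variable (K X V) in
/-- The action of the free associative algebra on `Hom(F, V) × V`, followed by the projection to
`V`. -/
noncomputable def twistedEval : ((FreeLieAlgebra K X →ₗ[K] V) × V) →ₗ[K] Coind K X V where
  toFun p := LinearMap.snd K _ _ ∘ₗ LinearMap.applyₗ p ∘ₗ
    (tensorAct (twistedAction K X V)).toLinearMap
  map_add' p q := LinearMap.ext fun u =>
    congrArg Prod.snd (map_add (tensorAct (twistedAction K X V) u) p q)
  map_smul' r p := LinearMap.ext fun u =>
    congrArg Prod.snd (map_smul (tensorAct (twistedAction K X V) u) r p)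

theorem eval_twistedEval (p : (FreeLieAlgebra K X →ₗ[K] V) × V) (u : FreeAlgebra K X) :
    Coind.eval (twistedEval K X V p) u = (tensorAct (twistedAction K X V) u p).2 := rfl

theorem twistedEval_action (a : FreeLieAlgebra K X) (p : (FreeLieAlgebra K X →ₗ[K] V) × V) :
    twistedEval K X V (twistedAction K X V a p) = ⁅a, twistedEval K X V p⁆ :=
  Coind.eval_injective (LinearMap.ext fun u => by
    rw [Coind.eval_lie, eval_twistedEval, eval_twistedEval, map_mul,
      tensorAct_incl twistedAction_lie]
    rfl)

theorem tensorAct_inr (u : FreeAlgebra K X) (v : V) :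
    tensorAct (twistedAction K X V) u (0, v) = (0, tensorAct (action K X V) u v) := by
  have h : LinearMap.lcomp K ((FreeLieAlgebra K X →ₗ[K] V) × V)
        (LinearMap.inr K (FreeLieAlgebra K X →ₗ[K] V) V) ∘ₗ
        (tensorAct (twistedAction K X V)).toLinearMap =
      LinearMap.llcomp K V V _ (LinearMap.inr K (FreeLieAlgebra K X →ₗ[K] V) V) ∘ₗ
        (tensorAct (action K X V)).toLinearMap := by
    refine tensor_linearMap_ext (LinearMap.ext fun v => ?_) fun u x hu => LinearMap.ext fun v => ?_
    · change tensorAct (twistedAction K X V) 1 (0, v) = (0, tensorAct (action K X V) 1 v)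
      rw [map_one, map_one]
      rfl
    · have h := LinearMap.congr_fun hu ⁅FreeLieAlgebra.of K x, v⁆
      change tensorAct (twistedAction K X V) u (0, ⁅FreeLieAlgebra.of K x, v⁆) =
        (0, tensorAct (action K X V) u ⁅FreeLieAlgebra.of K x, v⁆) at h
      change tensorAct (twistedAction K X V) (u * FreeAlgebra.ι K x) (0, v) =
        (0, tensorAct (action K X V) (u * FreeAlgebra.ι K x) v)
      rw [map_mul, map_mul, Module.End.mul_apply, Module.End.mul_apply, tensorAct_ι, tensorAct_ι,
        twistedAction_apply, action_apply, ← h]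
      simp
  exact LinearMap.congr_fun (LinearMap.congr_fun h u) v

theorem twistedEval_inr (v : V) : twistedEval K X V (0, v) = toCoind K X V v :=
  Coind.eval_injective (LinearMap.ext fun u => congrArg Prod.snd (tensorAct_inr u v))

variable (K X V) in
/-- The orbit map `v ↦ (a ↦ a v)`. -/
noncomputable def orbit : V →ₗ[K] FreeLieAlgebra K X →ₗ[K] V := (action K X V).flip

theorem orbit_apply (v : V) (a : FreeLieAlgebra K X) : orbit K X V v a = ⁅a, v⁆ := rfl

theorem twistedAction_orbit (a : FreeLieAlgebra K X) (v : V) :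
    twistedAction K X V a (orbit K X V v, 0) =
      (orbit K X V ⁅a, v⁆, 0) + (0, ⁅degree K X a, v⁆) := by
  rw [twistedAction_apply]
  refine Prod.ext (LinearMap.ext fun f => ?_) ?_
  · change ⁅a, orbit K X V v⁆ f = orbit K X V ⁅a, v⁆ f + 0
    rw [LieHom.lie_apply, orbit_apply, orbit_apply, orbit_apply, add_zero, lie_lie]
    abel
  · simp [orbit_apply]

/-- Induction on words: each letter of `u` acts once through the off-diagonal part and contributes
one copy of `u · v`, so the total is weighted by word length. -/
theorem eval_twistedEval_orbit (v : V) (u : FreeAlgebra K X) :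
    Coind.eval (twistedEval K X V (orbit K X V v, 0)) u =
      Coind.eval (toCoind K X V v) (tensorDegree K X u) := by
  have h : LinearMap.lcomp K V (LinearMap.inl K (FreeLieAlgebra K X →ₗ[K] V) V ∘ₗ orbit K X V) ∘ₗ
        LinearMap.llcomp K _ _ _ (LinearMap.snd K (FreeLieAlgebra K X →ₗ[K] V) V) ∘ₗ
        (tensorAct (twistedAction K X V)).toLinearMap =
      (tensorAct (action K X V)).toLinearMap ∘ₗ tensorDegree K X := by
    refine tensor_linearMap_ext (LinearMap.ext fun v => ?_) fun u x hu => LinearMap.ext fun v => ?_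
    · change (tensorAct (twistedAction K X V) 1 (orbit K X V v, 0)).2 =
        tensorAct (action K X V) (tensorDegree K X 1) v
      rw [map_one, tensorDegree_one, map_zero]
      rfl
    · have h := LinearMap.congr_fun hu ⁅FreeLieAlgebra.of K x, v⁆
      change (tensorAct (twistedAction K X V) u (orbit K X V ⁅FreeLieAlgebra.of K x, v⁆, 0)).2 =
        tensorAct (action K X V) (tensorDegree K X u) ⁅FreeLieAlgebra.of K x, v⁆ at h
      change (tensorAct (twistedAction K X V) (u * FreeAlgebra.ι K x) (orbit K X V v, 0)).2 =
        tensorAct (action K X V) (tensorDegree K X (u * FreeAlgebra.ι K x)) v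
      rw [map_mul, tensorDegree_mul_ι, map_add, map_mul, map_mul, Module.End.mul_apply,
        LinearMap.add_apply, Module.End.mul_apply, Module.End.mul_apply, tensorAct_ι, tensorAct_ι,
        twistedAction_orbit, action_apply, map_add, Prod.snd_add, h, degree_of, tensorAct_inr]
  exact LinearMap.congr_fun (LinearMap.congr_fun h u) v

theorem Z3_swap_left {g : Type u} [LieRing g] [LieAlgebra K g] [LieRingModule g V]
    [LieModule K g V] (c : Z3 K g V) (x y z : g) : c.1 x y z = - c.1 y x z := by
  have h := c.2.1 (x + y) z
  simp only [map_add, LinearMap.add_apply, c.2.1, zero_add, add_zero] at h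
  exact eq_neg_of_add_eq_zero_right h

theorem Z3_swap_right {g : Type u} [LieRing g] [LieAlgebra K g] [LieRingModule g V]
    [LieModule K g V] (c : Z3 K g V) (x y z : g) : c.1 x y z = - c.1 x z y := by
  have h := c.2.2.1 x (y + z)
  simp only [map_add, LinearMap.add_apply, c.2.2.1, zero_add, add_zero] at h
  exact eq_neg_of_add_eq_zero_right h

section Homotopy

variable (c : Z3 K (FreeLieAlgebra K X) V)

/-- The 2-cochain `(a, b) ↦ c(-, a, b)`. -/
noncomputable def contraction : FreeLieAlgebra K X →ₗ[K] FreeLieAlgebra K X →ₗ[K]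
    (FreeLieAlgebra K X →ₗ[K] V) := LinearMap.lflip.toLinearMap ∘ₗ c.1.flip

theorem contraction_apply (a b f : FreeLieAlgebra K X) : contraction c a b f = c.1 f a b := rfl

/-- Cartan's formula for contraction with the Euler derivation. The first component is the cocycle
identity at `(f, e, a, b)`. The second collects the three terms with `degree` inserted in one
argument; after `twistedEval` the first supplies the degree in the associative variable. -/
theorem d_contraction (e a b : FreeLieAlgebra K X) :
    twistedAction K X V e (contraction c a b, 0) - twistedAction K X V a (contraction c e b, 0)
      + twistedAction K X V b (contraction c e a, 0) - (contraction c ⁅e, a⁆ b, 0)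
      + (contraction c ⁅e, b⁆ a, 0) - (contraction c ⁅a, b⁆ e, 0) =
    (orbit K X V (c.1 e a b), 0) +
      (0, c.1 (degree K X e) a b + c.1 e (degree K X a) b + c.1 e a (degree K X b)) := by
  refine Prod.ext (LinearMap.ext fun f => ?_) ?_
  · change ⁅e, contraction c a b⁆ f - ⁅a, contraction c e b⁆ f + ⁅b, contraction c e a⁆ f
      - contraction c ⁅e, a⁆ b f + contraction c ⁅e, b⁆ a f - contraction c ⁅a, b⁆ e f =
      ⁅f, c.1 e a b⁆ + 0
    simp only [LieHom.lie_apply, contraction_apply, add_zero]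
    have h := c.2.2.2 f e a b
    rw [← lie_skew e f, ← lie_skew a f, ← lie_skew b f]
    simp only [map_neg, LinearMap.neg_apply]
    rw [Z3_swap_left c f ⁅e, a⁆, Z3_swap_left c f ⁅e, b⁆, Z3_swap_left c f ⁅a, b⁆, ← sub_eq_zero,
      ← neg_eq_zero, ← h]
    abel
  · change (⁅e, (0 : V)⁆ + contraction c a b (degree K X e))
      - (⁅a, (0 : V)⁆ + contraction c e b (degree K X a))
      + (⁅b, (0 : V)⁆ + contraction c e a (degree K X b)) - 0 + 0 - 0 = 0 + _
    simp only [lie_zero, contraction_apply, zero_add, add_zero, sub_zero]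
    rw [Z3_swap_left c e (degree K X a) b, Z3_swap_right c e a, Z3_swap_left c e (degree K X b) a]
    abel

variable [CharZero K]

/-- By Cartan's formula, the differential of the contraction is the total degree operator applied to
`toCoind ∘ c`. That operator commutes with the differential, so dividing the contraction by it
yields a primitive. -/
theorem exists_coind_primitive : ∃ β : twoCochain K (FreeLieAlgebra K X) (Coind K X V),
    ∀ x y z, d₂₃ K (FreeLieAlgebra K X) (Coind K X V) β x y z = toCoind K X V (c.1 x y z) := by
  let β' : FreeLieAlgebra K X →ₗ[K] FreeLieAlgebra K X →ₗ[K] Coind K X V :=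
    (contraction c).compr₂ (twistedEval K X V ∘ₗ LinearMap.inl K _ _)
  have hβ' : ∀ a b, β' a b = twistedEval K X V (contraction c a b, 0) := fun _ _ => rfl
  have hβ'_skew : ∀ a b, β' a b = - β' b a := fun a b => by
    have h : contraction c a b = - contraction c b a := LinearMap.ext fun f => Z3_swap_right c f a b
    rw [hβ', hβ', ← map_neg, h]
    simp
  obtain ⟨β₀, hβ₀⟩ := exists_weight_inverse (E := V) β'
  let β : FreeLieAlgebra K X →ₗ[K] FreeLieAlgebra K X →ₗ[K] Coind K X V := β₀
  have hβ : ∀ a b u, Coind.eval (β (degree K X a) b) u + Coind.eval (β a (degree K X b)) u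
      + Coind.eval (β a b) (tensorDegree K X u) = Coind.eval (β' a b) u := hβ₀
  have hskew : ∀ a b, β a b = - β b a := fun a b => by
    -- The symmetrization of `β` is killed by the total degree operator, since `β'` is skew.
    have h := eq_zero_of_weight₂ (E := V) (f := β + β.flip) fun a b u => by
      have h₁ := hβ a b u
      have h₂ := hβ b a u
      rw [hβ'_skew b a, map_neg, LinearMap.neg_apply] at h₂
      change (Coind.eval (β (degree K X a) b) u + Coind.eval (β b (degree K X a)) u)
        + (Coind.eval (β a (degree K X b)) u + Coind.eval (β (degree K X b) a) u)
        + (Coind.eval (β a b) (tensorDegree K X u) + Coind.eval (β b a) (tensorDegree K X u)) = 0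
      have h₃ := congrArg₂ (· + ·) h₁ h₂
      simp only [add_neg_cancel] at h₃
      rw [← h₃]
      abel
    exact eq_neg_of_add_eq_zero_left (LinearMap.congr_fun (LinearMap.congr_fun h a) b)
  have halt : ∀ a, β a a = 0 := fun a => by
    have h : (2 : K) • β a a = 0 := by
      rw [two_smul]
      exact eq_neg_iff_add_eq_zero.1 (hskew a a)
    exact (smul_eq_zero.1 h).resolve_left two_ne_zero
  refine ⟨⟨β, halt⟩, ?_⟩
  let f : FreeLieAlgebra K X →ₗ[K] FreeLieAlgebra K X →ₗ[K] FreeLieAlgebra K X →ₗ[K] Coind K X V :=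
    d₂₃ K (FreeLieAlgebra K X) (Coind K X V) ⟨β, halt⟩
  let γ : FreeLieAlgebra K X →ₗ[K] FreeLieAlgebra K X →ₗ[K] FreeLieAlgebra K X →ₗ[K] Coind K X V :=
    LinearMap.llcomp K _ _ _ (LinearMap.llcomp K _ _ _ (toCoind K X V : V →ₗ[K] Coind K X V)) ∘ₗ c.1
  have hf : ∀ x y z u, Coind.eval (f x y z) u = Coind.eval (β y z) (u * incl K X x)
      - Coind.eval (β x z) (u * incl K X y) + Coind.eval (β x y) (u * incl K X z)
      - Coind.eval (β ⁅x, y⁆ z) u + Coind.eval (β ⁅x, z⁆ y) u - Coind.eval (β ⁅y, z⁆ x) u :=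
    fun _ _ _ _ => rfl
  have hγ : ∀ x y z, γ x y z = toCoind K X V (c.1 x y z) := fun _ _ _ => rfl
  -- It is enough that the total degree operator kills the difference. `h₁` to `h₆` apply the
  -- operator to the six terms of the differential of `β`, and `h₀` is Cartan's formula.
  have key : f - γ = 0 := eq_zero_of_weight₃ (E := V) fun e a b u => by
    have h₀ := congrArg (fun w => Coind.eval (twistedEval K X V w) u) (d_contraction c e a b)
    simp only [map_add, map_sub, twistedEval_action, twistedEval_inr, LinearMap.add_apply,
      LinearMap.sub_apply, Coind.eval_lie, eval_twistedEval_orbit, ← hβ'] at h₀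
    have h₁ := hβ a b (u * incl K X e)
    have h₂ := hβ e b (u * incl K X a)
    have h₃ := hβ e a (u * incl K X b)
    have h₄ := hβ ⁅e, a⁆ b u
    have h₅ := hβ ⁅e, b⁆ a u
    have h₆ := hβ ⁅a, b⁆ e u
    simp only [tensorDegree_mul_incl, degree_lie, map_add, LinearMap.add_apply] at h₁ h₂ h₃ h₄ h₅ h₆
    change Coind.eval (f (degree K X e) a b - γ (degree K X e) a b) u
      + Coind.eval (f e (degree K X a) b - γ e (degree K X a) b) u
      + Coind.eval (f e a (degree K X b) - γ e a (degree K X b)) u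
      + Coind.eval (f e a b - γ e a b) (tensorDegree K X u) = 0
    simp only [map_sub, LinearMap.sub_apply, hf, hγ]
    linear_combination (norm := module) h₁ - h₂ + h₃ - h₄ + h₅ - h₆ + h₀
  intro x y z
  have h := LinearMap.congr_fun (LinearMap.congr_fun (LinearMap.congr_fun key x) y) z
  exact sub_eq_zero.1 h

/-- The third cohomology of a free Lie algebra vanishes. -/
theorem exists_d_eq : ∃ b : twoCochain K (FreeLieAlgebra K X) V,
    d₂₃ K (FreeLieAlgebra K X) V b = c.1 := by
  obtain ⟨β, hβ⟩ := exists_coind_primitive c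
  let I := Coind K X V
  let F := FreeLieAlgebra K X
  -- Dimension shift along `V → I → I ⧸ N`: the differential of `β` takes values in `V`, so `β`
  -- becomes a 2-cocycle in the quotient, where it has a primitive.
  let N : LieSubmodule K F I := (toCoind K X V).range
  let q : I →ₗ⁅K, F⁆ I ⧸ N := LieSubmodule.Quotient.mk' N
  have hq : ∀ v, q (toCoind K X V v) = 0 := fun v =>
    (LieSubmodule.Quotient.mk_eq_zero' (N := N)).2 ⟨v, rfl⟩
  let β₁ : twoCochain K F (I ⧸ N) := ⟨β.1.compr₂ (q : I →ₗ[K] I ⧸ N), fun x => by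
    change q (β x x) = 0
    rw [twoCochain_alt, map_zero]⟩
  have hβ₁ : β₁ ∈ twoCocycle K F (I ⧸ N) := by
    rw [mem_twoCocycle_iff]
    ext x y z
    have h := congrArg q (hβ x y z)
    rw [hq, d₂₃_apply] at h
    simp only [map_add, map_sub, LieModuleHom.map_lie] at h
    exact h
  obtain ⟨α, -, hα⟩ := exists_primitive ⟨β₁, hβ₁⟩ 0
  obtain ⟨σ, hσ⟩ := LinearMap.exists_rightInverse_of_surjective (q : I →ₗ[K] I ⧸ N)
    (LinearMap.range_eq_top.2 (LieSubmodule.Quotient.surjective_mk' N))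
  have hσ' : ∀ x, q (σ x) = x := fun x => LinearMap.congr_fun hσ x
  -- Adding the coboundary of a linear lift of `α` keeps the differential of `β` and cancels its
  -- image in the quotient, so the new cochain takes values in `V`.
  let γ : twoCochain K F I := β + d₁₂ K F I (σ ∘ₗ α)
  have hγ : d₂₃ K F I γ = d₂₃ K F I β := by
    rw [map_add]
    have h := LinearMap.congr_fun (d₂₃_comp_d₁₂ K F I) (σ ∘ₗ α)
    rw [LinearMap.comp_apply] at h
    rw [h, LinearMap.zero_apply, add_zero]
  have hγ' : ∀ a b, ∃ v, toCoind K X V v = γ a b := fun a b => by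
    refine (LieSubmodule.Quotient.mk_eq_zero' (N := N)).1 ?_
    change q (β a b + (⁅a, σ (α b)⁆ - ⁅b, σ (α a)⁆ - σ (α ⁅a, b⁆))) = 0
    simp only [map_add, map_sub, LieModuleHom.map_lie, hσ', hα]
    change q (β a b) + (_ - _ - (_ - _ + q (β a b))) = 0
    abel
  obtain ⟨r, hr⟩ := LinearMap.exists_leftInverse_of_injective (toCoind K X V : V →ₗ[K] I)
    (LinearMap.ker_eq_bot.2 toCoind_injective)
  have hr' : ∀ v, r (toCoind K X V v) = v := fun v => LinearMap.congr_fun hr v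
  let b : twoCochain K F V := ⟨γ.1.compr₂ r, fun x => by
    change r (γ x x) = 0
    rw [twoCochain_alt, map_zero]⟩
  have hb : ∀ x y, toCoind K X V (b x y) = γ x y := fun x y => by
    obtain ⟨v, hv⟩ := hγ' x y
    change toCoind K X V (r (γ x y)) = γ x y
    rw [← hv, hr']
  refine ⟨b, ?_⟩
  ext x y z
  apply toCoind_injective (K := K) (X := X)
  rw [← hβ, ← hγ]
  simp only [d₂₃_apply, map_add, map_sub, LieModuleHom.map_lie, hb]
  rfl

end Homotopy

end FreeLie

end Lie2

namespace Lie2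

open LieModule.Cohomology CategoryTheory

/-! ### Realization of classes by crossed modules -/

namespace FreeLie

variable {K : Type u} [Field K] [CharZero K] {X : Type u} {g : Type u} [LieRing g] [LieAlgebra K g]
  {V : Type u} [AddCommGroup V] [Module K V] [LieRingModule g V] [LieModule K g V]

/-- The free Lie algebra acts on `V` through `π`, and the pulled back cocycle is a coboundary there.
-/
theorem exists_pullback_primitive (π : FreeLieAlgebra K X →ₗ⁅K⁆ g) (w : Z3 K g V) :
    ∃ β : FreeLieAlgebra K X →ₗ[K] FreeLieAlgebra K X →ₗ[K] V, (∀ x, β x x = 0) ∧ ∀ x y z,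
      ⁅π x, β y z⁆ - ⁅π y, β x z⁆ + ⁅π z, β x y⁆ - β ⁅x, y⁆ z + β ⁅x, z⁆ y - β ⁅y, z⁆ x =
        w.1 (π x) (π y) (π z) := by
  let _ : LieRingModule (FreeLieAlgebra K X) V := LieRingModule.compLieHom V π
  have _ : LieModule K (FreeLieAlgebra K X) V := LieModule.compLieHom V π
  let p : FreeLieAlgebra K X →ₗ[K] g := π
  let c : FreeLieAlgebra K X →ₗ[K] FreeLieAlgebra K X →ₗ[K] FreeLieAlgebra K X →ₗ[K] V :=
    (w.1.compl₁₂ p p).compr₂ (LinearMap.lcomp K V p)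
  have hc : ∀ x y z, c x y z = w.1 (π x) (π y) (π z) := fun _ _ _ => rfl
  obtain ⟨b, hb⟩ := exists_d_eq (⟨c, fun x z => w.2.1 _ _, fun x y => w.2.2.1 _ _,
    fun x y z t => by
      simp only [hc, LieHom.map_lie]
      exact w.2.2.2 _ _ _ _⟩ : Z3 K (FreeLieAlgebra K X) V)
  exact ⟨b.1, b.2, fun x y z =>
    LinearMap.congr_fun (LinearMap.congr_fun (LinearMap.congr_fun hb x) y) z⟩

end FreeLie

namespace CrossedModule

variable {K : Type u} [Field K]

/-- The crossed module of an equivariant map `μ` from a module, subject to `μ(a)·a = 0`. -/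
def ofRepresentation {F H : Type u} [LieRing F] [LieAlgebra K F] [AddCommGroup H] [Module K H]
    (A : F →ₗ[K] H →ₗ[K] H) (hA : ∀ x y a, A ⁅x, y⁆ a = A x (A y a) - A y (A x a))
    (μ : H →ₗ[K] F) (hμ : ∀ x a, μ (A x a) = ⁅x, μ a⁆) (h₀ : ∀ a, A (μ a) a = 0) :
    CrossedModule K :=
  letI : LieRing H :=
    { bracket := fun a b => A (μ a) b
      add_lie := fun a b c => by
        change A (μ (a + b)) c = A (μ a) c + A (μ b) c
        rw [map_add, map_add, LinearMap.add_apply]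
      lie_add := fun a b c => map_add (A (μ a)) b c
      lie_self := h₀
      leibniz_lie := fun a b c => by
        change A (μ a) (A (μ b) c) = A (μ (A (μ a) b)) c + A (μ b) (A (μ a) c)
        rw [hμ, hA, sub_add_cancel] }
  letI : LieAlgebra K H := { lie_smul := fun r a b => map_smul (A (μ a)) r b }
  { h := H
    g := F
    μ := { μ with map_lie' := hμ _ _ }
    act :=
      { toFun := fun x =>
          { A x with
            leibniz' := fun a b => by
              have hs : ∀ a b, A (μ a) b = - A (μ b) a := fun a b => by
                have h := h₀ (a + b)
                simp only [map_add, LinearMap.add_apply, h₀, zero_add, add_zero] at h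
                exact eq_neg_of_add_eq_zero_right h
              change A x (A (μ a) b) = A (μ a) (A x b) - A (μ b) (A x a)
              rw [hs b (A x a), hμ, hA]
              abel }
        map_add' := fun x y => by
          ext a
          exact LinearMap.congr_fun (map_add A x y) a
        map_smul' := fun r x => by
          ext a
          exact LinearMap.congr_fun (map_smul A r x) a
        map_lie' := fun {x y} => by
          ext a
          exact hA x y a }
    μ_act := hμ
    act_μ := fun _ _ => rfl }

section Realization

variable {F g V : Type u} [LieRing F] [LieAlgebra K F] [LieRing g] [LieAlgebra K g]
  [AddCommGroup V] [Module K V] [LieRingModule g V] [LieModule K g V]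
  (π : F →ₗ⁅K⁆ g) (β : F →ₗ[K] F →ₗ[K] V)

/-- The twisted action on `ker π × V`. -/
def realizationAct : F →ₗ[K] (π.ker × V) →ₗ[K] (π.ker × V) :=
  LinearMap.mk₂ K (fun x p => (⁅x, p.1⁆, ⁅π x, p.2⁆ + β x p.1))
    (fun x y p => by
      simp only [add_lie, map_add, LinearMap.add_apply, Prod.mk_add_mk]; congr 1; abel)
    (fun r x p => by
      simp only [smul_lie, map_smul, LinearMap.smul_apply, Prod.smul_mk, smul_add])
    (fun x p q => by
      simp only [lie_add, Prod.fst_add, Prod.snd_add, LieSubmodule.coe_add, map_add, Prod.mk_add_mk]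
      congr 1; abel)
    (fun r x p => by
      simp only [lie_smul, Prod.smul_fst, Prod.smul_snd, LieSubmodule.coe_smul, map_smul,
        Prod.smul_mk, smul_add])

variable {π β}

/-- The obstruction is the differential of `β` with one argument in `ker π`. It equals `-w` with one
argument zero, hence vanishes. -/
theorem realizationAct_lie {w : Z3 K g V} (h₀ : ∀ x, β x x = 0)
    (h : ∀ x y z, ⁅π x, β y z⁆ - ⁅π y, β x z⁆ + ⁅π z, β x y⁆ - β ⁅x, y⁆ z + β ⁅x, z⁆ y
      - β ⁅y, z⁆ x = - w.1 (π x) (π y) (π z)) (x y : F) (p : π.ker × V) :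
    realizationAct π β ⁅x, y⁆ p =
      realizationAct π β x (realizationAct π β y p) -
        realizationAct π β y (realizationAct π β x p) := by
  have hs : ∀ x y, β x y = - β y x := fun x y => by
    have h := h₀ (x + y)
    simp only [map_add, LinearMap.add_apply, h₀, zero_add, add_zero] at h
    exact eq_neg_of_add_eq_zero_right h
  refine Prod.ext (lie_lie x y p.1) ?_
  change ⁅π ⁅x, y⁆, p.2⁆ + β ⁅x, y⁆ p.1 = ⁅π x, ⁅π y, p.2⁆ + β y p.1⁆ + β x ⁅y, (p.1 : F)⁆
    - (⁅π y, ⁅π x, p.2⁆ + β x p.1⁆ + β y ⁅x, (p.1 : F)⁆)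
  have h₁ := h x y p.1
  have hp : π (p.1 : F) = 0 := LieHom.mem_ker.1 p.1.2
  rw [hp, zero_lie, map_zero, neg_zero, hs ⁅x, (p.1 : F)⁆ y, hs ⁅y, (p.1 : F)⁆ x] at h₁
  rw [LieHom.map_lie, lie_lie, lie_add, lie_add, ← sub_eq_zero, ← neg_eq_zero, ← h₁]
  abel

/-- A primitive of the pullback of a 3-cocycle under a surjection defines a crossed module with
the class of the cocycle. -/
theorem exists_extension_of_primitive (hπ : Function.Surjective π) {w : Z3 K g V}
    (h₀ : ∀ x, β x x = 0)
    (h : ∀ x y z, ⁅π x, β y z⁆ - ⁅π y, β x z⁆ + ⁅π z, β x y⁆ - β ⁅x, y⁆ z + β ⁅x, z⁆ y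
      - β ⁅y, z⁆ x = - w.1 (π x) (π y) (π z)) :
    ∃ M : CrossedExtension K g V, M.cls = Submodule.Quotient.mk w := by
  have hs : ∀ x y, β x y = - β y x := fun x y => by
    have h := h₀ (x + y)
    simp only [map_add, LinearMap.add_apply, h₀, zero_add, add_zero] at h
    exact eq_neg_of_add_eq_zero_right h
  let μ : (π.ker × V) →ₗ[K] F := π.ker.toSubmodule.subtype ∘ₗ LinearMap.fst K _ _
  let X : CrossedModule K := ofRepresentation (realizationAct π β) (realizationAct_lie h₀ h) μ
    (fun _ _ => rfl) (fun p => Prod.ext (lie_self p.1) (by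
      change ⁅π (p.1 : F), p.2⁆ + β p.1 p.1 = 0
      rw [h₀, LieHom.mem_ker.1 p.1.2, zero_lie, add_zero]))
  have hμ : ∀ p : π.ker × V, X.μ p = (p.1 : F) := fun _ => rfl
  let e' : X.Coker →ₗ[K] g := Submodule.liftQ _ (π : F →ₗ[K] g) (by
    rintro _ ⟨p, rfl⟩
    exact (LieHom.mem_ker (f := π)).1 (p : π.ker × V).1.2)
  have he' : ∀ x : F, e' (X.toCoker x) = π x := fun _ => rfl
  have bij : Function.Bijective e' := by
    constructor
    · rw [injective_iff_map_eq_zero]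
      intro c hc
      induction c using Submodule.Quotient.induction_on with | _ x
      exact (X.toCoker_eq_zero_iff x).2 ⟨(⟨x, LieHom.mem_ker.2 hc⟩, 0), rfl⟩
    · intro y
      obtain ⟨x, hx⟩ := hπ y
      exact ⟨X.toCoker x, hx⟩
  let e : X.Coker ≃ₗ⁅K⁆ g :=
    { LinearEquiv.ofBijective e' bij with
      map_lie' := fun {c d} => by
        induction c using Submodule.Quotient.induction_on with | _ x
        induction d using Submodule.Quotient.induction_on with | _ y
        exact LieHom.map_lie π x y }
  have he : ∀ x : F, e (X.toCoker x) = π x := fun _ => rfl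
  let f : X.Ker ≃ₗ[K] V :=
    { toFun := fun v => (v.1 : π.ker × V).2
      map_add' := fun _ _ => rfl
      map_smul' := fun _ _ => rfl
      invFun := fun v => ⟨((0, v) : π.ker × V), rfl⟩
      left_inv := fun v => Subtype.ext (Prod.ext (Subtype.ext v.2.symm) rfl)
      right_inv := fun _ => rfl }
  have hf : ∀ x v, f ⁅x, v⁆ = ⁅e x, f v⁆ := fun c v => by
    induction c using Submodule.Quotient.induction_on with | _ x
    have hv : ((v.1 : π.ker × V).1 : F) = 0 := v.2
    change ⁅π x, (v.1 : π.ker × V).2⁆ + β x ((v.1 : π.ker × V).1 : F) = _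
    rw [hv, map_zero, add_zero]
    rfl
  let p : F →ₗ[K] g := π
  obtain ⟨ρ, hρ⟩ := LinearMap.exists_rightInverse_of_surjective p (LinearMap.range_eq_top.2 hπ)
  have hρ' : ∀ x, π (ρ x) = x := fun x => LinearMap.congr_fun hρ x
  have hmem : ∀ x y, ρ ⁅x, y⁆ - ⁅ρ x, ρ y⁆ ∈ π.ker := fun x y => by
    rw [LieHom.mem_ker, map_sub, LieHom.map_lie, hρ', hρ', hρ', sub_self]
  -- The first component lifts the defect of `ρ` as required. The component `-β (ρ x) (ρ y)` makes
  -- the cocycle equal to minus the differential of `β` at the lifts, which is `w` itself.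
  let b₀ : g →ₗ[K] g →ₗ[K] (π.ker × V) :=
    LinearMap.mk₂ K (fun x y => (⟨ρ ⁅x, y⁆ - ⁅ρ x, ρ y⁆, hmem x y⟩, - β (ρ x) (ρ y)))
      (fun x y z => by
        refine Prod.ext (Subtype.ext ?_) ?_ <;> simp <;> abel)
      (fun r x y => by
        refine Prod.ext (Subtype.ext ?_) ?_ <;> simp [smul_sub])
      (fun x y z => by
        refine Prod.ext (Subtype.ext ?_) ?_ <;> simp <;> abel)
      (fun r x y => by
        refine Prod.ext (Subtype.ext ?_) ?_ <;> simp [smul_sub])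
  let i : X.Coker →ₗ[K] g := e'
  let b : X.Coker →ₗ[K] X.Coker →ₗ[K] X.h := b₀.compl₁₂ i i
  let D : X.SectionData :=
    { ρ := ρ ∘ₗ i
      toCoker_ρ := fun c => bij.1 (hρ' (e' c))
      b := ⟨b, fun c => by
        refine Prod.ext (Subtype.ext ?_) ?_
        · change ρ ⁅e' c, e' c⁆ - ⁅ρ (e' c), ρ (e' c)⁆ = 0
          rw [lie_self, lie_self, map_zero, sub_zero]
        · change - β (ρ (e' c)) (ρ (e' c)) = 0
          rw [h₀, neg_zero]⟩
      μ_b := fun c d => by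
        change ρ ⁅e' c, e' d⁆ - ⁅ρ (e' c), ρ (e' d)⁆ = ρ (e' ⁅c, d⁆) - ⁅ρ (e' c), ρ (e' d)⁆
        rw [show e' ⁅c, d⁆ = ⁅e' c, e' d⁆ from LieEquiv.map_lie e c d] }
  refine ⟨⟨X, e, f, hf⟩, ?_⟩
  change H3.transport e f hf X.triplet.cls = _
  rw [← mk_cocycle_eq_cls D, H3.transport_mk_eq_mk_iff]
  refine ⟨0, fun _ => rfl, fun x y z => ?_⟩
  simp only [LinearMap.zero_apply, lie_zero, sub_zero, add_zero]
  have hl : ∀ c d, e' ⁅c, d⁆ = ⁅e' c, e' d⁆ := fun c d => LieEquiv.map_lie e c d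
  have hD : f (D.cocycle.1 x y z) =
      (⁅π (ρ (e' x)), - β (ρ (e' y)) (ρ (e' z))⁆
        + β (ρ (e' x)) (ρ ⁅e' y, e' z⁆ - ⁅ρ (e' y), ρ (e' z)⁆))
      - (⁅π (ρ (e' y)), - β (ρ (e' x)) (ρ (e' z))⁆
        + β (ρ (e' y)) (ρ ⁅e' x, e' z⁆ - ⁅ρ (e' x), ρ (e' z)⁆))
      + (⁅π (ρ (e' z)), - β (ρ (e' x)) (ρ (e' y))⁆
        + β (ρ (e' z)) (ρ ⁅e' x, e' y⁆ - ⁅ρ (e' x), ρ (e' y)⁆))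
      - - β (ρ (e' ⁅x, y⁆)) (ρ (e' z)) + - β (ρ (e' ⁅x, z⁆)) (ρ (e' y))
      - - β (ρ (e' ⁅y, z⁆)) (ρ (e' x)) := rfl
  have h₁ := h (ρ (e' x)) (ρ (e' y)) (ρ (e' z))
  rw [hD, show w.1 (e x) (e y) (e z) = - - w.1 (π (ρ (e' x))) (π (ρ (e' y))) (π (ρ (e' z))) by
    rw [hρ', hρ', hρ', neg_neg]; rfl, ← h₁]
  simp only [map_sub, hl, lie_neg]
  rw [hs (ρ (e' x)) (ρ ⁅e' y, e' z⁆), hs (ρ (e' y)) (ρ ⁅e' x, e' z⁆),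
    hs (ρ (e' z)) (ρ ⁅e' x, e' y⁆), hs (ρ (e' x)) ⁅ρ (e' y), ρ (e' z)⁆,
    hs (ρ (e' y)) ⁅ρ (e' x), ρ (e' z)⁆, hs (ρ (e' z)) ⁅ρ (e' x), ρ (e' y)⁆]
  abel

end Realization

end CrossedModule

/-- The free Lie algebra on the underlying set of `g` surjects onto `g` and kills the pulled back
class. The primitive is taken for `-w` because the crossed module realizes minus its differential.
-/
theorem CrossedExtension.cls_surjective {K : Type u} [Field K] [CharZero K] {g : Type u}
    [LieRing g] [LieAlgebra K g] {V : Type u} [AddCommGroup V] [Module K V] [LieRingModule g V]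
    [LieModule K g V] : Function.Surjective (cls : CrossedExtension K g V → H3 K g V) := by
  intro c
  obtain ⟨w, rfl⟩ := Submodule.Quotient.mk_surjective _ c
  let π : FreeLieAlgebra K g →ₗ⁅K⁆ g := FreeLieAlgebra.lift K id
  obtain ⟨β, h₀, h⟩ := FreeLie.exists_pullback_primitive π (-w)
  exact CrossedModule.exists_extension_of_primitive
    (fun x => ⟨FreeLieAlgebra.of K x, FreeLieAlgebra.lift_of_apply _ _⟩) h₀ h

end Lie2

namespace Lie2

open LieModule.Cohomology CategoryTheory

/-! ### Strict Lie 2-algebras and crossed modules -/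

namespace StrictLie2

variable {K : Type u} [Field K]

/-- The element of `ker s` with a given underlying arrow. -/
def mkKer (G : StrictLie2 K) (a : G.Arr) (h : G.s a = 0) : G.s.ker := ⟨a, LieHom.mem_ker.2 h⟩

theorem s_ker (G : StrictLie2 K) (a : G.s.ker) : G.s (a : G.Arr) = 0 := LieHom.mem_ker.1 a.2

/-- The arrow part of an arrow. -/
def arrPart (G : StrictLie2 K) : G.Arr →ₗ[K] G.s.ker where
  toFun a := G.mkKer (a - G.i (G.s a)) (by rw [map_sub, G.s_i, sub_self])
  map_add' a b := Subtype.ext (by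
    change a + b - G.i (G.s (a + b)) = (a - G.i (G.s a)) + (b - G.i (G.s b))
    rw [map_add, map_add]; abel)
  map_smul' r a := Subtype.ext (by
    change r • a - G.i (G.s (r • a)) = r • (a - G.i (G.s a))
    rw [map_smul, map_smul, smul_sub])

theorem coe_arrPart (G : StrictLie2 K) (a : G.Arr) :
    (G.arrPart a : G.Arr) = a - G.i (G.s a) := rfl

theorem arrPart_ker (G : StrictLie2 K) (a : G.s.ker) : G.arrPart a = a :=
  Subtype.ext (by rw [coe_arrPart, G.s_ker, map_zero, sub_zero])

theorem arrPart_i (G : StrictLie2 K) (x : G.Obj) : G.arrPart (G.i x) = 0 :=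
  Subtype.ext (by rw [coe_arrPart, G.s_i, sub_self]; rfl)

theorem arrow_eq (G : StrictLie2 K) (a : G.Arr) : a = G.i (G.s a) + G.arrPart a := by
  rw [coe_arrPart]; abel

variable {G H : StrictLie2 K}

theorem Hom.f₁_eq (F : Hom G H) (a : G.Arr) :
    F.f₁ a = H.i (F.f₀ (G.s a)) + F.f₁ (G.arrPart a : G.Arr) := by
  rw [← F.f₁_i, ← map_add, ← G.arrow_eq]

/-- The morphism of strict Lie 2-algebras extending a morphism of crossed modules. -/
def homOfCrossed (F : G.toCrossedModule ⟶ H.toCrossedModule) : Hom G H :=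
  let φ : G.s.ker →ₗ⁅K⁆ H.s.ker := CrossedModule.Hom.φ F
  let ψ : G.Obj →ₗ⁅K⁆ H.Obj := CrossedModule.Hom.ψ F
  have ht : ∀ a : G.s.ker, ψ (G.t a) = H.t (φ a) := fun a => CrossedModule.Hom.comm F a
  let A : G.Obj → G.s.ker → G.s.ker := fun x a => G.toCrossedModule.act x a
  have hφ : ∀ x a, (φ (A x a) : H.Arr) = ⁅H.i (ψ x), (φ a : H.Arr)⁆ :=
    fun x a => congrArg Subtype.val (CrossedModule.Hom.map_act F x a)
  have hb : ∀ a b : G.s.ker, (φ ⁅a, b⁆ : H.Arr) = ⁅(φ a : H.Arr), (φ b : H.Arr)⁆ :=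
    fun a b => congrArg Subtype.val (LieHom.map_lie φ a b)
  -- In terms of sources and arrow parts the bracket of arrows is that of a semidirect sum, which a
  -- morphism of crossed modules preserves.
  have hp : ∀ f g : G.Arr, G.arrPart ⁅f, g⁆ = ⁅G.arrPart f, G.arrPart g⁆
      + A (G.s f) (G.arrPart g) - A (G.s g) (G.arrPart f) := fun f g => Subtype.ext (by
    change ⁅f, g⁆ - G.i (G.s ⁅f, g⁆) = ⁅f - G.i (G.s f), g - G.i (G.s g)⁆
      + ⁅G.i (G.s f), g - G.i (G.s g)⁆ - ⁅G.i (G.s g), f - G.i (G.s f)⁆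
    simp only [LieHom.map_lie, lie_sub, sub_lie]
    rw [← lie_skew (G.i (G.s g)) f, ← lie_skew (G.i (G.s g)) (G.i (G.s f))]
    abel)
  { f₀ := ψ
    f₁ :=
      { toFun := fun a => H.i (ψ (G.s a)) + (φ (G.arrPart a) : H.Arr)
        map_add' := fun a b => by
          simp only [map_add, LieSubmodule.coe_add]
          abel
        map_smul' := fun r a => by
          simp only [map_smul, LieSubmodule.coe_smul, smul_add, RingHom.id_apply]
        map_lie' := fun {a b} => by
          rw [hp, map_sub, map_add, LieHom.map_lie, LieSubmodule.coe_sub, LieSubmodule.coe_add, hb]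
          rw [hφ, hφ]
          simp only [LieHom.map_lie, lie_add, add_lie]
          rw [← lie_skew (φ (G.arrPart a) : H.Arr) (H.i (ψ (G.s b)))]
          abel }
    s_f₁ := fun a => by
      change H.s (H.i (ψ (G.s a)) + (φ (G.arrPart a) : H.Arr)) = _
      rw [map_add, H.s_i, H.s_ker, add_zero]
    t_f₁ := fun a => by
      change H.t (H.i (ψ (G.s a)) + (φ (G.arrPart a) : H.Arr)) = ψ (G.t a)
      rw [map_add, H.t_i, ← ht, ← map_add, coe_arrPart, map_sub, G.t_i]
      congr 1
      abel
    f₁_i := fun x => by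
      change H.i (ψ (G.s (G.i x))) + (φ (G.arrPart (G.i x)) : H.Arr) = _
      rw [G.s_i, G.arrPart_i, map_zero]
      exact add_zero _
    f₁_m := fun p h => by
      rw [H.m_eq, G.m_eq]
      change H.i (ψ (G.s _)) + (φ (G.arrPart _) : H.Arr) =
        (H.i (ψ (G.s p.1.1)) + (φ (G.arrPart p.1.1) : H.Arr))
        + (H.i (ψ (G.s p.1.2)) + (φ (G.arrPart p.1.2) : H.Arr))
        - H.i (H.s (H.i (ψ (G.s p.1.2)) + (φ (G.arrPart p.1.2) : H.Arr)))
      simp only [map_add, map_sub, G.s_i, G.arrPart_i, H.s_i, H.s_ker, map_zero,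
        LieSubmodule.coe_add, sub_zero, add_zero]
      abel }

theorem map_homOfCrossed (F : G.toCrossedModule ⟶ H.toCrossedModule) :
    (crossedModuleFunctor K).map (homOfCrossed F : G ⟶ H) = F := by
  refine CrossedModule.Hom.ext (LieHom.ext fun (a : G.s.ker) => Subtype.ext ?_) rfl
  let φ : G.s.ker →ₗ⁅K⁆ H.s.ker := CrossedModule.Hom.φ F
  let ψ : G.Obj →ₗ⁅K⁆ H.Obj := CrossedModule.Hom.ψ F
  change H.i (ψ (G.s a)) + (φ (G.arrPart a) : H.Arr) = φ a
  rw [G.s_ker, map_zero, map_zero, zero_add, G.arrPart_ker]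

instance : (crossedModuleFunctor K).Full where
  map_surjective F := ⟨homOfCrossed F, map_homOfCrossed F⟩

instance : (crossedModuleFunctor K).Faithful where
  map_injective {G H F F'} h := by
    have h₀ : F.f₀ = F'.f₀ := congrArg CrossedModule.Hom.ψ h
    refine Hom.ext h₀ (LieHom.ext fun a => ?_)
    have h₁ : ∀ a : G.s.ker, F.f₁ a = F'.f₁ a := fun a =>
      congrArg Subtype.val (LieHom.congr_fun (congrArg CrossedModule.Hom.φ h) a)
    rw [Hom.f₁_eq F, Hom.f₁_eq F', h₀, h₁]

theorem TwoHom.toCrossed_bijective (F F' : G ⟶ H) :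
    Function.Bijective (TwoHom.toCrossed (F := F) (F' := F')) := by
  constructor
  · intro τ τ' h
    refine TwoHom.ext (LieHom.ext fun x => ?_)
    have h₁ : (τ.τ x - H.i (F.f₀ x) : H.Arr) = τ'.τ x - H.i (F.f₀ x) :=
      congrArg Subtype.val (LinearMap.congr_fun (congrArg CrossedModule.TwoHom.η h) x)
    exact sub_left_injective h₁
  · intro η
    let e : G.Obj →ₗ[K] H.s.ker := η.η
    have ht : ∀ x, H.t (e x) = F'.f₀ x - F.f₀ x := η.μ_η
    have hker : ∀ a : G.s.ker, (e (G.t a) : H.Arr) = F'.f₁ a - F.f₁ a :=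
      fun a => congrArg Subtype.val (η.η_μ a)
    have hlie : ∀ x y, (e ⁅x, y⁆ : H.Arr) = ⁅H.i (F.f₀ x), (e y : H.Arr)⁆
        - ⁅H.i (F.f₀ y), (e x : H.Arr)⁆ + ⁅(e x : H.Arr), (e y : H.Arr)⁆ :=
      fun x y => congrArg Subtype.val (η.η_lie x y)
    -- The inverse construction restores the identity of `F.f₀ x` to the arrow part; the homotopy
    -- law is what makes the result a Lie homomorphism.
    let τ : G.Obj →ₗ⁅K⁆ H.Arr :=
      { toFun := fun x => (e x : H.Arr) + H.i (F.f₀ x)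
        map_add' := fun x y => by
          simp only [map_add, LieSubmodule.coe_add]
          abel
        map_smul' := fun r x => by
          simp only [map_smul, LieSubmodule.coe_smul, smul_add, RingHom.id_apply]
        map_lie' := fun {x y} => by
          rw [hlie]
          simp only [LieHom.map_lie, lie_add, add_lie]
          rw [← lie_skew (e x : H.Arr) (H.i (F.f₀ y))]
          abel }
    refine ⟨⟨τ, ?_, ?_, ?_⟩, ?_⟩
    · intro x
      change H.s ((e x : H.Arr) + H.i (F.f₀ x)) = F.f₀ x
      rw [map_add, H.s_i, H.s_ker, zero_add]
    · intro x
      change H.t ((e x : H.Arr) + H.i (F.f₀ x)) = F'.f₀ x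
      rw [map_add, H.t_i, ht, sub_add_cancel]
    · intro a h₁ h₂
      rw [H.m_eq, H.m_eq]
      change F.f₁ a + ((e (G.t a) : H.Arr) + H.i (F.f₀ (G.t a)))
          - H.i (H.s ((e (G.t a) : H.Arr) + H.i (F.f₀ (G.t a)))) =
        ((e (G.s a) : H.Arr) + H.i (F.f₀ (G.s a))) + F'.f₁ a - H.i (H.s (F'.f₁ a))
      -- Splitting `a` into identity and arrow part reduces naturality to `η_μ` on `ker s`.
      have h₃ : (e (G.t a) : H.Arr) = e (G.s a) + e (G.t (G.arrPart a : G.Arr)) := by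
        rw [coe_arrPart, map_sub, G.t_i, ← LieSubmodule.coe_add, ← map_add]
        congr 2
        abel
      rw [map_add, H.s_ker, H.s_i, h₃, hker, F'.s_f₁, Hom.f₁_eq F a, Hom.f₁_eq F' a, zero_add]
      abel
    · refine CrossedModule.TwoHom.ext (LinearMap.ext fun (x : G.Obj) => Subtype.ext ?_)
      change (e x : H.Arr) + H.i (F.f₀ x) - H.i (F.f₀ x) = e x
      abel

end StrictLie2

end Lie2

/-! ### From crossed modules back to strict Lie 2-algebras -/

namespace Lie2

open LieModule.Cohomology CategoryTheory

namespace CrossedModule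

variable {K : Type u} [Field K]

/-- The strict Lie 2-algebra of a crossed module, with arrows the semidirect sum. -/
def toStrict (X : CrossedModule K) : StrictLie2 K where
  Obj := X.g
  Arr := LieAlgebra.SemiDirectSum X.h X.g X.act
  s := LieAlgebra.SemiDirectSum.projr X.act
  t :=
    { toFun := fun a => X.μ a.left + a.right
      map_add' := fun a b => by
        change X.μ (a.left + b.left) + (a.right + b.right) = _
        rw [map_add]
        abel
      map_smul' := fun r a => by
        change X.μ (r • a.left) + r • a.right = r • (X.μ a.left + a.right)
        rw [map_smul, smul_add]
      map_lie' := fun {a b} => by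
        change X.μ (⁅a.left, b.left⁆ + X.act a.right b.left - X.act b.right a.left)
          + ⁅a.right, b.right⁆ = ⁅X.μ a.left + a.right, X.μ b.left + b.right⁆
        rw [map_sub, map_add, X.μ_act, X.μ_act, LieHom.map_lie, add_lie, lie_add, lie_add,
          ← lie_skew b.right]
        abel }
  i := LieAlgebra.SemiDirectSum.inr X.act
  m :=
    { toFun := fun p => ⟨p.1.1.left + p.1.2.left, p.1.1.right⟩
      map_add' := fun p q => by
        refine LieAlgebra.SemiDirectSum.ext ?_ rfl
        change (p.1.1.left + q.1.1.left) + (p.1.2.left + q.1.2.left) =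
          (p.1.1.left + p.1.2.left) + (q.1.1.left + q.1.2.left)
        abel
      map_smul' := fun r p => LieAlgebra.SemiDirectSum.ext (smul_add r _ _).symm rfl
      map_lie' := fun {p q} => by
        have hp : X.μ p.1.1.left + p.1.1.right = p.1.2.right := p.2
        have hq : X.μ q.1.1.left + q.1.1.right = q.1.2.right := q.2
        refine LieAlgebra.SemiDirectSum.ext ?_ rfl
        change (⁅p.1.1.left, q.1.1.left⁆ + X.act p.1.1.right q.1.1.left
            - X.act q.1.1.right p.1.1.left)
          + (⁅p.1.2.left, q.1.2.left⁆ + X.act p.1.2.right q.1.2.left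
            - X.act q.1.2.right p.1.2.left) =
          ⁅p.1.1.left + p.1.2.left, q.1.1.left + q.1.2.left⁆
            + X.act p.1.1.right (q.1.1.left + q.1.2.left)
            - X.act q.1.1.right (p.1.1.left + p.1.2.left)
        -- By composability the second arrows start at `μ(left) + right` of the first ones.
        -- Boundaries act by inner derivations, which supplies the mixed brackets of the left
        -- components.
        rw [← hp, ← hq]
        simp only [map_add, LieDerivation.add_apply, X.act_μ, add_lie, lie_add]
        rw [← lie_skew p.1.2.left q.1.1.left]
        abel }
  s_i _ := rfl
  t_i x := by
    change X.μ 0 + x = x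
    rw [map_zero, zero_add]
  s_m _ := rfl
  t_m p := by
    have hp : X.μ p.1.1.left + p.1.1.right = p.1.2.right := p.2
    change X.μ (p.1.1.left + p.1.2.left) + p.1.1.right = X.μ p.1.2.left + p.1.2.right
    rw [← hp, map_add]
    abel
  id_m f _ := LieAlgebra.SemiDirectSum.ext (zero_add f.left) rfl
  m_id f _ := LieAlgebra.SemiDirectSum.ext (add_zero f.left) rfl
  assoc p q h _ _ := by
    refine LieAlgebra.SemiDirectSum.ext ?_ rfl
    change p.1.1.left + p.1.2.left + q.1.2.left = p.1.1.left + (q.1.1.left + q.1.2.left)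
    rw [h, add_assoc]

/-- The crossed module of the strict Lie 2-algebra of `X` is `X`. -/
def toStrictIso (X : CrossedModule K) : X.toStrict.toCrossedModule ≅ X where
  hom :=
    { φ :=
        { toFun := fun (a : X.toStrict.s.ker) =>
            ((a : X.toStrict.Arr) : LieAlgebra.SemiDirectSum X.h X.g X.act).left
          map_add' := fun _ _ => rfl
          map_smul' := fun _ _ => rfl
          map_lie' := fun {a b} => by
            let a' : LieAlgebra.SemiDirectSum X.h X.g X.act := (a : X.toStrict.s.ker).1
            let b' : LieAlgebra.SemiDirectSum X.h X.g X.act := (b : X.toStrict.s.ker).1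
            have ha : a'.right = 0 := X.toStrict.s_ker a
            have hb : b'.right = 0 := X.toStrict.s_ker b
            change ⁅a'.left, b'.left⁆ + X.act a'.right b'.left - X.act b'.right a'.left =
              ⁅a'.left, b'.left⁆
            rw [ha, hb, map_zero, LieDerivation.zero_apply, LieDerivation.zero_apply, add_zero,
              sub_zero] }
      ψ := (LieHom.id : X.g →ₗ⁅K⁆ X.g)
      comm := fun (a : X.toStrict.s.ker) => by
        let a' : LieAlgebra.SemiDirectSum X.h X.g X.act := (a : X.toStrict.s.ker).1
        have ha : a'.right = 0 := X.toStrict.s_ker a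
        change X.μ a'.left + a'.right = X.μ a'.left
        rw [ha, add_zero]
      map_act := fun (x : X.g) (a : X.toStrict.s.ker) => by
        let a' : LieAlgebra.SemiDirectSum X.h X.g X.act := (a : X.toStrict.s.ker).1
        have ha : a'.right = 0 := X.toStrict.s_ker a
        change ⁅(0 : X.h), a'.left⁆ + X.act x a'.left - X.act a'.right 0 = X.act x a'.left
        rw [zero_lie, map_zero, zero_add, sub_zero] }
  inv :=
    { φ :=
        { toFun := fun a => X.toStrict.mkKer (LieAlgebra.SemiDirectSum.inl X.act a) rfl
          map_add' := fun a b => Subtype.ext (map_add (LieAlgebra.SemiDirectSum.inl X.act) a b)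
          map_smul' := fun r a => Subtype.ext (map_smul (LieAlgebra.SemiDirectSum.inl X.act) r a)
          map_lie' := fun {a b} =>
            Subtype.ext (LieHom.map_lie (LieAlgebra.SemiDirectSum.inl X.act) a b) }
      ψ := (LieHom.id : X.g →ₗ⁅K⁆ X.g)
      comm := fun a => (add_zero (X.μ a)).symm
      map_act := fun x a => Subtype.ext (by
        refine LieAlgebra.SemiDirectSum.ext ?_ ?_
        · change X.act x a = ⁅(0 : X.h), a⁆ + X.act x a - X.act 0 0
          rw [zero_lie, map_zero, zero_add, sub_zero]
        · exact (lie_zero x).symm) }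
  hom_inv_id := Hom.ext (LieHom.ext fun (a : X.toStrict.s.ker) => Subtype.ext
    (LieAlgebra.SemiDirectSum.ext rfl (X.toStrict.s_ker a).symm)) rfl
  inv_hom_id := rfl

end CrossedModule

namespace StrictLie2

variable (K : Type u) [Field K]

instance : (crossedModuleFunctor K).EssSurj where
  mem_essImage X := ⟨X.toStrict, ⟨X.toStrictIso⟩⟩

theorem crossedModuleFunctor_isEquivalence : (crossedModuleFunctor K).IsEquivalence where

end StrictLie2

namespace CrossedModule

variable {K : Type u} [Field K]

/-! ### Weak morphisms of crossed modules -/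

/-- A weak morphism of crossed modules. -/
structure WeakHom (X Y : CrossedModule K) where
  F₀ : X.g →ₗ[K] Y.g
  F₁ : X.h →ₗ[K] Y.h
  F₂ : X.g →ₗ[K] X.g →ₗ[K] Y.h
  F₂_self : ∀ x, F₂ x x = 0
  μ_F₁ : ∀ a, Y.μ (F₁ a) = F₀ (X.μ a)
  μ_F₂ : ∀ x y, Y.μ (F₂ x y) = F₀ ⁅x, y⁆ - ⁅F₀ x, F₀ y⁆
  F₁_act : ∀ x a, F₁ (X.act x a) = Y.act (F₀ x) (F₁ a) + F₂ x (X.μ a)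
  coh : ∀ x y z, Y.act (F₀ x) (F₂ y z) - Y.act (F₀ y) (F₂ x z) + Y.act (F₀ z) (F₂ x y)
    - F₂ ⁅x, y⁆ z + F₂ ⁅x, z⁆ y - F₂ ⁅y, z⁆ x = 0

namespace WeakHom

variable {X Y : CrossedModule K} (W : WeakHom X Y)

theorem F₂_skew (x y : X.g) : W.F₂ x y = - W.F₂ y x := by
  have h := W.F₂_self (x + y)
  simp only [map_add, LinearMap.add_apply, W.F₂_self, zero_add, add_zero] at h
  exact eq_neg_of_add_eq_zero_right h

theorem act_act (x y : X.g) (b : Y.h) : Y.act (W.F₀ x) (Y.act (W.F₀ y) b) =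
    Y.act (W.F₀ y) (Y.act (W.F₀ x) b) + Y.act (W.F₀ ⁅x, y⁆) b - ⁅W.F₂ x y, b⁆ := by
  rw [← Y.act_μ, W.μ_F₂, map_sub, LieDerivation.sub_apply, Y.act_lie]
  abel

/-- The extension of `X.g` by `Y.h` attached to a weak morphism. -/
@[ext] structure Total (W : WeakHom X Y) : Type u where
  fst : Y.h
  snd : X.g

variable {W}

/-- The underlying product. -/
def Total.equiv : W.Total ≃ Y.h × X.g where
  toFun z := (z.fst, z.snd)
  invFun p := ⟨p.1, p.2⟩
  left_inv _ := rfl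
  right_inv _ := rfl

instance : AddCommGroup W.Total := Total.equiv.addCommGroup

instance : Module K W.Total := Total.equiv.module K

@[simp] theorem Total.fst_add (z w : W.Total) : (z + w).fst = z.fst + w.fst := rfl
@[simp] theorem Total.snd_add (z w : W.Total) : (z + w).snd = z.snd + w.snd := rfl
@[simp] theorem Total.fst_smul (r : K) (z : W.Total) : (r • z).fst = r • z.fst := rfl
@[simp] theorem Total.snd_smul (r : K) (z : W.Total) : (r • z).snd = r • z.snd := rfl

instance : Bracket W.Total W.Total where
  bracket z w := ⟨⁅z.fst, w.fst⁆ + Y.act (W.F₀ z.snd) w.fst - Y.act (W.F₀ w.snd) z.fst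
    - W.F₂ z.snd w.snd, ⁅z.snd, w.snd⁆⟩

@[simp] theorem Total.fst_lie (z w : W.Total) : ⁅z, w⁆.fst = ⁅z.fst, w.fst⁆
    + Y.act (W.F₀ z.snd) w.fst - Y.act (W.F₀ w.snd) z.fst - W.F₂ z.snd w.snd := rfl
@[simp] theorem Total.snd_lie (z w : W.Total) : ⁅z, w⁆.snd = ⁅z.snd, w.snd⁆ := rfl

/-- A nonabelian extension with factor set `-F₂`. `F₀` is a homomorphism only up to `μ F₂`, so the
action of `X.g` on `Y.h` is a representation up to inner derivations by `F₂`, and `coh` is the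
factor set identity. -/
instance : LieRing W.Total where
  add_lie z w v := by
    refine Total.ext ?_ ?_ <;> simp
    abel
  lie_add z w v := by
    refine Total.ext ?_ ?_ <;> simp
    abel
  lie_self z := by
    refine Total.ext ?_ (lie_self z.snd)
    rw [Total.fst_lie, lie_self, zero_add, sub_self, W.F₂_self, sub_zero]
    rfl
  leibniz_lie z w v := by
    refine Total.ext ?_ (leibniz_lie z.snd w.snd v.snd)
    simp only [Total.fst_lie, Total.fst_add, Total.snd_lie, map_add, map_sub, lie_add, lie_sub,
      add_lie, sub_lie, act_lie_apply]
    have h := W.coh z.snd w.snd v.snd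
    rw [leibniz_lie z.fst w.fst v.fst, W.act_act z.snd w.snd v.fst, W.act_act z.snd v.snd w.fst,
      W.act_act w.snd v.snd z.fst, W.F₂_skew z.snd ⁅w.snd, v.snd⁆, W.F₂_skew w.snd ⁅z.snd, v.snd⁆,
      ← lie_skew z.fst (W.F₂ w.snd v.snd), ← lie_skew w.fst (W.F₂ z.snd v.snd),
      ← lie_skew w.fst (Y.act (W.F₀ v.snd) z.fst), ← lie_skew w.fst (Y.act (W.F₀ z.snd) v.fst),
      ← lie_skew v.fst (Y.act (W.F₀ z.snd) w.fst), ← lie_skew v.fst (Y.act (W.F₀ w.snd) z.fst),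
      ← sub_eq_zero, ← neg_eq_zero, ← h]
    abel

instance : LieAlgebra K W.Total where
  lie_smul r z w := by
    refine Total.ext ?_ ?_
    · simp [smul_sub, smul_add]
    · simp

end WeakHom

end CrossedModule

end Lie2

/-! ### The butterfly span of a weak morphism -/

namespace Lie2

open LieModule.Cohomology CategoryTheory

namespace CrossedModule

variable {K : Type u} [Field K]

namespace WeakHom

variable {X Y : CrossedModule K} (W : WeakHom X Y)

/-- The projection of the total extension to the source. -/
def toSource : W.Total →ₗ⁅K⁆ X.g where
  toFun z := z.snd
  map_add' _ _ := rfl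
  map_smul' _ _ := rfl
  map_lie' := rfl

/-- The projection of the total extension to the target. -/
def toTarget : W.Total →ₗ⁅K⁆ Y.g where
  toFun z := Y.μ z.fst + W.F₀ z.snd
  map_add' z w := by
    simp only [Total.fst_add, Total.snd_add, map_add]
    abel
  map_smul' r z := by
    simp only [Total.fst_smul, Total.snd_smul, map_smul, smul_add, RingHom.id_apply]
  map_lie' {z w} := by
    simp only [Total.fst_lie, Total.snd_lie, map_add, map_sub, LieHom.map_lie, Y.μ_act, W.μ_F₂,
      add_lie, lie_add]
    rw [← lie_skew (W.F₀ w.snd)]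
    abel

/-- The boundary map of the apex of the span of a weak morphism. -/
def boundary : (X.h × Y.h) →ₗ⁅K⁆ W.Total where
  toFun a := ⟨a.2 - W.F₁ a.1, X.μ a.1⟩
  map_add' a b := by
    refine Total.ext ?_ (map_add X.μ a.1 b.1)
    change a.2 + b.2 - W.F₁ (a.1 + b.1) = a.2 - W.F₁ a.1 + (b.2 - W.F₁ b.1)
    rw [map_add]
    abel
  map_smul' r a := by
    refine Total.ext ?_ (map_smul X.μ r a.1)
    change r • a.2 - W.F₁ (r • a.1) = r • (a.2 - W.F₁ a.1)
    rw [map_smul, smul_sub]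
  map_lie' {a b} := by
    refine Total.ext ?_ (LieHom.map_lie X.μ a.1 b.1)
    change ⁅a.2, b.2⁆ - W.F₁ ⁅a.1, b.1⁆ = ⁅a.2 - W.F₁ a.1, b.2 - W.F₁ b.1⁆
      + Y.act (W.F₀ (X.μ a.1)) (b.2 - W.F₁ b.1) - Y.act (W.F₀ (X.μ b.1)) (a.2 - W.F₁ a.1)
      - W.F₂ (X.μ a.1) (X.μ b.1)
    rw [← X.act_μ, W.F₁_act, ← W.μ_F₁, ← W.μ_F₁, Y.act_μ, Y.act_μ, Y.act_μ]
    simp only [lie_sub, sub_lie]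
    rw [← lie_skew (W.F₁ b.1) a.2, ← lie_skew (W.F₁ b.1) (W.F₁ a.1)]
    abel

/-- The apex of the span of strict morphisms attached to a weak morphism. -/
def apex : CrossedModule K where
  h := X.h × Y.h
  g := W.Total
  μ := W.boundary
  act :=
    { toFun := fun z =>
        { toFun := fun a => (X.act z.snd a.1, Y.act (W.toTarget z) a.2)
          map_add' := fun a b => Prod.ext (map_add _ _ _) (map_add _ _ _)
          map_smul' := fun r a => Prod.ext (map_smul _ r _) (map_smul _ r _)
          leibniz' := fun a b => Prod.ext ((X.act z.snd).leibniz' a.1 b.1)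
            ((Y.act (W.toTarget z)).leibniz' a.2 b.2) }
      map_add' := fun z w => by
        refine LieDerivation.ext fun a => Prod.ext ?_ ?_
        · change X.act (z.snd + w.snd) a.1 = X.act z.snd a.1 + X.act w.snd a.1
          rw [map_add, LieDerivation.add_apply]
        · change Y.act (W.toTarget (z + w)) a.2 =
            Y.act (W.toTarget z) a.2 + Y.act (W.toTarget w) a.2
          rw [map_add, map_add, LieDerivation.add_apply]
      map_smul' := fun r z => by
        refine LieDerivation.ext fun a => Prod.ext ?_ ?_
        · change X.act (r • z.snd) a.1 = r • X.act z.snd a.1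
          rw [map_smul, LieDerivation.smul_apply]
        · change Y.act (W.toTarget (r • z)) a.2 = r • Y.act (W.toTarget z) a.2
          rw [map_smul, map_smul, LieDerivation.smul_apply]
      map_lie' := fun {z w} => by
        refine LieDerivation.ext fun a => ?_
        rw [LieDerivation.commutator_apply]
        refine Prod.ext (X.act_lie z.snd w.snd a.1) ?_
        change Y.act (W.toTarget ⁅z, w⁆) a.2 = Y.act (W.toTarget z) (Y.act (W.toTarget w) a.2)
          - Y.act (W.toTarget w) (Y.act (W.toTarget z) a.2)
        rw [LieHom.map_lie, Y.act_lie] }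
  μ_act z a := by
    refine Total.ext ?_ (X.μ_act z.snd a.1)
    change Y.act (Y.μ z.fst + W.F₀ z.snd) a.2 - W.F₁ (X.act z.snd a.1) = ⁅z.fst, a.2 - W.F₁ a.1⁆
      + Y.act (W.F₀ z.snd) (a.2 - W.F₁ a.1) - Y.act (W.F₀ (X.μ a.1)) z.fst
      - W.F₂ z.snd (X.μ a.1)
    rw [W.F₁_act, ← W.μ_F₁, Y.act_μ, map_add, LieDerivation.add_apply, Y.act_μ, lie_sub, map_sub,
      ← lie_skew z.fst (W.F₁ a.1)]
    abel
  act_μ a b := by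
    refine Prod.ext (X.act_μ a.1 b.1) ?_
    change Y.act (Y.μ (a.2 - W.F₁ a.1) + W.F₀ (X.μ a.1)) b.2 = ⁅a.2, b.2⁆
    rw [map_sub, W.μ_F₁, sub_add_cancel, Y.act_μ]

/-- The left leg of the span of a weak morphism. -/
def left : W.apex ⟶ X where
  φ := LieHom.mk (LinearMap.fst K X.h Y.h) rfl
  ψ := W.toSource
  comm _ := rfl
  map_act _ _ := rfl

/-- The right leg of the span of a weak morphism. -/
def right : W.apex ⟶ Y where
  φ := LieHom.mk (LinearMap.snd K X.h Y.h) rfl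
  ψ := W.toTarget
  comm a := by
    change Y.μ (a.2 - W.F₁ a.1) + W.F₀ (X.μ a.1) = Y.μ a.2
    rw [map_sub, W.μ_F₁, sub_add_cancel]
  map_act _ _ := rfl

/-- If `z` lies over `μ a`, it is the boundary of `(a, z.fst + F₁ a)`. Thus passing to the cokernel
removes all of `Y.h` and leaves the cokernel of `X`. -/
theorem bijective_cokerMap_left : Function.Bijective (cokerMap W.left) := by
  constructor
  · rw [injective_iff_map_eq_zero]
    intro c hc
    induction c using Submodule.Quotient.induction_on with | _ z
    obtain ⟨a, ha⟩ := (X.toCoker_eq_zero_iff _).1 hc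
    refine (W.apex.toCoker_eq_zero_iff z).2 ⟨((a, (z : W.Total).fst + W.F₁ a) : X.h × Y.h), ?_⟩
    exact Total.ext (add_sub_cancel_right _ _) ha
  · intro c
    induction c using Submodule.Quotient.induction_on with | _ x
    exact ⟨W.apex.toCoker (⟨0, x⟩ : W.Total), rfl⟩

/-- The kernel of the boundary is the graph of `F₁` over `ker μ`; hence the left leg is bijective on
kernels and the right leg is `F₁`. -/
theorem snd_ker (v : W.apex.Ker) : (v.1 : X.h × Y.h).2 = W.F₁ (v.1 : X.h × Y.h).1 :=
  sub_eq_zero.1 (congrArg Total.fst (v.2 : W.boundary v.1 = 0))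

theorem bijective_kerMap_left : Function.Bijective (kerMap W.left) := by
  constructor
  · intro v w h
    have h₁ : (v.1 : X.h × Y.h).1 = (w.1 : X.h × Y.h).1 := congrArg Subtype.val h
    refine Subtype.ext (Prod.ext h₁ ?_)
    rw [W.snd_ker, W.snd_ker, h₁]
  · intro v
    refine ⟨⟨((v.1, W.F₁ v.1) : X.h × Y.h), ?_⟩, rfl⟩
    change W.boundary (v.1, W.F₁ v.1) = 0
    exact Total.ext (sub_self _) v.2

theorem cokerMap_right_eq (e : X.Coker → Y.Coker) (he : ∀ x, e (X.toCoker x) = Y.toCoker (W.F₀ x))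
    (c : W.apex.Coker) : cokerMap W.right c = e (cokerMap W.left c) := by
  induction c using Submodule.Quotient.induction_on with | _ z
  refine Eq.trans ?_ (he _).symm
  refine sub_eq_zero.1 ((Y.toCoker_eq_zero_iff (W.toTarget z - W.F₀ (z : W.Total).snd)).2
    ⟨(z : W.Total).fst, ?_⟩)
  exact (add_sub_cancel_right (Y.μ (z : W.Total).fst) (W.F₀ (z : W.Total).snd)).symm

theorem kerMap_right_eq (f : X.Ker → Y.Ker) (hf : ∀ v, (f v : Y.h) = W.F₁ v)
    (v : W.apex.Ker) : kerMap W.right v = f (kerMap W.left v) :=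
  Subtype.ext ((W.snd_ker v).trans (hf (kerMap W.left v)).symm)

end WeakHom

end CrossedModule

namespace StrictLie2

open CrossedModule

variable {K : Type u} [Field K]

/-- A homomorphism of strict Lie 2-algebras, regarded as semi-strict ones, as a weak morphism of
crossed modules. -/
def weakHom {G H : StrictLie2 K} (F : SemistrictLie2.Hom G.toSemistrict H.toSemistrict) :
    WeakHom G.toCrossedModule H.toCrossedModule where
  F₀ := F.f₀
  F₁ := (H.kerEquiv : H.toSemistrict.Ker →ₗ[K] H.toCrossedModule.h) ∘ₗ F.k₁ ∘ₗ
    (G.kerEquiv.symm : G.toCrossedModule.h →ₗ[K] G.toSemistrict.Ker)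
  F₂ := F.k₂.compr₂ (H.kerEquiv : H.toSemistrict.Ker →ₗ[K] H.toCrossedModule.h)
  F₂_self x := (congrArg H.kerEquiv (F.k₂_self x)).trans (map_zero _)
  μ_F₁ a := F.d_k₁ (G.kerEquiv.symm a)
  μ_F₂ x y := F.d_k₂ x y
  F₁_act x a := congrArg H.kerEquiv (F.k₁_act x (G.kerEquiv.symm a))
  coh x y z := by
    have h := F.k₁_l₃ x y z
    rw [show G.toSemistrict.l₃ x y z = 0 from G.toSemistrict_l₃ _ _ _,
      show H.toSemistrict.l₃ (F.f₀ x) (F.f₀ y) (F.f₀ z) = 0 from H.toSemistrict_l₃ _ _ _,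
      map_zero, zero_add] at h
    exact congrArg H.kerEquiv h.symm

end StrictLie2

/-! ### Classification of crossed modules -/

namespace CrossedModule

variable {K : Type u} [Field K]

theorem bijective_cokerMap_of_iso {X Y : CrossedModule K} (κ : X ≅ Y) :
    Function.Bijective (cokerMap κ.hom) := by
  have hc : ∀ {X Y Z : CrossedModule K} (F : X ⟶ Y) (F' : Y ⟶ Z) c,
      cokerMap F' (cokerMap F c) = cokerMap (F ≫ F') c := fun F F' c => by
    induction c using Submodule.Quotient.induction_on with | _ x
    rfl
  have hid : ∀ {X : CrossedModule K} c, cokerMap (𝟙 X) c = c := fun c => by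
    induction c using Submodule.Quotient.induction_on with | _ x
    rfl
  refine Function.bijective_iff_has_inverse.2 ⟨cokerMap κ.inv, fun c => ?_, fun c => ?_⟩
  · rw [hc, κ.hom_inv_id, hid]
  · rw [hc, κ.inv_hom_id, hid]

theorem bijective_kerMap_of_iso {X Y : CrossedModule K} (κ : X ≅ Y) :
    Function.Bijective (kerMap κ.hom) := by
  have hc : ∀ {X Y Z : CrossedModule K} (F : X ⟶ Y) (F' : Y ⟶ Z) v,
      kerMap F' (kerMap F v) = kerMap (F ≫ F') v := fun _ _ _ => rfl
  have hid : ∀ {X : CrossedModule K} v, kerMap (𝟙 X) v = v := fun _ => rfl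
  refine Function.bijective_iff_has_inverse.2 ⟨kerMap κ.inv, fun c => ?_, fun c => ?_⟩
  · rw [hc, κ.hom_inv_id, hid]
  · rw [hc, κ.inv_hom_id, hid]

/-- An isomorphism of triplets is realized by a span of elementary equivalences. -/
theorem exists_span {X Y : CrossedModule K} (E : Triplet.Iso X.triplet Y.triplet) :
    ∃ (Z : CrossedModule K) (p : Z ⟶ X) (q : Z ⟶ Y),
      Function.Bijective (cokerMap p) ∧ Function.Bijective (kerMap p) ∧
      (∀ c, cokerMap q c = E.e (cokerMap p c)) ∧ ∀ v, kerMap q v = E.f (kerMap p v) := by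
  let κ := X.toStrictIso
  let κ' := Y.toStrictIso
  let EX := tripletIso κ.hom (bijective_cokerMap_of_iso κ) (bijective_kerMap_of_iso κ)
  let EY := tripletIso κ'.hom (bijective_cokerMap_of_iso κ') (bijective_kerMap_of_iso κ')
  -- The isomorphism is realized between the associated strict algebras, where skeletal models
  -- supply a semi-strict homomorphism; its weak morphism then yields the span.
  obtain ⟨F, -, hF₀, hF₁⟩ := StrictLie2.exists_hom_of_iso ((EX.trans E).trans EY.symm)
  let W := StrictLie2.weakHom F
  refine ⟨W.apex, W.left ≫ κ.hom, W.right ≫ κ'.hom, ?_, ?_, fun c => ?_, fun v => ?_⟩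
  · have h := (bijective_cokerMap_of_iso κ).comp W.bijective_cokerMap_left
    convert h using 1
    funext c
    induction c using Submodule.Quotient.induction_on with | _ x
    rfl
  · exact (bijective_kerMap_of_iso κ).comp W.bijective_kerMap_left
  · have h := W.cokerMap_right_eq ((EX.trans E).trans EY.symm).e (fun x => (hF₀ x).symm) c
    have h' := (congrArg EY.e h).trans (EY.e.apply_symm_apply _)
    induction c using Submodule.Quotient.induction_on with | _ x
    exact h'
  · have h := W.kerMap_right_eq ((EX.trans E).trans EY.symm).f (fun v => (hF₁ v).symm) v
    exact (congrArg EY.f h).trans (EY.f.apply_symm_apply _)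

theorem eqvGen_of_iso {X Y : CrossedModule K} (E : Triplet.Iso X.triplet Y.triplet) :
    Relation.EqvGen ElementaryEquiv X Y := by
  obtain ⟨Z, p, q, hp, hp', hq, hq'⟩ := exists_span E
  refine .trans _ Z _ (.symm _ _ (.rel _ _ (elementaryEquiv_iff.2 ⟨p, hp, hp'⟩)))
    (.rel _ _ (elementaryEquiv_iff.2 ⟨q, ?_, ?_⟩))
  · rw [show (cokerMap q : Z.Coker → Y.Coker) = E.e ∘ cokerMap p from funext hq]
    exact E.e.bijective.comp hp
  · rw [show (kerMap q : Z.Ker → Y.Ker) = E.f ∘ kerMap p from funext hq']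
    exact E.f.bijective.comp hp'

/-- Elementary equivalences preserve the triplet by naturality of the class. Conversely, both legs
of the span realizing an isomorphism of triplets are elementary equivalences. -/
theorem eqvGen_iff_isomorphic {X Y : CrossedModule K} :
    Relation.EqvGen ElementaryEquiv X Y ↔ Triplet.Isomorphic X.triplet Y.triplet := by
  refine ⟨fun h => ?_, fun ⟨E⟩ => eqvGen_of_iso E⟩
  induction h with
  | rel X Y h => exact h.isomorphic
  | refl X => exact Triplet.isomorphic_equivalence.refl _
  | symm X Y _ ih => exact Triplet.isomorphic_equivalence.symm ih
  | trans X Y Z _ _ ih ih' => exact Triplet.isomorphic_equivalence.trans ih ih'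

/-- The classification of crossed modules by triplets. -/
theorem exists_bijective_quot [CharZero K] :
    ∃ b : Quot (ElementaryEquiv (K := K)) → Quot (Triplet.Isomorphic (K := K)),
      Function.Bijective b ∧ ∀ X, b (Quot.mk _ X) = Quot.mk _ X.triplet := by
  refine ⟨Quot.map triplet fun X Y h => h.isomorphic, ⟨?_, ?_⟩, fun _ => rfl⟩
  · rintro ⟨X⟩ ⟨Y⟩ h
    exact Quot.eqvGen_sound (eqvGen_iff_isomorphic.2 (Triplet.mk_eq_mk_iff.1 h))
  · rintro ⟨T⟩
    obtain ⟨M, hM⟩ := CrossedExtension.cls_surjective T.cls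
    exact ⟨Quot.mk _ M.X, Quot.sound ⟨⟨M.e, M.f, M.equivariant, hM⟩⟩⟩

end CrossedModule

namespace CrossedExtension

open CrossedModule

variable {K : Type u} [Field K] {g : Type u} [LieRing g] [LieAlgebra K g]
    {V : Type u} [AddCommGroup V] [Module K V] [LieRingModule g V] [LieModule K g V]

/-- Equality of classes makes the composite of the identifications of `M` and `N` an isomorphism of
triplets. The apex of its span is marked through the left leg, so that both legs induce the
identities of `g` and `V`. -/
theorem eqvGen_of_cls_eq {M N : CrossedExtension K g V} (h : M.cls = N.cls) :
    Relation.EqvGen ElementaryEquiv M N := by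
  have hN : ∀ x v, N.f.symm ⁅x, v⁆ = ⁅N.e.symm x, N.f.symm v⁆ := fun x v => by
    rw [LinearEquiv.symm_apply_eq, N.equivariant, N.f.apply_symm_apply, N.e.apply_symm_apply]
  have hE : ∀ (c : M.X.Coker) (v : M.X.Ker), (M.f.trans N.f.symm) ⁅c, v⁆ =
      ⁅(M.e.trans N.e.symm) c, (M.f.trans N.f.symm) v⁆ := fun c v => by
    change N.f.symm (M.f ⁅c, v⁆) = ⁅N.e.symm (M.e c), N.f.symm (M.f v)⁆
    rw [M.equivariant, hN]
  let E : Triplet.Iso M.X.triplet N.X.triplet :=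
    { e := M.e.trans N.e.symm
      f := M.f.trans N.f.symm
      equivariant := hE
      map_cls := by
        refine (H3.transport_transport M.e M.f M.equivariant N.e.symm N.f.symm hN hE _).symm.trans ?_
        refine (congrArg (H3.transport N.e.symm N.f.symm hN) h).trans ?_
        exact H3.transport_symm_transport N.e N.f N.equivariant hN _ }
  obtain ⟨Z, p, q, hp, hp', hq, hq'⟩ := exists_span E
  let P : CrossedExtension K g V :=
    { X := Z
      e := (LieEquiv.ofBijective (cokerMap p) hp).trans M.e
      f := (LinearEquiv.ofBijective (kerMap p) hp').trans M.f
      equivariant := fun c v => by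
        change M.f (kerMap p ⁅c, v⁆) = ⁅M.e (cokerMap p c), M.f (kerMap p v)⁆
        rw [kerMap_lie, M.equivariant] }
  have h₁ : ElementaryEquiv P M := by
    refine ⟨p, fun x => ?_, fun v => ?_⟩
    · exact M.e.symm_apply_apply (M.X.toCoker (Hom.ψ p x))
    · exact congrArg Subtype.val (M.f.symm_apply_apply (kerMap p v))
  have h₂ : ElementaryEquiv P N := by
    refine ⟨q, fun x => (hq (Z.toCoker x)).symm, fun v => ?_⟩
    exact congrArg Subtype.val (hq' v).symm
  exact .trans _ P _ (.symm _ _ (.rel _ _ h₁)) (.rel _ _ h₂)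

/-- The classification of crossed modules with fixed cokernel and kernel. -/
theorem exists_bijective_quot [CharZero K] :
    ∃ b : Quot (ElementaryEquiv (K := K) (g := g) (V := V)) → H3 K g V,
      Function.Bijective b ∧ ∀ M, b (Quot.mk _ M) = M.cls := by
  refine ⟨Quot.lift cls fun M N h => h.cls_eq, ⟨?_, ?_⟩, fun _ => rfl⟩
  · rintro ⟨M⟩ ⟨N⟩ h
    exact Quot.eqvGen_sound (eqvGen_of_cls_eq h)
  · intro c
    obtain ⟨M, hM⟩ := cls_surjective c
    exact ⟨Quot.mk _ M, hM⟩

end CrossedExtension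

/-! ### Agreement of the two classifications -/

namespace StrictLie2

variable {K : Type u} [Field K]

/-- Both sides amount to an isomorphism of triplets. A skeletal model of `G` composed with an
equivalence `G → H` is a skeletal model of `H`, so the two crossed modules share the triplet of one
skeletal algebra. -/
theorem equivalent_iff_eqvGen (G H : StrictLie2 K) :
    G.toSemistrict.Equivalent H.toSemistrict ↔
      Relation.EqvGen CrossedModule.ElementaryEquiv G.toCrossedModule H.toCrossedModule := by
  rw [CrossedModule.eqvGen_iff_isomorphic]
  constructor
  · rintro ⟨F, hF⟩
    obtain ⟨S, φ, hφ⟩ := G.toSemistrict.exists_skeletal_equivalence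
    obtain ⟨E, -⟩ := G.exists_iso_of_model S φ hφ
    obtain ⟨E', -⟩ := H.exists_iso_of_model S (φ.comp F) (hφ.comp hF)
    exact ⟨E.symm.trans E'⟩
  · rintro ⟨E⟩
    obtain ⟨F, hF, -⟩ := exists_hom_of_iso E
    exact ⟨F, hF⟩

end StrictLie2

end Lie2

theorem mainTheorem3 {K : Type u} [Field K] [CharZero K] :
    -- `α` is well defined and a bijection: an equivalence on objects and 1-morphisms, and a
    -- bijection on 2-morphisms
    (Lie2.StrictLie2.crossedModuleFunctor K).IsEquivalence ∧
    (∀ (G H : Lie2.StrictLie2 K) (F F' : Quiver.Hom G H), Function.Bijective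
      (Lie2.StrictLie2.TwoHom.toCrossed (F := F) (F' := F'))) ∧
    -- the class of a crossed module does not depend on the choice of sections
    (∀ (X : Lie2.CrossedModule K) (D : X.SectionData),
      (Submodule.Quotient.mk D.cocycle : Lie2.H3 K X.Coker X.Ker) = X.triplet.cls) ∧
    -- `β` induces a bijection on equivalence classes
    (∃ b : Quot (Lie2.CrossedModule.ElementaryEquiv (K := K)) →
        Quot (Lie2.Triplet.Isomorphic (K := K)),
      Function.Bijective b ∧ ∀ X, b (Quot.mk _ X) = Quot.mk _ X.triplet) ∧
    -- the same with fixed cokernel and kernel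
    (∀ (g : Type u) [LieRing g] [LieAlgebra K g] (V : Type u) [AddCommGroup V] [Module K V]
        [LieRingModule g V] [LieModule K g V],
      ∃ b : Quot (Lie2.CrossedExtension.ElementaryEquiv (K := K) (g := g) (V := V)) →
          Lie2.H3 K g V,
        Function.Bijective b ∧ ∀ M, b (Quot.mk _ M) = M.cls) ∧
    -- existence of skeletal models
    (∀ (L : Lie2.SemistrictLie2 K) (σ : L.Coker →ₗ[K] L.Obj),
      (∀ c, Submodule.Quotient.mk (σ c) = c) →
      ∃ (S : Lie2.SkeletalLie2 K) (φ : Lie2.SemistrictLie2.Hom S.toSemistrictLie2 L)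
        (e : S.Obj ≃ₗ[K] L.Coker) (f : S.Ker ≃ₗ[K] LinearMap.ker L.d),
        φ.IsEquivalence ∧ (∀ x, φ.f₀ x = σ (e x)) ∧
          ∀ v : S.Ker, φ.f₁ v = ((f v : L.Ker) : L.Arr)) ∧
    -- `γ` is a bijection, on equivalence classes or, equivalently, on isomorphism classes
    (∃ b : Quot (Lie2.SkeletalLie2.Equivalent (K := K)) →
        Quot (Lie2.Triplet.Isomorphic (K := K)),
      Function.Bijective b ∧ ∀ S, b (Quot.mk _ S) = Quot.mk _ S.triplet) ∧
    (∀ (S T : Lie2.SkeletalLie2 K)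
        (F : Lie2.SemistrictLie2.Hom S.toSemistrictLie2 T.toSemistrictLie2),
      F.IsEquivalence ↔ F.IsIso) ∧
    (∀ (S T : Lie2.SkeletalLie2 K) (e : S.Obj ≃ₗ[K] T.Obj) (f : S.Ker ≃ₗ[K] T.Ker),
      (∃ F : Lie2.SemistrictLie2.Hom S.toSemistrictLie2 T.toSemistrictLie2,
        F.IsIso ∧ (∀ x, F.f₀ x = e x) ∧ ∀ v : S.Ker, F.f₁ v = (f v : T.Arr)) ↔
      ∃ E : Lie2.Triplet.Iso S.triplet T.triplet,
        (∀ x : S.Obj, E.e x = e x) ∧ ∀ v : S.Ker, E.f v = f v) ∧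
    -- the diagram commutes: every skeletal model of a strict Lie 2-algebra has the triplet of
    -- the associated crossed module, the identification being induced by the model
    (∀ (G : Lie2.StrictLie2 K) (S : Lie2.SkeletalLie2 K)
        (φ : Lie2.SemistrictLie2.Hom S.toSemistrictLie2 G.toSemistrict), φ.IsEquivalence →
      ∃ E : Lie2.Triplet.Iso S.triplet G.toCrossedModule.triplet,
        (∀ x : S.Obj, E.e x = G.toCrossedModule.toCoker (φ.f₀ x)) ∧
        ∀ v : S.Ker, G.kerToArr (E.f v) = φ.f₁ v) ∧
    -- hence the two classifications of strict Lie 2-algebras agree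
    (∀ G H : Lie2.StrictLie2 K,
      G.toSemistrict.Equivalent H.toSemistrict ↔
        Relation.EqvGen Lie2.CrossedModule.ElementaryEquiv
          G.toCrossedModule H.toCrossedModule) := by
  refine ⟨Lie2.StrictLie2.crossedModuleFunctor_isEquivalence K,
    fun G H F F' => Lie2.StrictLie2.TwoHom.toCrossed_bijective F F',
    fun X D => Lie2.CrossedModule.mk_cocycle_eq_cls D, Lie2.CrossedModule.exists_bijective_quot,
    fun g _ _ V _ _ _ _ => Lie2.CrossedExtension.exists_bijective_quot,
    fun L σ hσ => L.exists_skeletal_model σ hσ, Lie2.SkeletalLie2.exists_bijective_quot,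
    fun S T F => Lie2.SkeletalLie2.isEquivalence_iff_isIso F,
    Lie2.SkeletalLie2.exists_isIso_iff, fun G S φ hφ => G.exists_iso_of_model S φ hφ,
    Lie2.StrictLie2.equivalent_iff_eqvGen⟩
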